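/- For an integer $m\ge 1$ let $D_{2m}$ be the dihedral group of order $2m$, $\mu_m\subset D_{2m}$ its subgroup of rotations, and $D_2=\langle\tau\rangle\subset D_{2m}$ the subgroup of order $2$ generated by a reflection $\tau$. For a finite group $G$, let $\underline{A}^{G}$ be the Burnside Tambara functor: $\underline{A}^G(X)$ is the Grothendieck group of finite $G$-sets over the finite $G$-set $X$ under disjoint union, with restrictions given by pullback, transfers by composition, and norms induced by dependent products; for a finite $G$-set $T$ let $[T]\in \underline{A}^G(G/G)$ be its class. Let $\underline{\mathbb Z}$ be the constant $D_2$-Tambara functor $\mathbb Z$, whose value at a finite $D_2$-set $X$ is the ring of $D_2$-invariant functions $X\to\mathbb Z$, with transfers and norms given by sums and products over the fibres. Let $N_{D_2}^{D_{2m}}\underline{\mathbb Z}$ be its norm, that is, the $D_{2m}$-Mackey functor obtained by left Kan extension of $\underline{\mathbb Z}$ (as a functor on spans of finite $D_2$-sets) along coinduction $\mathrm{Map}^{D_2}(D_{2m},-)$, with its induced structure of a $D_{2m}$-Tambara functor. **Theorem.** For every odd integer $m\ge 1$ (in particular for every odd prime $m=p$) there is an isomorphism of $D_{2m}$-Tambara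 functors $$N_{D_2}^{D_{2m}}\underline{\mathbb Z}\;\cong\;\underline{A}^{D_{2m}}/\bigl(2-[D_{2m}/\mu_m]\bigr),$$ where the right-hand side is the quotient of the Tambara functor $\underline{A}^{D_{2m}}$ by the ideal generated by the element $2-[D_{2m}/\mu_m]\in \underline{A}^{D_{2m}}(D_{2m}/D_{2m})$. Moreover, this quotient is also the coequalizer, as a Mackey functor, of the two maps $2,\ [D_{2m}/\mu_m]\colon \underline{A}^{D_{2m}}\rightrightarrows\underline{A}^{D_{2m}}$ given by multiplication: for every finite $D_{2m}$-set $X$, two elements $x,y\in\underline{A}^{D_{2m}}(X)$ have the same image in the quotient if and only if $x-y=(2-[D_{2m}/\mu_m])\cdot z$ for some $z\in\underline{A}^{D_{2m}}(X)$. -/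

import Mathlib

/-! ### Finite `G`-sets, pullbacks and dependent products -/

/-- A finite `G`-set. -/
structure FinGSet (G : Type) [Group G] where
  carrier : Type
  [act : MulAction G carrier]
  [fin : Finite carrier]

namespace FinGSet

instance (G : Type) [Group G] : CoeSort (FinGSet G) Type := ⟨carrier⟩
instance {G : Type} [Group G] (X : FinGSet G) : MulAction G X := X.act
instance {G : Type} [Group G] (X : FinGSet G) : Finite X := X.fin

/-- The disjoint union of two finite `G`-sets. -/
def sum {G : Type} [Group G] (X Y : FinGSet G) : FinGSet G := ⟨X ⊕ Y⟩

/-- The empty `G`-set. -/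
def empty (G : Type) [Group G] : FinGSet G :=
  letI : MulAction G Empty := { smul := fun _ x => x, one_smul := fun _ => rfl,
                                mul_smul := fun _ _ _ => rfl }
  ⟨Empty⟩

/-- The one-point `G`-set `G/G`. -/
def pt (G : Type) [Group G] : FinGSet G :=
  letI : MulAction G Unit := { smul := fun _ x => x, one_smul := fun _ => rfl,
                               mul_smul := fun _ _ _ => rfl }
  ⟨Unit⟩

/-- The orbit `G/K`. -/
def orbit {G : Type} [Group G] [Finite G] (K : Subgroup G) : FinGSet G := ⟨G ⧸ K⟩

/-- The product of two finite `G`-sets, with the diagonal action. -/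
def prod {G : Type} [Group G] (X Y : FinGSet G) : FinGSet G := ⟨X × Y⟩

/-- A finite `G`-set regarded as an `H`-set, for a subgroup `H` of `G`. -/
def restrict {G : Type} [Group G] (H : Subgroup G) (X : FinGSet G) : FinGSet H := ⟨X⟩

/-- A `G`-map regarded as an `H`-map. -/
def restrictHom {G : Type} [Group G] (H : Subgroup G) {X Y : FinGSet G} (f : X →[G] Y) :
    X.restrict H →[H] Y.restrict H :=
  ⟨fun x => f (show X from x), fun h x => map_smul f (h : G) (show X from x)⟩

def inl {G : Type} [Group G] {X Y : FinGSet G} : X →[G] X.sum Y := ⟨Sum.inl, fun _ _ => rfl⟩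
def inr {G : Type} [Group G] {X Y : FinGSet G} : Y →[G] X.sum Y := ⟨Sum.inr, fun _ _ => rfl⟩

/-- The map out of a disjoint union with given components. -/
def desc {G : Type} [Group G] {X Y Z : FinGSet G} (f : X →[G] Z) (g : Y →[G] Z) :
    X.sum Y →[G] Z :=
  ⟨Sum.elim f g, by
    rintro c (x | x)
    · exact map_smul f c x
    · exact map_smul g c x⟩

/-- The fold map. -/
def fold {G : Type} [Group G] (X : FinGSet G) : X.sum X →[G] X :=
  desc (MulActionHom.id G) (MulActionHom.id G)

/-- The unique map out of the empty `G`-set. -/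
def fromEmpty {G : Type} [Group G] (X : FinGSet G) : empty G →[G] X :=
  ⟨fun x => Empty.elim x, fun _ x => Empty.elim x⟩

/-- The unique map to the one-point `G`-set. -/
def toPt {G : Type} [Group G] (X : FinGSet G) : X →[G] pt G := ⟨fun _ => (show Unit from ()), fun _ _ => rfl⟩

def fst {G : Type} [Group G] {X Y : FinGSet G} : X.prod Y →[G] X := ⟨Prod.fst, fun _ _ => rfl⟩

def snd {G : Type} [Group G] {X Y : FinGSet G} : X.prod Y →[G] Y := ⟨Prod.snd, fun _ _ => rfl⟩

/-- The square `f ∘ f' = g ∘ g'` is a pullback square of sets. A commutative square of `G`-sets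
is a pullback square if and only if the underlying square of sets is one. -/
def IsPb {P X Y Z : Type} (f' : P → X) (g' : P → Y) (f : X → Z) (g : Y → Z) : Prop :=
  (∀ p, f (f' p) = g (g' p)) ∧ ∀ x y, f x = g y → ∃! p, f' p = x ∧ g' p = y

/-- The diagram
```
      h       e
  X <---- A <---- E
  |               |
 f|               |q
  v       p       v
  Y <------------ P
```
is an exponential diagram: `E = X ×_Y P`, and `P = ∏_f A` is the dependent product, i.e. a point
of `P` over `y : Y` is the same thing as a section `s` of `h` over the fibre `f⁻¹(y)`,
and `e : E → A` is the evaluation map `(x, s) ↦ s x`.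
A diagram of `G`-sets and `G`-maps of this shape is an exponential diagram of `G`-sets if and only
if the underlying diagram of sets is one. -/
def IsExp {A X Y E P : Type} (h : A → X) (f : X → Y) (e : E → A) (q : E → P) (p : P → Y) : Prop :=
  IsPb (fun ε => h (e ε)) q f p ∧
  ∀ (y : Y) (s : ∀ x, f x = y → A), (∀ x hx, h (s x hx) = x) →
    ∃! π, p π = y ∧ ∀ ε, q ε = π → ∀ hx, e ε = s (h (e ε)) hx

/-- The fibre product `X ×_Z Y`. -/
def pb {G : Type} [Group G] {X Y Z : FinGSet G} (f : X →[G] Z) (g : Y →[G] Z) : FinGSet G :=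
  letI : MulAction G {x : X × Y // f x.1 = g x.2} :=
    { smul := fun c x => ⟨(c • x.1.1, c • x.1.2), by
        have := x.2
        simp only [map_smul, this]⟩
      one_smul := fun x => Subtype.ext (one_smul G x.1)
      mul_smul := fun a b x => Subtype.ext (mul_smul a b x.1) }
  ⟨{x : X × Y // f x.1 = g x.2}⟩

def pbFst {G : Type} [Group G] {X Y Z : FinGSet G} (f : X →[G] Z) (g : Y →[G] Z) :
    pb f g →[G] X := ⟨fun x => x.1.1, fun _ _ => rfl⟩

def pbSnd {G : Type} [Group G] {X Y Z : FinGSet G} (f : X →[G] Z) (g : Y →[G] Z) :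
    pb f g →[G] Y := ⟨fun x => x.1.2, fun _ _ => rfl⟩

theorem isPb_pb {G : Type} [Group G] {X Y Z : FinGSet G} (f : X →[G] Z) (g : Y →[G] Z) :
    IsPb (pbFst f g) (pbSnd f g) f g :=
  ⟨fun p => p.2, fun x y h => ⟨⟨(x, y), h⟩, ⟨rfl, rfl⟩, fun _ hp =>
    Subtype.ext (Prod.ext hp.1 hp.2)⟩⟩

/-- The dependent product `∏_f A`: pairs of a point `y` and a section of `h` over `f⁻¹(y)`,
the section being given by its image, a subset of `A` which `h` maps bijectively to `f⁻¹(y)`.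
The group acts by translating `y` and the subset. -/
def expo {G : Type} [Group G] {A X Y : FinGSet G} (h : A →[G] X) (f : X →[G] Y) : FinGSet G :=
  letI : MulAction G {s : Y × Set A // Set.BijOn h s.2 (f ⁻¹' {s.1})} :=
    { smul := fun c s => ⟨(c • s.1.1, (fun a => c • a) '' s.1.2), by
        obtain ⟨⟨y, S⟩, hm, hi, hs⟩ := s
        refine ⟨?_, ?_, ?_⟩
        · rintro _ ⟨a, ha, rfl⟩
          have := hm ha
          simp only [Set.mem_preimage, Set.mem_singleton_iff, map_smul] at this ⊢
          rw [this]
        · rintro _ ⟨a, ha, rfl⟩ _ ⟨b, hb, rfl⟩ hab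
          simp only [map_smul, smul_left_cancel_iff] at hab ⊢
          exact hi ha hb hab
        · intro x hx
          have hx' : c⁻¹ • x ∈ f ⁻¹' {y} := by
            simp only [Set.mem_preimage, Set.mem_singleton_iff, map_smul] at hx ⊢
            rw [hx, inv_smul_smul]
          obtain ⟨a, ha, hax⟩ := hs hx'
          exact ⟨c • a, ⟨a, ha, rfl⟩, by rw [map_smul, hax, smul_inv_smul]⟩⟩
      one_smul := fun s => Subtype.ext (Prod.ext (one_smul G _) (by
        show (fun a => (1 : G) • a) '' s.1.2 = s.1.2
        simp))
      mul_smul := fun a b s => Subtype.ext (Prod.ext (mul_smul a b _) (by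
        show (fun x => (a * b) • x) '' s.1.2 = (fun x => a • x) '' ((fun x => b • x) '' s.1.2)
        simp [Set.image_image, mul_smul])) }
  ⟨{s : Y × Set A // Set.BijOn h s.2 (f ⁻¹' {s.1})}⟩

/-- The total space `X ×_Y ∏_f A`: a section together with a point of its image. -/
def expoE {G : Type} [Group G] {A X Y : FinGSet G} (h : A →[G] X) (f : X →[G] Y) : FinGSet G :=
  letI : MulAction G {s : expo h f × A // s.2 ∈ s.1.1.2} :=
    { smul := fun c s => ⟨(c • s.1.1, c • s.1.2), ⟨s.1.2, s.2, rfl⟩⟩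
      one_smul := fun s => Subtype.ext (one_smul G s.1)
      mul_smul := fun a b s => Subtype.ext (mul_smul a b s.1) }
  ⟨{s : expo h f × A // s.2 ∈ s.1.1.2}⟩

def expoEv {G : Type} [Group G] {A X Y : FinGSet G} (h : A →[G] X) (f : X →[G] Y) :
    expoE h f →[G] A := ⟨fun s => s.1.2, fun _ _ => rfl⟩

def expoQ {G : Type} [Group G] {A X Y : FinGSet G} (h : A →[G] X) (f : X →[G] Y) :
    expoE h f →[G] expo h f := ⟨fun s => s.1.1, fun _ _ => rfl⟩

def expoP {G : Type} [Group G] {A X Y : FinGSet G} (h : A →[G] X) (f : X →[G] Y) :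
    expo h f →[G] Y := ⟨fun s => s.1.1, fun _ _ => rfl⟩

theorem sec_congr {A X Y : Type} {f : X → Y} {y : Y} (s : ∀ x, f x = y → A) {x x' : X}
    (h : x = x') (hx : f x = y) (hx' : f x' = y) : s x hx = s x' hx' := by
  subst h; rfl

theorem isExp_expo {G : Type} [Group G] {A X Y : FinGSet G} (h : A →[G] X) (f : X →[G] Y) :
    IsExp h f (expoEv h f) (expoQ h f) (expoP h f) := by
  refine ⟨⟨?_, ?_⟩, ?_⟩
  · rintro ⟨⟨⟨⟨y, S⟩, hm, hi, hs⟩, a⟩, ha⟩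
    exact hm ha
  · rintro x ⟨⟨y, S⟩, hm, hi, hs⟩ hx
    obtain ⟨a, ha, hax⟩ := hs (show f x = y from hx)
    refine ⟨⟨(⟨(y, S), hm, hi, hs⟩, a), ha⟩, ⟨hax, rfl⟩, ?_⟩
    rintro ⟨⟨s, b⟩, hb⟩ ⟨hbx, hs'⟩
    have hs' : s = ⟨(y, S), hm, hi, hs⟩ := hs'
    subst hs'
    have : b = a := hi hb ha (Eq.trans hbx hax.symm)
    subst this; rfl
  · intro y s hs
    have key : Set.BijOn h {a | ∃ x hx, s x hx = a} (f ⁻¹' {y}) := by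
      refine ⟨?_, ?_, ?_⟩
      · rintro _ ⟨x, hx, rfl⟩
        simpa [hs x hx] using hx
      · rintro _ ⟨x, hx, rfl⟩ _ ⟨x', hx', rfl⟩ hh
        have : x = x' := by simpa [hs] using hh
        subst this; rfl
      · intro x hx
        exact ⟨s x hx, ⟨x, hx, rfl⟩, hs x hx⟩
    refine ⟨⟨(y, _), key⟩, ⟨rfl, ?_⟩, ?_⟩
    · rintro ⟨⟨t, a⟩, ha⟩ rfl hx
      obtain ⟨x, hx', h1⟩ := ha
      have h1 : s x hx' = a := h1
      subst h1
      show s x hx' = s (h (s x hx')) hx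
      exact sec_congr s (hs x hx').symm hx' hx
    · rintro ⟨⟨y', S⟩, hS⟩ ⟨hy, hS'⟩
      have hy : y' = y := hy
      subst hy
      refine Subtype.ext (Prod.ext rfl ?_)
      ext a
      constructor
      · intro ha
        exact ⟨h a, hS.1 ha, (hS' ⟨(⟨(y', S), hS⟩, a), ha⟩ rfl (hS.1 ha)).symm⟩
      · rintro ⟨x, hx, rfl⟩
        obtain ⟨a, ha, hax⟩ := hS.2.2 hx
        have := hS' ⟨(⟨(y', S), hS⟩, a), ha⟩ rfl (hS.1 ha)
        have h2 : a = s (h a) (hS.1 ha) := this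
        subst hax
        rw [← h2]; exact ha

end FinGSet

/-! ### Elementary facts on pullback squares and exponential diagrams -/

namespace FinGSet

theorem IsPb.ext {P X Y Z : Type} {f' : P → X} {g' : P → Y} {f : X → Z} {g : Y → Z}
    (H : IsPb f' g' f g) {a b : P} (h1 : f' a = f' b) (h2 : g' a = g' b) : a = b :=
  (H.2 (f' b) (g' b) (H.1 b)).unique ⟨h1, h2⟩ ⟨rfl, rfl⟩

theorem IsPb.paste {Q P X Y Z W : Type} {f' : P → X} {g' : P → Y} {f : X → Z} {g : Y → Z}
    {u : Q → P} {v : Q → W} {w : W → Y} (H : IsPb f' g' f g) (H' : IsPb u v g' w) :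
    IsPb (fun x => f' (u x)) v f (fun x => g (w x)) := by
  refine ⟨fun p => by rw [H.1, H'.1], fun x y h => ?_⟩
  obtain ⟨p, ⟨hp1, hp2⟩, _⟩ := H.2 x (w y) h
  obtain ⟨q, ⟨hq1, hq2⟩, _⟩ := H'.2 p y hp2
  refine ⟨q, ⟨by simp only [hq1, hp1], hq2⟩, fun q' ⟨h1, h2⟩ => H'.ext (H.ext ?_ ?_) ?_⟩
  · exact h1.trans (by rw [hq1, hp1])
  · rw [H'.1, H'.1, h2, hq2]
  · rw [h2, hq2]

theorem IsPb.symm {P X Y Z : Type} {f' : P → X} {g' : P → Y} {f : X → Z} {g : Y → Z}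
    (H : IsPb f' g' f g) : IsPb g' f' g f :=
  ⟨fun p => (H.1 p).symm, fun x y h => by simpa only [and_comm] using H.2 y x h.symm⟩

/-- The left square is a pullback if the right one and the outer rectangle are. -/
theorem IsPb.left {Q P X Y Z W : Type} {f' : P → X} {g' : P → Y} {f : X → Z} {g : Y → Z}
    {u : Q → P} {v : Q → W} {w : W → Y} (H : IsPb f' g' f g)
    (H' : IsPb (fun x => f' (u x)) v f (fun x => g (w x))) (hc : ∀ x, g' (u x) = w (v x)) :
    IsPb u v g' w := by
  refine ⟨hc, fun p y h => ?_⟩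
  obtain ⟨q, ⟨h1, h2⟩, _⟩ := H'.2 (f' p) y (by rw [H.1, h])
  refine ⟨q, ⟨H.ext h1 (by rw [hc, h2, h]), h2⟩, fun q' ⟨h3, h4⟩ => H'.ext ?_ ?_⟩
  · simp only [h3, h1]
  · rw [h4, h2]

theorem isPb_of_bijective {A B C : Type} (p : A → C) (q : B → C) (φ : A → B)
    (hφ : Function.Bijective φ) (h : ∀ a, q (φ a) = p a) : IsPb φ p q id := by
  refine ⟨h, fun b c hbc => ?_⟩
  obtain ⟨a, rfl⟩ := hφ.2 b
  exact ⟨a, ⟨rfl, by rw [← h a]; exact hbc⟩, fun a' h' => hφ.1 h'.1⟩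

section

variable {A X Y E P : Type} {h : A → X} {f : X → Y} {e : E → A} {q : E → P} {p : P → Y}

theorem IsExp.comm (H : IsExp h f e q p) (ε : E) : f (h (e ε)) = p (q ε) := H.1.1 ε

theorem IsExp.inj (H : IsExp h f e q p) {ε ε' : E} (h1 : q ε = q ε') (h2 : h (e ε) = h (e ε')) :
    ε = ε' := H.1.ext h2 h1

theorem IsExp.exists_pt (H : IsExp h f e q p) {x : X} {π : P} (hx : f x = p π) :
    ∃ ε, q ε = π ∧ h (e ε) = x := by
  obtain ⟨ε, h, -⟩ := H.1.2 x π hx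
  exact ⟨ε, h.2, h.1⟩

theorem IsExp.ext (H : IsExp h f e q p) {π π' : P} (hp : p π = p π')
    (hh : ∀ ε, q ε = π → ∃ ε', q ε' = π' ∧ e ε' = e ε) : π = π' := by
  choose ε hε1 hε2 using fun (x : X) (hx : f x = p π') => H.exists_pt (x := x) hx
  refine (H.2 (p π') (fun x hx => e (ε x hx)) hε2).unique ⟨hp, ?_⟩ ⟨rfl, ?_⟩
  · intro δ hδ hx
    obtain ⟨δ', h1, h2⟩ := hh δ hδ
    exact h2.symm.trans (congrArg e (H.inj (by rw [h1, hε1]) (by rw [hε2, h2])))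
  · intro δ hδ hx
    exact congrArg e (H.inj (by rw [hδ, hε1]) (hε2 _ hx).symm)

theorem IsExp.exists_sec (H : IsExp h f e q p) (y : Y) (T : A → Prop)
    (h2 : ∀ x, f x = y → ∃ a, T a ∧ h a = x) :
    ∃ π, p π = y ∧ ∀ ε, q ε = π → T (e ε) := by
  choose a ha1 ha2 using h2
  obtain ⟨π, ⟨hπ, hπ'⟩, -⟩ := H.2 y a ha2
  refine ⟨π, hπ, fun ε hε => ?_⟩
  rw [hπ' ε hε (by rw [H.comm, hε, hπ])]
  exact ha1 _ _

theorem IsExp.mk' (hc : ∀ ε, f (h (e ε)) = p (q ε))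
    (hi : ∀ ε ε', q ε = q ε' → h (e ε) = h (e ε') → ε = ε')
    (hx : ∀ x π, f x = p π → ∃ ε, q ε = π ∧ h (e ε) = x)
    (ext : ∀ π π', p π = p π' → (∀ ε, q ε = π → ∃ ε', q ε' = π' ∧ e ε' = e ε) → π = π')
    (ex : ∀ y (T : A → Prop), (∀ a a', T a → T a' → h a = h a' → a = a') →
      (∀ a, T a → f (h a) = y) →
      (∀ x, f x = y → ∃ a, T a ∧ h a = x) → ∃ π, p π = y ∧ ∀ ε, q ε = π → T (e ε)) :
    IsExp h f e q p := by
  refine ⟨⟨hc, fun x π hh => ?_⟩, fun y s hs => ?_⟩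
  · obtain ⟨ε, h1, h2⟩ := hx x π hh
    exact ⟨ε, ⟨h2, h1⟩, fun ε' ⟨h3, h4⟩ => hi _ _ (by rw [h4, h1]) (h3.trans h2.symm)⟩
  · obtain ⟨π, hπ1, hπ2⟩ := ex y (fun a => ∃ x hx, s x hx = a)
      (by
        rintro _ _ ⟨x, hx, rfl⟩ ⟨x', hx', rfl⟩ hh
        rw [hs, hs] at hh
        exact sec_congr s hh _ _)
      (by rintro _ ⟨x, hx, rfl⟩; rw [hs, hx])
      (fun x hx => ⟨s x hx, ⟨x, hx, rfl⟩, hs x hx⟩)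
    have key : ∀ ε, q ε = π → ∀ hx, e ε = s (h (e ε)) hx := by
      intro ε hε hx
      obtain ⟨x, hx', h1⟩ := hπ2 ε hε
      exact h1.symm.trans (sec_congr s (by rw [← h1, hs]) hx' hx)
    refine ⟨π, ⟨hπ1, key⟩, fun π' ⟨h1, h2⟩ => (ext _ _ (by rw [hπ1, h1]) fun ε hε => ?_).symm⟩
    have hy : f (h (e ε)) = y := by rw [hc, hε, hπ1]
    obtain ⟨ε', h3, h4⟩ := hx (h (e ε)) π' (by rw [hy, h1])
    refine ⟨ε', h3, ?_⟩
    rw [key ε hε hy, h2 ε' h3 (by rw [h4, hy])]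
    exact sec_congr s h4 _ _

theorem isExp_id (p : A → X) : IsExp p (fun x => x) (fun x => x) (fun x => x) p := by
  refine IsExp.mk' (fun _ => rfl) (fun _ _ h _ => h) (fun x π h => ⟨π, rfl, h.symm⟩)
    (fun π π' _ h => ?_) fun y T _ _ h => ?_
  · obtain ⟨_, h1, h2⟩ := h π rfl
    rw [← h1, ← h2]
  · obtain ⟨a, h1, h2⟩ := h y rfl
    exact ⟨a, h2, by rintro _ rfl; exact h1⟩

theorem IsExp.comp {Z E₂ P₂ E₃ : Type} {g : Y → Z} {e₂ : E₂ → P} {q₂ : E₂ → P₂} {p₂ : P₂ → Z}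
    {u : E₃ → E} {v : E₃ → E₂} (H : IsExp h f e q p) (H₂ : IsExp p g e₂ q₂ p₂)
    (H₃ : IsPb u v q e₂) :
    IsExp h (fun x => g (f x)) (fun x => e (u x)) (fun x => q₂ (v x)) p₂ := by
  have c3 := H₃.1
  refine IsExp.mk' ?_ ?_ ?_ ?_ ?_
  · intro ε; rw [H.comm, c3, H₂.comm]
  · intro ε ε' h1 h2
    have hv : v ε = v ε' := H₂.inj h1 (by rw [← c3, ← c3, ← H.comm, ← H.comm, h2])
    exact H₃.ext (H.inj (by rw [c3, c3, hv]) h2) hv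
  · intro x π hx
    obtain ⟨ε₂, h1, h2⟩ := H₂.exists_pt hx
    obtain ⟨ε₁, h3, h4⟩ := H.exists_pt h2.symm
    obtain ⟨ε, ⟨h5, h6⟩, -⟩ := H₃.2 ε₁ ε₂ h3
    exact ⟨ε, by rw [h6, h1], by rw [h5, h4]⟩
  · intro π π' hp hh
    refine H₂.ext hp fun ε₂ hε₂ => ?_
    obtain ⟨ε₂', h1, h2⟩ := H₂.exists_pt (x := p (e₂ ε₂)) (π := π') (by rw [H₂.comm, hε₂, hp])
    refine ⟨ε₂', h1, ?_⟩
    refine (H.ext h2.symm fun ε₁ hε₁ => ?_).symm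
    obtain ⟨ε, ⟨h5, h6⟩, -⟩ := H₃.2 ε₁ ε₂ hε₁
    obtain ⟨ε', h7, h8⟩ := hh ε (by rw [h6, hε₂])
    have : v ε' = ε₂' := H₂.inj (by rw [h7, h1])
      (by rw [h2, ← c3, ← H.comm, h8, h5, H.comm, hε₁])
    exact ⟨u ε', by rw [c3, this], by rw [h8, h5]⟩
  · intro z T hT hz hT'
    have key : ∀ y, g y = z → ∃ π, (g (p π) = z ∧ ∀ ε, q ε = π → T (e ε)) ∧ p π = y := by
      intro y hy
      obtain ⟨π, h1, h2⟩ := H.exists_sec y (fun a => T a)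
        (fun x hx => by
          obtain ⟨a, ha, hax⟩ := hT' x (by rw [hx, hy])
          exact ⟨a, ha, hax⟩)
      exact ⟨π, ⟨by rw [h1, hy], h2⟩, h1⟩
    obtain ⟨π, h1, h2⟩ := H₂.exists_sec z _ key
    exact ⟨π, h1, fun ε hε => (h2 (v ε) hε).2 (u ε) (c3 ε)⟩

theorem IsExp.baseChange {Y' P' X' A' E' : Type} {g : Y' → Y} {a : P' → P} {p' : P' → Y'}
    {x₁ : X' → X} {f' : X' → Y'} {a₁ : A' → A} {h' : A' → X'} {e₁ : E' → E} {q' : E' → P'}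
    {e' : E' → A'} (H : IsExp h f e q p) (HP : IsPb a p' p g) (HX : IsPb x₁ f' f g)
    (HA : IsPb a₁ h' h x₁) (HE : IsPb e₁ q' q a) (c : ∀ ε, a₁ (e' ε) = e (e₁ ε))
    (c' : ∀ ε, f' (h' (e' ε)) = p' (q' ε)) : IsExp h' f' e' q' p' := by
  have k : ∀ ε, x₁ (h' (e' ε)) = h (e (e₁ ε)) := fun ε => by rw [← HA.1, c]
  refine IsExp.mk' c' ?_ ?_ ?_ ?_
  · intro ε ε' h1 h2
    exact HE.ext (H.inj (by rw [HE.1, HE.1, h1]) (by rw [← k, ← k, h2])) h1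
  · intro x π hx
    obtain ⟨ε, h1, h2⟩ := H.exists_pt (x := x₁ x) (π := a π) (by rw [HX.1, HP.1, hx])
    obtain ⟨ε', ⟨h3, h4⟩, -⟩ := HE.2 ε π h1
    exact ⟨ε', h4, HX.ext (by rw [k, h3, h2]) (by rw [c', h4, hx])⟩
  · intro π π' hp hh
    refine HP.ext (H.ext (by rw [HP.1, HP.1, hp]) fun ε hε => ?_) hp
    obtain ⟨ε', ⟨h3, h4⟩, -⟩ := HE.2 ε π hε
    obtain ⟨ε'', h5, h6⟩ := hh ε' h4
    exact ⟨e₁ ε'', by rw [HE.1, h5], by rw [← c, h6, c, h3]⟩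
  · intro y T hT hy hT'
    obtain ⟨π, h1, h2⟩ := H.exists_sec (g y) (fun b => ∃ b', T b' ∧ a₁ b' = b) (fun x hx => by
      obtain ⟨x', ⟨hx1, hx2⟩, -⟩ := HX.2 x y hx
      obtain ⟨b, hb1, hb2⟩ := hT' x' hx2
      exact ⟨a₁ b, ⟨b, hb1, rfl⟩, by rw [HA.1, hb2, hx1]⟩)
    obtain ⟨π', ⟨h3, h4⟩, -⟩ := HP.2 π y h1
    refine ⟨π', h4, fun ε hε => ?_⟩
    obtain ⟨b, hb1, hb2⟩ := h2 (e₁ ε) (by rw [HE.1, hε, h3])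
    have : b = e' ε := HA.ext (by rw [hb2, c])
      (HX.ext (by rw [k, ← HA.1, hb2]) (by rw [hy b hb1, c', hε, h4]))
    rw [← this]; exact hb1

theorem IsExp.transfer {B BE E₂ P₂ : Type} {k : B → A} {b₁ : BE → B} {b₂ : BE → E} {e₂ : E₂ → BE}
    {q₂ : E₂ → P₂} {p₂ : P₂ → P} (H : IsExp h f e q p) (HB : IsPb b₁ b₂ k e)
    (H₂ : IsExp b₂ q e₂ q₂ p₂) :
    IsExp (fun b => h (k b)) f (fun x => b₁ (e₂ x)) q₂ (fun x => p (p₂ x)) := by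
  have c := HB.1
  refine IsExp.mk' ?_ ?_ ?_ ?_ ?_
  · intro ε; rw [c, H.comm, H₂.comm]
  · intro ε ε' h1 h2
    exact H₂.inj h1 (H.inj (by rw [H₂.comm, H₂.comm, h1]) (by rw [← c, ← c, h2]))
  · intro x π hx
    obtain ⟨ε, h1, h2⟩ := H.exists_pt hx
    obtain ⟨ε', h3, h4⟩ := H₂.exists_pt h1
    exact ⟨ε', h3, by rw [c, h4, h2]⟩
  · intro π π' hp hh
    have hp2 : p₂ π = p₂ π' := H.ext hp fun ε hε => by
      obtain ⟨ε₂, h1, h2⟩ := H₂.exists_pt hε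
      obtain ⟨ε₂', h3, h4⟩ := hh ε₂ h1
      exact ⟨b₂ (e₂ ε₂'), by rw [H₂.comm, h3], by rw [← c, h4, c, h2]⟩
    refine H₂.ext hp2 fun ε hε => ?_
    obtain ⟨ε', h3, h4⟩ := hh ε hε
    refine ⟨ε', h3, HB.ext h4 (H.inj ?_ ?_)⟩
    · rw [H₂.comm, H₂.comm, h3, hε, hp2]
    · rw [← c, ← c, h4]
  · intro y T hT hy hT'
    obtain ⟨π, h1, h2⟩ := H.exists_sec y (fun a => ∃ b, T b ∧ k b = a) (fun x hx => by
      obtain ⟨b, hb1, hb2⟩ := hT' x hx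
      exact ⟨k b, ⟨b, hb1, rfl⟩, hb2⟩)
    obtain ⟨π₂, h3, h4⟩ := H₂.exists_sec π (fun β => T (b₁ β)) (fun ε hε => by
      obtain ⟨b, hb1, hb2⟩ := h2 ε hε
      obtain ⟨β, ⟨h5, h6⟩, -⟩ := HB.2 b ε hb2
      exact ⟨β, by rwa [h5], h6⟩)
    exact ⟨π₂, by rw [h3, h1], h4⟩

end

section

variable {G : Type} [Group G]

theorem exists_hom {Q P : FinGSet G} (ρ : Q → P → Prop)
    (hρ : ∀ (g : G) x y, ρ x y → ρ (g • x) (g • y)) (h : ∀ x, ∃! y, ρ x y) :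
    ∃ φ : Q →[G] P, ∀ x, ρ x (φ x) := by
  choose φ h1 h2 using h
  exact ⟨⟨φ, fun g x => (h2 _ _ (hρ g _ _ (h1 x))).symm⟩, h1⟩

theorem IsPb.lift {Q P X Y Z : FinGSet G} {f' : P →[G] X} {g' : P →[G] Y} {f : X →[G] Z}
    {g : Y →[G] Z} (H : IsPb f' g' f g) (u : Q →[G] X) (v : Q →[G] Y) (h : ∀ x, f (u x) = g (v x)) :
    ∃ φ : Q →[G] P, (∀ x, f' (φ x) = u x) ∧ ∀ x, g' (φ x) = v x := by
  obtain ⟨φ, hφ⟩ := exists_hom (fun x y => f' y = u x ∧ g' y = v x)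
    (fun c x y hxy => by simp only [map_smul, hxy, and_self]) (fun x => H.2 _ _ (h x))
  exact ⟨φ, fun x => (hφ x).1, fun x => (hφ x).2⟩

theorem IsPb.lift_bijective {Q P X Y Z : FinGSet G} {f' : P →[G] X} {g' : P →[G] Y} {f : X →[G] Z}
    {g : Y →[G] Z} {u : Q →[G] X} {v : Q →[G] Y} (H : IsPb f' g' f g) (H' : IsPb u v f g) :
    ∃ φ : Q →[G] P, Function.Bijective φ ∧ (∀ x, f' (φ x) = u x) ∧ ∀ x, g' (φ x) = v x := by
  obtain ⟨φ, h1, h2⟩ := H.lift u v H'.1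
  refine ⟨φ, ⟨fun x y h => H'.ext (by rw [← h1, ← h1, h]) (by rw [← h2, ← h2, h]), fun p => ?_⟩,
    h1, h2⟩
  obtain ⟨x, ⟨h3, h4⟩, -⟩ := H'.2 (f' p) (g' p) (H.1 p)
  exact ⟨x, H.ext (by rw [h1, h3]) (by rw [h2, h4])⟩

theorem IsExp.lift {A X Y E P Q EQ : FinGSet G} {h : A →[G] X} {f : X →[G] Y} {e : E →[G] A}
    {q : E →[G] P} {p : P →[G] Y} (H : IsExp h f e q p) (eQ : EQ →[G] A) (qQ : EQ →[G] Q)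
    (pQ : Q →[G] Y) (HQ : IsPb (fun ε => h (eQ ε)) qQ f pQ) :
    ∃ (φ : Q →[G] P) (ψ : EQ →[G] E), (∀ x, p (φ x) = pQ x) ∧ (∀ x, e (ψ x) = eQ x) ∧
      IsPb ψ qQ q φ := by
  obtain ⟨φ, hφ⟩ := exists_hom
    (fun x π => p π = pQ x ∧ ∀ ε, qQ ε = x → ∃ ε', q ε' = π ∧ e ε' = eQ ε)
    (by
      rintro c x π ⟨h1, h2⟩
      refine ⟨by simp only [map_smul, h1], fun ε hε => ?_⟩
      obtain ⟨ε', h3, h4⟩ := h2 (c⁻¹ • ε) (by rw [map_smul, hε, inv_smul_smul])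
      exact ⟨c • ε', by rw [map_smul, h3], by rw [map_smul, h4, map_smul, smul_inv_smul]⟩)
    (by
      intro x
      obtain ⟨π, h1, h2⟩ := H.exists_sec (pQ x) (fun a => ∃ ε, qQ ε = x ∧ eQ ε = a) (fun z hz => by
        obtain ⟨ε, ⟨h3, h4⟩, -⟩ := HQ.2 z x hz
        exact ⟨eQ ε, ⟨ε, h4, rfl⟩, h3⟩)
      refine ⟨π, ⟨h1, fun ε hε => ?_⟩, ?_⟩
      · obtain ⟨ε', h3, h4⟩ := H.exists_pt (x := h (eQ ε)) (π := π) (by rw [HQ.1, hε, h1])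
        obtain ⟨ε'', h5, h6⟩ := h2 ε' h3
        have : ε'' = ε := HQ.ext (by simp only [h6, h4]) (by rw [h5, hε])
        exact ⟨ε', h3, by rw [← h6, this]⟩
      · rintro π' ⟨h3, h4⟩
        refine (H.ext (by rw [h1, h3]) fun ε hε => ?_).symm
        obtain ⟨ε'', h5, h6⟩ := h2 ε hε
        rw [← h6]
        exact h4 ε'' h5)
  have key : ∀ ε, ∃! ε', q ε' = φ (qQ ε) ∧ e ε' = eQ ε := by
    intro ε
    obtain ⟨ε', h1, h2⟩ := (hφ (qQ ε)).2 ε rfl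
    exact ⟨ε', ⟨h1, h2⟩, fun ε'' ⟨h3, h4⟩ => H.inj (by rw [h1, h3]) (by rw [h2, h4])⟩
  obtain ⟨ψ, hψ⟩ := exists_hom (fun ε ε' => q ε' = φ (qQ ε) ∧ e ε' = eQ ε)
    (fun c x y hxy => by simp only [map_smul, hxy, and_self]) key
  refine ⟨φ, ψ, fun x => (hφ x).1, fun x => (hψ x).2, fun x => (hψ x).1, fun ε' x hx => ?_⟩
  obtain ⟨ε, ⟨h1, h2⟩, -⟩ := HQ.2 (h (e ε')) x (by rw [H.comm, hx, (hφ x).1])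
  have h1 : h (eQ ε) = h (e ε') := h1
  refine ⟨ε, ⟨H.inj (by rw [(hψ ε).1, h2, hx]) (by rw [(hψ ε).2, h1]), h2⟩, ?_⟩
  rintro δ ⟨h3, h4⟩
  exact HQ.ext (by simp only [h1]; rw [← h3, (hψ δ).2]) (by rw [h4, h2])

theorem IsExp.lift_bijective {A X Y E P Q EQ : FinGSet G} {h : A →[G] X} {f : X →[G] Y}
    {e : E →[G] A} {q : E →[G] P} {p : P →[G] Y} (H : IsExp h f e q p) {eQ : EQ →[G] A}
    {qQ : EQ →[G] Q} {pQ : Q →[G] Y} (HQ : IsExp h f eQ qQ pQ) :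
    ∃ (φ : Q →[G] P) (ψ : EQ →[G] E), Function.Bijective φ ∧ (∀ x, p (φ x) = pQ x) ∧
      (∀ x, e (ψ x) = eQ x) ∧ IsPb ψ qQ q φ := by
  obtain ⟨φ, ψ, h1, h2, h3⟩ := H.lift eQ qQ pQ HQ.1
  refine ⟨φ, ψ, ⟨fun x x' hx => ?_, fun π => ?_⟩, h1, h2, h3⟩
  · refine HQ.ext (by rw [← h1, ← h1, hx]) fun ε hε => ?_
    obtain ⟨ε', ⟨h4, h5⟩, -⟩ := h3.2 (ψ ε) x' (by rw [h3.1, hε, hx])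
    exact ⟨ε', h5, by rw [← h2, h4, h2]⟩
  · obtain ⟨x, h4, h5⟩ := HQ.exists_sec (p π) (fun a => ∃ ε', q ε' = π ∧ e ε' = a)
      (fun z hz => by
        obtain ⟨ε, h6, h7⟩ := H.exists_pt hz
        exact ⟨e ε, ⟨ε, h6, rfl⟩, h7⟩)
    refine ⟨x, H.ext (by rw [h1, h4]) fun ε hε => ?_⟩
    obtain ⟨δ, ⟨h6, h7⟩, -⟩ := h3.2 ε x hε
    obtain ⟨ε', h8, h9⟩ := h5 δ h7
    exact ⟨ε', h8, by rw [h9, ← h6, h2]⟩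

end

end FinGSet

/-! ### Tambara functors -/

open FinGSet

universe u v

/-- The part of the structure of a Tambara functor given by restrictions and norms: a product
preserving contravariant functor `X ↦ obj X` on finite `G`-sets, with norms `obj X → obj Y`
along every map `X → Y`, functorial and compatible with pullbacks. -/
structure NormSystem (G : Type) [Group G] where
  obj : FinGSet G → Type u
  res : ∀ {X Y : FinGSet G}, (X →[G] Y) → obj Y → obj X
  nm : ∀ {X Y : FinGSet G}, (X →[G] Y) → obj X → obj Y
  res_id : ∀ {X : FinGSet G} (x : obj X), res (MulActionHom.id G) x = x
  res_comp : ∀ {X Y Z : FinGSet G} (f : X →[G] Y) (g : Y →[G] Z) (z : obj Z),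
    res f (res g z) = res (g.comp f) z
  nm_id : ∀ {X : FinGSet G} (x : obj X), nm (MulActionHom.id G) x = x
  nm_comp : ∀ {X Y Z : FinGSet G} (f : X →[G] Y) (g : Y →[G] Z) (x : obj X),
    nm g (nm f x) = nm (g.comp f) x
  res_nm : ∀ {P X Y Z : FinGSet G} (f' : P →[G] X) (g' : P →[G] Y) (f : X →[G] Z) (g : Y →[G] Z),
    IsPb f' g' f g → ∀ x : obj X, res g (nm f x) = nm g' (res f' x)
  obj_empty : ∀ X : FinGSet G, IsEmpty X → ∃! _x : obj X, True
  obj_sum : ∀ {X Y : FinGSet G} (x : obj X) (y : obj Y),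
    ∃! z : obj (X.sum Y), res inl z = x ∧ res inr z = y

/-- A semi-Tambara functor: restrictions, transfers and norms on finite `G`-sets, turning disjoint
unions into products, where norms and transfers are functorial and compatible with pullbacks, and
the norm of a transfer is computed by exponential diagrams:
`N_f T_h = T_p N_q R_e`. -/
structure SemiTambara (G : Type) [Group G] extends NormSystem.{u} G where
  tr : ∀ {X Y : FinGSet G}, (X →[G] Y) → obj X → obj Y
  tr_id : ∀ {X : FinGSet G} (x : obj X), tr (MulActionHom.id G) x = x
  tr_comp : ∀ {X Y Z : FinGSet G} (f : X →[G] Y) (g : Y →[G] Z) (x : obj X),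
    tr g (tr f x) = tr (g.comp f) x
  res_tr : ∀ {P X Y Z : FinGSet G} (f' : P →[G] X) (g' : P →[G] Y) (f : X →[G] Z) (g : Y →[G] Z),
    IsPb f' g' f g → ∀ x : obj X, res g (tr f x) = tr g' (res f' x)
  nm_tr : ∀ {A X Y E P : FinGSet G} (h : A →[G] X) (f : X →[G] Y) (e : E →[G] A) (q : E →[G] P)
    (p : P →[G] Y), IsExp h f e q p → ∀ a : obj A, nm f (tr h a) = tr p (nm q (res e a))

/-- A Tambara functor: a semi-Tambara functor `S` for which the commutative monoids `S(X)` are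
groups. Here the sum of `x, y : S(X)` is `T_∇ z`, where `∇ : X ⊔ X → X` is the fold map
and `z : S(X ⊔ X)` is the element with components `x` and `y`, and zero is the transfer
of the unique element of `S(∅)`. -/
structure TambaraFunctor (G : Type) [Group G] extends SemiTambara.{u} G where
  exists_neg : ∀ {X : FinGSet G} (x : obj X), ∃ (z : obj (X.sum X)) (o : obj (empty G)),
    res inl z = x ∧ tr (fold X) z = tr (fromEmpty X) o

/-- An isomorphism of Tambara functors. -/
structure TambaraFunctor.Iso {G : Type} [Group G] (R : TambaraFunctor.{u} G)
    (S : TambaraFunctor.{v} G) where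
  equiv : ∀ X : FinGSet G, R.obj X ≃ S.obj X
  map_res : ∀ {X Y : FinGSet G} (f : X →[G] Y) (y : R.obj Y),
    equiv X (R.res f y) = S.res f (equiv Y y)
  map_tr : ∀ {X Y : FinGSet G} (f : X →[G] Y) (x : R.obj X),
    equiv Y (R.tr f x) = S.tr f (equiv X x)
  map_nm : ∀ {X Y : FinGSet G} (f : X →[G] Y) (x : R.obj X),
    equiv Y (R.nm f x) = S.nm f (equiv X x)

/-! ### Finite `G`-sets with labels -/

namespace NormSystem

variable {G : Type} [Group G]

/-- A finite `G`-set `A` over `Y` together with a label in `M(A)`. -/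
structure LSet (M : NormSystem.{u} G) (Y : FinGSet G) where
  A : FinGSet G
  p : A →[G] Y
  lab : M.obj A

/-- Isomorphism of labelled `G`-sets over `Y`. -/
def LSet.Isom {M : NormSystem.{u} G} {Y : FinGSet G} (s t : M.LSet Y) : Prop :=
  ∃ φ : s.A →[G] t.A, Function.Bijective φ ∧ (∀ a, t.p (φ a) = s.p a) ∧ M.res φ t.lab = s.lab

theorem LSet.Isom.symm {M : NormSystem.{u} G} {Y : FinGSet G} {s t : M.LSet Y} (h : s.Isom t) :
    t.Isom s := by
  obtain ⟨φ, hφ, h1, h2⟩ := h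
  obtain ⟨ψ, hψ⟩ := exists_hom (fun b a => φ a = b) (fun g b a h => by rw [map_smul, h])
    (fun b => by
      obtain ⟨a, rfl⟩ := hφ.2 b
      exact ⟨a, rfl, fun a' h => hφ.1 h⟩)
  have hψ' : ∀ a, ψ (φ a) = a := fun a => hφ.1 (hψ _)
  refine ⟨ψ, ⟨fun a b h => by rw [← hψ a, h, hψ], fun a => ⟨φ a, hψ' a⟩⟩,
    fun b => by rw [← h1, hψ], ?_⟩
  rw [← h2, M.res_comp]
  have : φ.comp ψ = MulActionHom.id G := MulActionHom.ext hψ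
  rw [this, M.res_id]

theorem LSet.Isom.refl {M : NormSystem.{u} G} {Y : FinGSet G} (s : M.LSet Y) : s.Isom s :=
  ⟨MulActionHom.id G, Function.bijective_id, fun _ => rfl, M.res_id _⟩

instance LSet.setoid (M : NormSystem.{u} G) (Y : FinGSet G) : Setoid (M.LSet Y) where
  r := LSet.Isom
  iseqv :=
    { refl := LSet.Isom.refl
      symm := LSet.Isom.symm
      trans := by
        rintro s t r ⟨φ, hφ, h1, h2⟩ ⟨ψ, hψ, h3, h4⟩
        exact ⟨ψ.comp φ, hψ.comp hφ, fun a => (h3 _).trans (h1 _), by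
          rw [← M.res_comp, h4, h2]⟩ }

theorem isom_res {M : NormSystem.{u} G} {Y Y' P P' : FinGSet G} {s t : M.LSet Y} (h : s.Isom t)
    {f : Y' →[G] Y} {a : P →[G] s.A} {b : P →[G] Y'} {a' : P' →[G] t.A} {b' : P' →[G] Y'}
    (H : IsPb a b s.p f) (H' : IsPb a' b' t.p f) :
    LSet.Isom (M := M) ⟨P, b, M.res a s.lab⟩ ⟨P', b', M.res a' t.lab⟩ := by
  obtain ⟨φ, hφ, h1, h2⟩ := h
  have H2 : IsPb (φ.comp a) b t.p f := by
    refine ⟨fun x => (h1 _).trans (H.1 x), fun x y hxy => ?_⟩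
    obtain ⟨x, rfl⟩ := hφ.2 x
    obtain ⟨z, ⟨h3, h4⟩, -⟩ := H.2 x y (by rw [← h1, hxy])
    exact ⟨z, ⟨congrArg φ h3, h4⟩, fun z' h' => H.ext ((hφ.1 h'.1).trans h3.symm) (h'.2.trans h4.symm)⟩
  obtain ⟨χ, hχ, h3, h4⟩ := H'.lift_bijective H2
  refine ⟨χ, hχ, h4, ?_⟩
  have : a'.comp χ = φ.comp a := MulActionHom.ext h3
  show M.res χ (M.res a' t.lab) = M.res a s.lab
  rw [M.res_comp, this, ← M.res_comp, h2]

theorem isom_nm {M : NormSystem.{u} G} {Y Y' P P' E E' : FinGSet G} {s t : M.LSet Y}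
    (h : s.Isom t) {f : Y →[G] Y'} {e : E →[G] s.A} {q : E →[G] P} {p : P →[G] Y'}
    {e' : E' →[G] t.A} {q' : E' →[G] P'} {p' : P' →[G] Y'}
    (H : IsExp s.p f e q p) (H' : IsExp t.p f e' q' p') :
    LSet.Isom (M := M) ⟨P, p, M.nm q (M.res e s.lab)⟩ ⟨P', p', M.nm q' (M.res e' t.lab)⟩ := by
  obtain ⟨φ, hφ, h1, h2⟩ := h
  have H2 : IsExp t.p f (φ.comp e) q p := by
    refine IsExp.mk' (fun ε => ?_) (fun ε ε' h3 h4 => ?_) (fun x π hx => ?_) (fun π π' hp hh => ?_)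
      (fun y T hT hy hT' => ?_)
    · show f (t.p (φ (e ε))) = _
      rw [h1, H.comm]
    · have h4 : t.p (φ (e ε)) = t.p (φ (e ε')) := h4
      rw [h1, h1] at h4
      exact H.inj h3 h4
    · obtain ⟨ε, h3, h4⟩ := H.exists_pt hx
      exact ⟨ε, h3, (h1 _).trans h4⟩
    · refine H.ext hp fun ε hε => ?_
      obtain ⟨ε', h3, h4⟩ := hh ε hε
      exact ⟨ε', h3, hφ.1 h4⟩
    · refine H.exists_sec y (fun a => T (φ a)) fun x hx => ?_
      obtain ⟨b, hb1, hb2⟩ := hT' x hx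
      obtain ⟨a, rfl⟩ := hφ.2 b
      exact ⟨a, hb1, by rw [← h1, hb2]⟩
  obtain ⟨χ, ψ, hχ, h3, h4, h5⟩ := H'.lift_bijective H2
  refine ⟨χ, hχ, h3, ?_⟩
  show M.res χ (M.nm q' (M.res e' t.lab)) = M.nm q (M.res e s.lab)
  rw [M.res_nm _ _ _ _ h5, M.res_comp]
  have : e'.comp ψ = φ.comp e := MulActionHom.ext h4
  rw [this, ← M.res_comp, h2]

/-- Isomorphism classes of labelled `G`-sets over `Y`. -/
def Free (M : NormSystem.{u} G) (Y : FinGSet G) : Type (max 1 u) := 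
  Quotient (LSet.setoid M Y)

/-- The class of a labelled `G`-set. -/
def cls {M : NormSystem.{u} G} {Y : FinGSet G} (A : FinGSet G) (p : A →[G] Y) (m : M.obj A) :
    M.Free Y := Quotient.mk _ ⟨A, p, m⟩

/-- Restriction is pullback. -/
def fRes (M : NormSystem.{u} G) {X Y : FinGSet G} (f : X →[G] Y) : M.Free Y → M.Free X :=
  Quotient.map (fun s => ⟨pb s.p f, pbSnd s.p f, M.res (pbFst s.p f) s.lab⟩)
    (fun _ _ h => isom_res h (isPb_pb _ _) (isPb_pb _ _))

/-- Transfer is composition. -/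
def fTr (M : NormSystem.{u} G) {X Y : FinGSet G} (f : X →[G] Y) : M.Free X → M.Free Y :=
  Quotient.map (fun s => ⟨s.A, f.comp s.p, s.lab⟩)
    (fun _ _ ⟨φ, h, h1, h2⟩ => ⟨φ, h, fun a => congrArg f (h1 a), h2⟩)

/-- The norm is the dependent product, labelled by the norm of the restriction of the label along
evaluation. -/
def fNm (M : NormSystem.{u} G) {X Y : FinGSet G} (f : X →[G] Y) : M.Free X → M.Free Y :=
  Quotient.map (fun s => ⟨expo s.p f, expoP s.p f, M.nm (expoQ s.p f) (M.res (expoEv s.p f) s.lab)⟩)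
    (fun _ _ h => isom_nm h (isExp_expo _ _) (isExp_expo _ _))

section

variable {M : NormSystem.{u} G}

theorem Free.ind {Y : FinGSet G} {C : M.Free Y → Prop}
    (h : ∀ (A : FinGSet G) (p : A →[G] Y) (m : M.obj A), C (cls A p m)) (x : M.Free Y) : C x :=
  Quotient.ind (fun _ => h _ _ _) x

theorem mk_eq {Y A B : FinGSet G} {p : A →[G] Y} {m : M.obj A} {q : B →[G] Y} {n : M.obj B}
    (φ : A →[G] B) (hφ : Function.Bijective φ) (h : ∀ a, q (φ a) = p a) (hm : M.res φ n = m) :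
    cls A p m = cls B q n := Quotient.sound ⟨φ, hφ, h, hm⟩

theorem mk_eq_iff {Y A B : FinGSet G} {p : A →[G] Y} {m : M.obj A} {q : B →[G] Y} {n : M.obj B} :
    cls A p m = cls B q n ↔
      ∃ φ : A →[G] B, Function.Bijective φ ∧ (∀ a, q (φ a) = p a) ∧ M.res φ n = m :=
  ⟨fun h => Quotient.exact h, fun ⟨φ, h1, h2, h3⟩ => mk_eq φ h1 h2 h3⟩

theorem fRes_mk {Y Y' A P : FinGSet G} {p : A →[G] Y} {m : M.obj A} {f : Y' →[G] Y} {a : P →[G] A}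
    {b : P →[G] Y'} (H : IsPb a b p f) : M.fRes f (cls A p m) = cls P b (M.res a m) :=
  Quotient.sound (isom_res (s := ⟨A, p, m⟩) (t := ⟨A, p, m⟩) (LSet.Isom.refl _) (isPb_pb _ _) H)

theorem fTr_mk {Y Y' A : FinGSet G} {p : A →[G] Y} {m : M.obj A} {f : Y →[G] Y'} :
    M.fTr f (cls A p m) = cls A (f.comp p) m := rfl

theorem fNm_mk {Y Y' A E P : FinGSet G} {π : A →[G] Y} {m : M.obj A} {f : Y →[G] Y'} {e : E →[G] A}
    {q : E →[G] P} {p : P →[G] Y'} (H : IsExp π f e q p) :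
    M.fNm f (cls A π m) = cls P p (M.nm q (M.res e m)) :=
  Quotient.sound (isom_nm (s := ⟨A, π, m⟩) (t := ⟨A, π, m⟩) (LSet.Isom.refl _) (isExp_expo _ _) H)

/-- The map `A ⊔ B → X ⊔ Y` induced by `A → X` and `B → Y`. -/
def sumMap {A B X Y : FinGSet G} (p : A →[G] X) (q : B →[G] Y) : A.sum B →[G] X.sum Y :=
  desc (inl.comp p) (inr.comp q)

theorem isPb_inl {A B X Y : FinGSet G} (p : A →[G] X) (q : B →[G] Y) :
    IsPb (inl : A →[G] A.sum B) p (sumMap p q) (inl : X →[G] X.sum Y) := by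
  refine ⟨fun _ => rfl, ?_⟩
  rintro (a | b) x h
  · exact ⟨a, ⟨rfl, Sum.inl_injective h⟩, fun a' h' => Sum.inl_injective h'.1⟩
  · exact absurd h Sum.inr_ne_inl

theorem isPb_inr {A B X Y : FinGSet G} (p : A →[G] X) (q : B →[G] Y) :
    IsPb (inr : B →[G] A.sum B) q (sumMap p q) (inr : Y →[G] X.sum Y) := by
  refine ⟨fun _ => rfl, ?_⟩
  rintro (a | b) x h
  · exact absurd h Sum.inl_ne_inr
  · exact ⟨b, ⟨rfl, Sum.inr_injective h⟩, fun a' h' => Sum.inr_injective h'.1⟩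

/-- If `z` has components `[A, p, m]` and `[B, q, n]`, then it is `[A ⊔ B, p ⊔ q, (m, n)]`. -/
theorem eq_mk_sum {X Y A B : FinGSet G} {p : A →[G] X} {m : M.obj A} {q : B →[G] Y} {n : M.obj B}
    {l : M.obj (A.sum B)} (hl : M.res inl l = m ∧ M.res inr l = n) {z : M.Free (X.sum Y)}
    (h1 : M.fRes inl z = cls A p m) (h2 : M.fRes inr z = cls B q n) :
    z = cls (A.sum B) (sumMap p q) l := by
  induction z using Free.ind with | h C c k =>
  rw [fRes_mk (isPb_pb _ _)] at h1 h2
  obtain ⟨φ, hφ, hφ1, hφ2⟩ := mk_eq_iff.1 h1.symm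
  obtain ⟨ψ, hψ, hψ1, hψ2⟩ := mk_eq_iff.1 h2.symm
  symm
  have c1 : ∀ x : pb c (inl : X →[G] X.sum Y), c (pbFst _ _ x) = inl (pbSnd _ _ x) := (isPb_pb c (inl : X →[G] X.sum Y)).1
  have c2 : ∀ x : pb c (inr : Y →[G] X.sum Y), c (pbFst _ _ x) = inr (pbSnd _ _ x) := (isPb_pb c (inr : Y →[G] X.sum Y)).1
  refine mk_eq (desc ((pbFst _ _).comp φ) ((pbFst _ _).comp ψ)) ⟨?_, ?_⟩ ?_ ?_
  · rintro (a | a) (b | b) h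
    · have h : pbFst _ _ (φ a) = pbFst _ _ (φ b) := h
      exact congrArg Sum.inl (hφ.1 ((isPb_pb _ _).ext h (Sum.inl_injective
        ((c1 _).symm.trans ((congrArg c h).trans (c1 _))))))
    · have h : pbFst _ _ (φ a) = pbFst _ _ (ψ b) := h
      exact absurd ((c1 _).symm.trans ((congrArg c h).trans (c2 _))) Sum.inl_ne_inr
    · have h : pbFst _ _ (ψ a) = pbFst _ _ (φ b) := h
      exact absurd ((c2 _).symm.trans ((congrArg c h).trans (c1 _))) Sum.inr_ne_inl
    · have h : pbFst _ _ (ψ a) = pbFst _ _ (ψ b) := h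
      exact congrArg Sum.inr (hψ.1 ((isPb_pb _ _).ext h (Sum.inr_injective
        ((c2 _).symm.trans ((congrArg c h).trans (c2 _))))))
  · intro x
    rcases hx : c x with y | y
    · obtain ⟨d, ⟨hd, -⟩, -⟩ := (isPb_pb c (inl : X →[G] X.sum Y)).2 x y hx
      obtain ⟨a, rfl⟩ := hφ.2 d
      exact ⟨Sum.inl a, hd⟩
    · obtain ⟨d, ⟨hd, -⟩, -⟩ := (isPb_pb c (inr : Y →[G] X.sum Y)).2 x y hx
      obtain ⟨a, rfl⟩ := hψ.2 d
      exact ⟨Sum.inr a, hd⟩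
  · rintro (a | a)
    · exact (c1 _).trans (congrArg Sum.inl (hφ1 a))
    · exact (c2 _).trans (congrArg Sum.inr (hψ1 a))
  · refine (M.obj_sum m n).unique ⟨?_, ?_⟩ hl
    · rw [M.res_comp, ← hφ2, M.res_comp]; rfl
    · rw [M.res_comp, ← hψ2, M.res_comp]; rfl

theorem fRes_inl_mk_sum {X Y A B : FinGSet G} {p : A →[G] X} {q : B →[G] Y}
    (l : M.obj (A.sum B)) : M.fRes inl (cls (A.sum B) (sumMap p q) l) = cls A p (M.res inl l) :=
  fRes_mk (isPb_inl p q)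

theorem fRes_inr_mk_sum {X Y A B : FinGSet G} {p : A →[G] X} {q : B →[G] Y}
    (l : M.obj (A.sum B)) : M.fRes inr (cls (A.sum B) (sumMap p q) l) = cls B q (M.res inr l) :=
  fRes_mk (isPb_inr p q)

end

/-- The semi-Tambara functor of isomorphism classes of finite `G`-sets with labels in `M`. -/
def free (M : NormSystem.{u} G) : SemiTambara.{max 1 u} G where
  obj := M.Free
  res := M.fRes
  nm := M.fNm
  tr := M.fTr
  res_id x := by
    induction x using Free.ind with | h A p m =>
    rw [fRes_mk (a := MulActionHom.id G) (b := p) ⟨fun _ => rfl, fun x y h => ⟨x, ⟨rfl, h⟩,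
      fun _ h' => h'.1⟩⟩, M.res_id]
  res_comp f g x := by
    induction x using Free.ind with | h A p m =>
    rw [fRes_mk (isPb_pb _ _), fRes_mk (isPb_pb _ _), M.res_comp]
    have H : IsPb ((pbFst p g).comp (pbFst (pbSnd p g) f)) (pbSnd (pbSnd p g) f) p (g.comp f) :=
      (by
        have := IsPb.paste (isPb_pb p g) (isPb_pb (pbSnd p g) f)
        exact this)
    exact (fRes_mk H).symm
  nm_id x := by
    induction x using Free.ind with | h A p m =>
    rw [fNm_mk (e := MulActionHom.id G) (q := MulActionHom.id G) (p := p) (isExp_id p), M.res_id,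
      M.nm_id]
  nm_comp f g x := by
    induction x using Free.ind with | h A p m =>
    rw [fNm_mk (isExp_expo _ _), fNm_mk (isExp_expo _ _), M.res_nm _ _ _ _ (isPb_pb _ _),
      M.nm_comp, M.res_comp]
    have H : IsExp p (g.comp f)
        ((expoEv p f).comp (pbFst (expoQ p f) (expoEv (expoP p f) g)))
        ((expoQ (expoP p f) g).comp (pbSnd (expoQ p f) (expoEv (expoP p f) g)))
        (expoP (expoP p f) g) :=
      (by
        have := IsExp.comp (isExp_expo p f) (isExp_expo (expoP p f) g) 
          (isPb_pb (expoQ p f) (expoEv (expoP p f) g))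
        exact this)
    exact (fNm_mk H).symm
  res_nm {P X Y Z} f' g' f g H x := by
    induction x using Free.ind with | h A p m =>
    rw [fNm_mk (isExp_expo _ _), fRes_mk (isPb_pb _ _), fRes_mk (isPb_pb _ _),
      M.res_nm _ _ _ _ (isPb_pb _ _), M.res_comp]
    obtain ⟨x', hx1, hx2⟩ := IsPb.lift H
      (p.comp ((expoEv p f).comp (pbFst (expoQ p f) (pbFst (expoP p f) g))))
      ((pbSnd (expoP p f) g).comp (pbSnd (expoQ p f) (pbFst (expoP p f) g))) (fun ε => by
        have h1 := (isExp_expo p f).comm (pbFst (expoQ p f) (pbFst (expoP p f) g) ε)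
        have h2 := (isPb_pb (expoQ p f) (pbFst (expoP p f) g)).1 ε
        have h3 := (isPb_pb (expoP p f) g).1 (pbSnd (expoQ p f) (pbFst (expoP p f) g) ε)
        exact h1.trans ((congrArg _ h2).trans h3))
    obtain ⟨e', he1, he2⟩ := IsPb.lift (isPb_pb p f')
      ((expoEv p f).comp (pbFst (expoQ p f) (pbFst (expoP p f) g))) x' (fun ε => (hx1 ε).symm)
    have key := IsExp.baseChange (isExp_expo p f) (isPb_pb (expoP p f) g) H (isPb_pb p f')
      (isPb_pb (expoQ p f) (pbFst (expoP p f) g)) he1 (fun ε => by rw [he2, hx2]; rfl)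
    rw [fNm_mk key, M.res_comp]
    congr 3
    exact MulActionHom.ext fun ε => (he1 ε).symm
  tr_id x := by
    induction x using Free.ind with | h A p m => rfl
  tr_comp f g x := by
    induction x using Free.ind with | h A p m => rfl
  res_tr f' g' f g H x := by
    induction x using Free.ind with | h A p m =>
    rw [fTr_mk, fRes_mk (isPb_pb _ _)]
    exact fRes_mk (IsPb.paste H.symm (isPb_pb _ _).symm).symm
  nm_tr h f e q p H x := by
    induction x using Free.ind with | h A k m =>
    have H' : IsExp (h.comp k) f ((pbFst k e).comp (expoEv (pbSnd k e) q)) (expoQ (pbSnd k e) q)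
        (p.comp (expoP (pbSnd k e) q)) :=
      (by
        have := IsExp.transfer H (isPb_pb k e) (isExp_expo (pbSnd k e) q)
        exact this)
    rw [fTr_mk, fRes_mk (isPb_pb _ _), fNm_mk H', fNm_mk (isExp_expo (pbSnd k e) q), fTr_mk,
      M.res_comp]
  obj_empty X hX := by
    obtain ⟨o, -, ho⟩ := M.obj_empty X hX
    refine ⟨cls X (MulActionHom.id G) o, trivial, fun x _ => ?_⟩
    induction x using Free.ind with | h A p m =>
    have hA : IsEmpty A := ⟨fun a => hX.elim (p a)⟩
    exact mk_eq p ⟨fun a => (hA.elim a), fun x => (hX.elim x)⟩ (fun _ => rfl)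
      ((M.obj_empty A hA).unique trivial trivial)
  obj_sum x y := by
    induction x using Free.ind with | h A p m =>
    induction y using Free.ind with | h B q n =>
    obtain ⟨l, ⟨h1, h2⟩, -⟩ := M.obj_sum m n
    refine ⟨cls (A.sum B) (sumMap p q) l, ⟨?_, ?_⟩, fun z hz => eq_mk_sum ⟨h1, h2⟩ hz.1 hz.2⟩
    · rw [fRes_inl_mk_sum, h1]
    · rw [fRes_inr_mk_sum, h2]

end NormSystem

/-! ### Quotients of Tambara functors -/

namespace SemiTambara

variable {G : Type} [Group G]

/-- The zero element of `S(X)`: the transfer of the unique element of `S(∅)`. -/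
noncomputable def zero (S : SemiTambara.{u} G) (X : FinGSet G) : S.obj X :=
  S.tr (fromEmpty X) (S.obj_empty (empty G) (inferInstanceAs (IsEmpty Empty))).choose

/-- A congruence: an equivalence relation compatible with restrictions, transfers, norms and
with the decompositions `S(X ⊔ Y) = S(X) × S(Y)`. -/
structure Congruence (S : SemiTambara.{u} G) where
  r : ∀ {X : FinGSet G}, S.obj X → S.obj X → Prop
  iseqv : ∀ {X : FinGSet G}, Equivalence (r (X := X))
  res : ∀ {X Y : FinGSet G} (f : X →[G] Y) {a b : S.obj Y}, r a b → r (S.res f a) (S.res f b)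
  tr : ∀ {X Y : FinGSet G} (f : X →[G] Y) {a b : S.obj X}, r a b → r (S.tr f a) (S.tr f b)
  nm : ∀ {X Y : FinGSet G} (f : X →[G] Y) {a b : S.obj X}, r a b → r (S.nm f a) (S.nm f b)
  sum : ∀ {X Y : FinGSet G} {a b : S.obj (X.sum Y)},
    r (S.res inl a) (S.res inl b) → r (S.res inr a) (S.res inr b) → r a b

/-- The quotient of a semi-Tambara functor by a congruence. -/
def quot (S : SemiTambara.{u} G) (c : S.Congruence) : SemiTambara.{u} G where
  obj X := Quotient (⟨c.r, c.iseqv⟩ : Setoid (S.obj X))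
  res f := Quotient.map (S.res f) (fun _ _ => c.res f)
  tr f := Quotient.map (S.tr f) (fun _ _ => c.tr f)
  nm f := Quotient.map (S.nm f) (fun _ _ => c.nm f)
  res_id x := by
    induction x using Quotient.ind
    exact congrArg (Quotient.mk _) (S.res_id _)
  res_comp _ _ x := by
    induction x using Quotient.ind
    exact congrArg (Quotient.mk _) (S.res_comp _ _ _)
  nm_id x := by
    induction x using Quotient.ind
    exact congrArg (Quotient.mk _) (S.nm_id _)
  nm_comp _ _ x := by
    induction x using Quotient.ind
    exact congrArg (Quotient.mk _) (S.nm_comp _ _ _)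
  res_nm f' g' f g H x := by
    induction x using Quotient.ind
    exact congrArg (Quotient.mk _) (S.res_nm f' g' f g H _)
  tr_id x := by
    induction x using Quotient.ind
    exact congrArg (Quotient.mk _) (S.tr_id _)
  tr_comp _ _ x := by
    induction x using Quotient.ind
    exact congrArg (Quotient.mk _) (S.tr_comp _ _ _)
  res_tr f' g' f g H x := by
    induction x using Quotient.ind
    exact congrArg (Quotient.mk _) (S.res_tr f' g' f g H _)
  nm_tr h f e q p H x := by
    induction x using Quotient.ind
    exact congrArg (Quotient.mk _) (S.nm_tr h f e q p H _)
  obj_empty X hX := by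
    obtain ⟨o, -, ho⟩ := S.obj_empty X hX
    refine ⟨Quotient.mk _ o, trivial, fun x _ => ?_⟩
    induction x using Quotient.ind
    exact congrArg (Quotient.mk _) (ho _ trivial)
  obj_sum x y := by
    induction x using Quotient.ind with | _ x =>
    induction y using Quotient.ind with | _ y =>
    obtain ⟨z, ⟨h1, h2⟩, -⟩ := S.obj_sum x y
    refine ⟨Quotient.mk _ z, ⟨congrArg (Quotient.mk _) h1, congrArg (Quotient.mk _) h2⟩, ?_⟩
    intro z' hz'
    induction z' using Quotient.ind with | _ z' =>
    refine Quotient.sound (c.sum ?_ ?_)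
    · rw [h1]; exact Quotient.exact hz'.1
    · rw [h2]; exact Quotient.exact hz'.2

/-- The smallest congruence identifying `x` and `y`. -/
inductive GenRel (S : SemiTambara.{u} G) {X₀ : FinGSet G} (x y : S.obj X₀) :
    ∀ {X : FinGSet G}, S.obj X → S.obj X → Prop
  | base : GenRel S x y x y
  | refl {X : FinGSet G} (a : S.obj X) : GenRel S x y a a
  | symm {X : FinGSet G} {a b : S.obj X} : GenRel S x y a b → GenRel S x y b a
  | trans {X : FinGSet G} {a b c : S.obj X} :
      GenRel S x y a b → GenRel S x y b c → GenRel S x y a c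
  | res {X Y : FinGSet G} (f : X →[G] Y) {a b : S.obj Y} :
      GenRel S x y a b → GenRel S x y (S.res f a) (S.res f b)
  | tr {X Y : FinGSet G} (f : X →[G] Y) {a b : S.obj X} :
      GenRel S x y a b → GenRel S x y (S.tr f a) (S.tr f b)
  | nm {X Y : FinGSet G} (f : X →[G] Y) {a b : S.obj X} :
      GenRel S x y a b → GenRel S x y (S.nm f a) (S.nm f b)
  | sum {X Y : FinGSet G} {a b : S.obj (X.sum Y)} :
      GenRel S x y (S.res inl a) (S.res inl b) → GenRel S x y (S.res inr a) (S.res inr b) →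
      GenRel S x y a b

def genCongruence (S : SemiTambara.{u} G) {X₀ : FinGSet G} (x y : S.obj X₀) : S.Congruence where
  r := GenRel S x y
  iseqv := ⟨GenRel.refl, GenRel.symm, GenRel.trans⟩
  res := GenRel.res
  tr := GenRel.tr
  nm := GenRel.nm
  sum := GenRel.sum

end SemiTambara

/-- The quotient `R/(x)` of a Tambara functor by the ideal generated by an element `x`, that is, by
the smallest congruence identifying `x` with zero. -/
noncomputable def TambaraFunctor.quotientBy {G : Type} [Group G] (R : TambaraFunctor.{u} G)
    {X₀ : FinGSet G} (x : R.obj X₀) : TambaraFunctor.{u} G where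
  toSemiTambara := R.quot (R.genCongruence x (R.zero X₀))
  exists_neg a := by
    induction a using Quotient.ind with | _ a =>
    obtain ⟨z, o, h1, h2⟩ := R.exists_neg a
    exact ⟨Quotient.mk _ z, Quotient.mk _ o, congrArg (Quotient.mk _) h1,
      congrArg (Quotient.mk _) h2⟩

/-- The projection `R → R/(x)`. -/
def TambaraFunctor.toQuotient {G : Type} [Group G] (R : TambaraFunctor.{u} G)
    {X₀ : FinGSet G} (x : R.obj X₀) {X : FinGSet G} (a : R.obj X) : (R.quotientBy x).obj X :=
  Quotient.mk _ a

/-! ### The norm -/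

namespace NormSystem

variable {G : Type} [Group G]

/-- For a subgroup `H` of `G`, the functor `A ↦ M(res_H A)` on finite `G`-sets. -/
def onRestrict (H : Subgroup G) (M : NormSystem.{u} H) : NormSystem.{u} G where
  obj A := M.obj (A.restrict H)
  res f := M.res (restrictHom H f)
  nm f := M.nm (restrictHom H f)
  res_id := M.res_id
  res_comp _ _ := M.res_comp _ _
  nm_id := M.nm_id
  nm_comp _ _ := M.nm_comp _ _
  res_nm _ _ _ _ h := M.res_nm _ _ _ _ h
  obj_empty _ h := M.obj_empty _ h
  obj_sum := M.obj_sum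

end NormSystem

namespace TambaraFunctor

variable {G : Type} [Group G] {H : Subgroup G}

/-- For a `G`-set `A` and a map of `H`-sets `t : X → A`, this says that the `G`-set `P`, with its
maps `π : P → A` and `ev : P → X`, is the pullback of `Map^H(G, t) : Map^H(G, X) → Map^H(G, A)`
along the unit `A → Map^H(G, A)`, `a ↦ (g ↦ g a)`: a point of `P` over `a` is the same
thing as an `H`-map `F : G → X` with `t (F g) = g a` for all `g`. -/
def IsCoind {A P : FinGSet G} {X : FinGSet H} (t : X →[H] A.restrict H) (ev : P.restrict H →[H] X)
    (π : P →[G] A) : Prop :=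
  (∀ ε : P, t (ev ε) = π ε) ∧ ∀ (a : A) (F : G → X), (∀ (h : H) (g : G), F (h * g) = h • F g) →
    (∀ g : G, t (F g) = g • a) → ∃! ε : P, π ε = a ∧ ∀ g : G, ev (g • ε : P) = F g

/-- The underlying semi-Tambara functor of labelled sets of the norm of `R`. -/
abbrev preNorm (H : Subgroup G) (R : TambaraFunctor.{u} H) : SemiTambara.{max 1 u} G :=
  (NormSystem.onRestrict H R.toNormSystem).free

/-- The basic relation: `[A → Y, T_t r] = [P → A → Y, R_ev r]`. -/
inductive NStep (R : TambaraFunctor.{u} H) {Y : FinGSet G} :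
    (preNorm H R).obj Y → (preNorm H R).obj Y → Prop
  | mk {A P : FinGSet G} {X : FinGSet H} (p : A →[G] Y) (t : X →[H] A.restrict H)
      (ev : P.restrict H →[H] X) (π : P →[G] A) (r : R.obj X) (hc : IsCoind t ev π) :
      NStep R (NormSystem.cls (M := NormSystem.onRestrict H R.toNormSystem) A p (R.tr t r))
        (NormSystem.cls (M := NormSystem.onRestrict H R.toNormSystem) P (p.comp π) (R.res ev r))

/-- The equivalence relation generated by the basic relation. -/
def NRel (R : TambaraFunctor.{u} H) {Y : FinGSet G} :
    (preNorm H R).obj Y → (preNorm H R).obj Y → Prop :=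
  Relation.EqvGen (NStep R)

theorem IsCoind.ext {A P : FinGSet G} {X : FinGSet H} {t : X →[H] A.restrict H}
    {ev : P.restrict H →[H] X} {π : P →[G] A} (hc : IsCoind t ev π) {s s' : P} (h : π s = π s')
    (h' : ∀ g : G, ev (g • s : P) = ev (g • s' : P)) : s = s' := by
  refine (hc.2 (π s') (fun g => ev (g • s' : P)) (fun k g => ?_) (fun g => ?_)).unique ⟨h, h'⟩
    ⟨rfl, fun _ => rfl⟩
  · have : ((k : G) * g) • s' = (k : G) • (g • s') := mul_smul _ _ _
    rw [this]
    exact map_smul ev k (g • s' : P)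
  · exact (hc.1 _).trans (map_smul π g s')

theorem NStep.tr {R : TambaraFunctor.{u} H} {Y Y' : FinGSet G} (f : Y →[G] Y')
    {a b : (preNorm H R).obj Y} (h : NStep R a b) :
    NStep R ((preNorm H R).tr f a) ((preNorm H R).tr f b) := by
  obtain ⟨p, t, ev, π, r, hc⟩ := h
  exact NStep.mk (f.comp p) t ev π r hc

theorem NStep.res {R : TambaraFunctor.{u} H} {Y Y' : FinGSet G} (f : Y' →[G] Y)
    {a b : (preNorm H R).obj Y} (h : NStep R a b) :
    NStep R ((preNorm H R).res f a) ((preNorm H R).res f b) := by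
  obtain @⟨A, P, X, p, t, ev, π, r, hc⟩ := h
  obtain ⟨π', h1, h2⟩ := (isPb_pb p f).lift (π.comp (pbFst (p.comp π) f)) (pbSnd (p.comp π) f)
    (isPb_pb (p.comp π) f).1
  have HX := isPb_pb t (restrictHom H (pbFst p f))
  obtain ⟨ev', h3, h4⟩ := HX.lift (ev.comp (restrictHom H (pbFst (p.comp π) f)))
    (restrictHom H π') (fun x => (hc.1 _).trans (h1 x).symm)
  have hc' : IsCoind (pbSnd t (restrictHom H (pbFst p f))) ev' π' := by
    refine ⟨h4, fun a F hF hF' => ?_⟩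
    have hF2 : ∀ g : G, t (pbFst t (restrictHom H (pbFst p f)) (F g)) = g • pbFst p f a := fun g =>
      (HX.1 (F g)).trans (congrArg (pbFst p f) (hF' g))
    obtain ⟨s, ⟨hs1, hs2⟩, -⟩ := hc.2 (pbFst p f a) (fun g => pbFst t _ (F g))
      (fun k g => by rw [hF, map_smul]) hF2
    obtain ⟨s', ⟨hs3, hs4⟩, -⟩ := (isPb_pb (p.comp π) f).2 s (pbSnd p f a)
      ((congrArg p hs1).trans ((isPb_pb p f).1 a))
    have k1 : π' s' = a := (isPb_pb p f).ext ((h1 s').trans ((congrArg π hs3).trans hs1))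
      ((h2 s').trans hs4)
    refine ⟨s', ⟨k1, fun g => HX.ext ?_ ?_⟩, ?_⟩
    · refine (h3 _).trans (Eq.trans ?_ (hs2 g))
      exact congrArg ev ((map_smul (pbFst (p.comp π) f) g s').trans (congrArg (g • ·) hs3))
    · exact (h4 _).trans ((map_smul π' g s').trans ((congrArg (g • ·) k1).trans (hF' g).symm))
    · rintro s'' ⟨k2, k3⟩
      refine (isPb_pb (p.comp π) f).ext (Eq.trans ?_ hs3.symm) ?_
      · refine hc.ext ?_ fun g => ?_
        · exact (h1 s'').symm.trans ((congrArg _ k2).trans hs1.symm)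
        · refine Eq.trans ?_ ((congrArg _ (k3 g)).trans (hs2 g).symm)
          refine Eq.trans ?_ (h3 (g • s'' : pb (p.comp π) f)).symm
          exact congrArg ev (map_smul (pbFst (p.comp π) f) g s'').symm
      · exact (h2 s'').symm.trans ((congrArg _ k2).trans hs4.symm)
  have hl := NormSystem.fRes_mk (M := NormSystem.onRestrict H R.toNormSystem) (m := R.tr t r)
    (isPb_pb p f)
  have hl' := NormSystem.fRes_mk (M := NormSystem.onRestrict H R.toNormSystem) (m := R.res ev r)
    (isPb_pb (p.comp π) f)
  have e1 : (NormSystem.onRestrict H R.toNormSystem).res (pbFst p f) (R.tr t r) = R.tr _ (R.res _ r) :=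
    R.res_tr _ _ t (restrictHom H (pbFst p f)) HX r
  have e2 : (NormSystem.onRestrict H R.toNormSystem).res (pbFst (p.comp π) f) (R.res ev r) =
      R.res ev' (R.res (pbFst t (restrictHom H (pbFst p f))) r) := by
    rw [R.res_comp]
    refine (R.res_comp _ _ _).trans ?_
    congr 1
    exact MulActionHom.ext fun x => (h3 x).symm
  rw [e1] at hl
  rw [e2] at hl'
  have e3 : pbSnd (p.comp π) f = (pbSnd p f).comp π' := MulActionHom.ext fun x => (h2 x).symm
  rw [e3] at hl'
  have key := NStep.mk (pbSnd p f) _ _ _ (R.res (pbFst t (restrictHom H (pbFst p f))) r) hc'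
  rw [← hl, ← hl'] at key
  exact key

theorem NStep.nm {R : TambaraFunctor.{u} H} {Y Y' : FinGSet G} (f : Y →[G] Y')
    {a b : (preNorm H R).obj Y} (h : NStep R a b) :
    NStep R ((preNorm H R).nm f a) ((preNorm H R).nm f b) := by
  obtain @⟨A, P, X, p, t, ev, π, r, hc⟩ := h
  have HB := isExp_expo p f
  have HP := isExp_expo (p.comp π) f
  have HXE := isPb_pb t (restrictHom H (expoEv p f))
  set t' := pbSnd t (restrictHom H (expoEv p f)) with ht'
  set x' := pbFst t (restrictHom H (expoEv p f)) with hx'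
  have HW := isExp_expo t' (restrictHom H (expoQ p f))
  set w := expoP t' (restrictHom H (expoQ p f)) with hw
  set qW := expoQ t' (restrictHom H (expoQ p f)) with hqW
  set eW := expoEv t' (restrictHom H (expoQ p f)) with heW
  have HX : IsExp ((restrictHom H p).comp t) (restrictHom H f) (x'.comp eW) qW
      ((restrictHom H (expoP p f)).comp w) := by
    have := IsExp.transfer HB HXE HW
    exact this
  have HQ : IsPb (fun ε => (restrictHom H p).comp t ((ev.comp (restrictHom H (expoEv (p.comp π) f))) ε))
      (restrictHom H (expoQ (p.comp π) f)) (restrictHom H f)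
      (restrictHom H (expoP (p.comp π) f)) := by
    have : (fun ε => (restrictHom H p).comp t
        ((ev.comp (restrictHom H (expoEv (p.comp π) f))) ε)) =
        fun ε => (p.comp π) (expoEv (p.comp π) f ε) := funext fun ε => congrArg p (hc.1 _)
    rw [this]
    exact HP.1
  obtain ⟨ev'', ψ'', k1, k2, k3⟩ := HX.lift _ _ _ HQ
  obtain ⟨π'', ψ, k4, k5, k6⟩ := HB.lift (π.comp (expoEv (p.comp π) f)) (expoQ (p.comp π) f)
    (expoP (p.comp π) f) HP.1
  have k7 : ∀ β, w (ev'' β) = π'' β := by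
    intro β
    refine HB.ext ((k1 β).trans (k4 β).symm) fun ε hε => ?_
    obtain ⟨δ, h1, h2⟩ := HW.exists_pt (x := ε) (π := ev'' β) hε
    obtain ⟨εP, ⟨h3, h4⟩, -⟩ := k3.2 δ β h1
    refine ⟨ψ εP, (k6.1 εP).trans (congrArg π'' h4), (k5 εP).trans ?_⟩
    have h5 := (hc.1 (expoEv (p.comp π) f εP)).symm.trans (congrArg t (k2 εP).symm)
    refine h5.trans ((HXE.1 _).trans ?_)
    show expoEv p f (t' (eW (ψ'' εP))) = _
    rw [h3, h2]
  have hc'' : IsCoind w ev'' π'' := by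
    refine ⟨k7, fun b₀ F hF hF' => ?_⟩
    obtain ⟨β, hβ1, hβ2⟩ := HP.exists_sec (expoP p f b₀)
      (fun s => ∃ ε₀, expoQ p f ε₀ = b₀ ∧ π s = expoEv p f ε₀ ∧ ∀ g : G, ∃ δ, qW δ = F g ∧
        t' (eW δ) = g • ε₀ ∧ x' (eW δ) = ev (g • s : P)) (by
        intro y hy
        obtain ⟨ε₀, h1, h2⟩ := HB.exists_pt hy
        have hq : ∀ g : G, expoQ p f (g • ε₀) = w (F g) := fun g => by
          rw [hF', map_smul, h1]
        choose δ hδ1 hδ2 using fun g : G => HW.exists_pt (x := g • ε₀) (π := F g) (hq g)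
        obtain ⟨s, ⟨hs1, hs2⟩, -⟩ := hc.2 (expoEv p f ε₀) (fun g => x' (eW (δ g)))
          (fun k g => by
            rw [← map_smul, ← map_smul]
            congr 2
            refine HW.inj ?_ ?_
            · rw [map_smul, hδ1, hδ1, hF]
            · rw [hδ2, map_smul, map_smul, hδ2]
              exact mul_smul (k : G) g ε₀)
          (fun g => by
            refine (HXE.1 _).trans ?_
            refine (congrArg (expoEv p f) (hδ2 g)).trans ?_
            exact map_smul _ _ _)
        refine ⟨s, ⟨ε₀, h1, hs1, fun g => ⟨δ g, hδ1 g, hδ2 g, (hs2 g).symm⟩⟩, ?_⟩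
        exact (congrArg p hs1).trans h2)
    have u1 : π'' β = b₀ := by
      refine HB.ext ((k4 β).trans hβ1) fun ε hε => ?_
      obtain ⟨εP, ⟨h3, h4⟩, -⟩ := k6.2 ε β hε
      obtain ⟨ε₀, h5, h6, -⟩ := hβ2 εP h4
      refine ⟨ε₀, h5, h6.symm.trans ?_⟩
      rw [← h3]
      exact (k5 εP).symm
    have u2 : ∀ g : G, ev'' (g • β : expo (p.comp π) f) = F g := by
      intro g
      refine HX.ext ?_ fun δ hδ => ?_
      · refine (k1 _).trans ?_
        refine (map_smul (expoP (p.comp π) f) g β).trans ?_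
        refine Eq.trans ?_ (congrArg (expoP p f) (hF' g)).symm
        rw [hβ1, map_smul]
      · obtain ⟨εP', ⟨h3, h4⟩, -⟩ := k3.2 δ _ hδ
        have h4 : expoQ (p.comp π) f εP' = g • β := h4
        obtain ⟨ε₀, -, -, h5⟩ := hβ2 (g⁻¹ • (show expoE (p.comp π) f from εP'))
          (by rw [map_smul, h4, inv_smul_smul])
        obtain ⟨δ', h6, -, h7⟩ := h5 g
        refine ⟨δ', h6, h7.trans ?_⟩
        rw [map_smul, smul_inv_smul, ← h3]
        exact (k2 εP').symm
    refine ⟨β, ⟨u1, u2⟩, ?_⟩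
    rintro β' ⟨v1, v2⟩
    refine (HP.ext ?_ fun εP hεP => ?_).symm
    · rw [← k4, ← k4, u1, v1]
    · obtain ⟨εP', h1, h2⟩ := HP.exists_pt (x := (p.comp π) (expoEv (p.comp π) f εP)) (π := β')
        (by rw [HP.comm, hεP, ← k4, ← k4, u1, v1])
      refine ⟨εP', h1, hc.ext ?_ fun g => ?_⟩
      · have : ψ εP' = ψ εP := HB.inj
          (by rw [k6.1, k6.1, h1, hεP, u1, v1])
          ((congrArg p (k5 εP')).trans (h2.trans (congrArg p (k5 εP)).symm))
        exact (k5 εP').symm.trans ((congrArg _ this).trans (k5 εP))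
      · have hg : ∀ ζ : expoE (p.comp π) f, ev (g • expoEv (p.comp π) f ζ : P) =
            x' (eW (ψ'' (g • ζ : expoE (p.comp π) f))) := fun ζ =>
          (congrArg ev (map_smul (expoEv (p.comp π) f) g ζ).symm).trans
            (k2 (g • ζ : expoE (p.comp π) f)).symm
        rw [hg, hg]
        have hp : ∀ ζ : expoE (p.comp π) f,
            ((restrictHom H p).comp t) ((x'.comp eW) (ψ'' ζ)) =
              (p.comp π) (expoEv (p.comp π) f ζ) := fun ζ =>
          congrArg p ((congrArg t (k2 ζ)).trans (hc.1 _))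
        congr 2
        refine HX.inj ?_ ?_
        · refine (k3.1 _).trans (Eq.trans ?_ (k3.1 _).symm)
          have e1 : expoQ (p.comp π) f (g • εP') = g • β' := by rw [map_smul, h1]
          have e2 : expoQ (p.comp π) f (g • εP) = g • β := by rw [map_smul, hεP]
          exact (congrArg ev'' e1).trans ((v2 g).trans ((u2 g).symm.trans
            (congrArg ev'' e2.symm)))
        · refine (hp _).trans (Eq.trans ?_ (hp _).symm)
          rw [map_smul, map_smul, map_smul, map_smul, h2]
  have hl := NormSystem.fNm_mk (M := NormSystem.onRestrict H R.toNormSystem) (m := R.tr t r) HB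
  have hl' := NormSystem.fNm_mk (M := NormSystem.onRestrict H R.toNormSystem) (m := R.res ev r) HP
  have e1 : (NormSystem.onRestrict H R.toNormSystem).nm (expoQ p f)
      ((NormSystem.onRestrict H R.toNormSystem).res (expoEv p f) (R.tr t r)) =
      R.tr w (R.nm qW (R.res eW (R.res x' r))) := by
    have a1 : (NormSystem.onRestrict H R.toNormSystem).res (expoEv p f) (R.tr t r) =
      R.tr t' (R.res x' r) := R.res_tr _ _ t (restrictHom H (expoEv p f)) HXE r
    rw [a1]
    exact R.nm_tr _ _ _ _ _ HW _
  have e2 : (NormSystem.onRestrict H R.toNormSystem).nm (expoQ (p.comp π) f)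
      ((NormSystem.onRestrict H R.toNormSystem).res (expoEv (p.comp π) f) (R.res ev r)) =
      R.res ev'' (R.nm qW (R.res eW (R.res x' r))) := by
    rw [R.res_nm _ _ _ _ k3, R.res_comp, R.res_comp]
    refine congrArg (R.nm _) ((R.res_comp _ _ _).trans ?_)
    congr 1
    exact MulActionHom.ext fun x => (k2 x).symm
  rw [e1] at hl
  rw [e2] at hl'
  have e3 : expoP (p.comp π) f = (expoP p f).comp π'' := MulActionHom.ext fun x => (k4 x).symm
  rw [e3] at hl'
  have key := NStep.mk (expoP p f) _ _ _ (R.nm qW (R.res eW (R.res x' r))) hc''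
  rw [← hl, ← hl'] at key
  exact key

end TambaraFunctor

namespace TambaraFunctor

variable {G : Type} [Group G] {H : Subgroup G}

/-- The map `X ⊔ res B → res (A ⊔ B)` induced by `t : X → res A`. -/
def sumRes {X : FinGSet H} {A B : FinGSet G} (t : X →[H] A.restrict H) :
    X.sum (B.restrict H) →[H] (A.sum B).restrict H :=
  desc ((restrictHom H inl).comp t) (restrictHom H inr)

/-- The map `res (P ⊔ B) → X ⊔ res B` induced by `ev : res P → X`. -/
def resSum {X : FinGSet H} {P B : FinGSet G} (ev : P.restrict H →[H] X) :
    (P.sum B).restrict H →[H] X.sum (B.restrict H) :=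
  desc (X := P.restrict H) (Y := B.restrict H) (inl.comp ev) inr

theorem isCoind_sum {A P : FinGSet G} {X : FinGSet H} {t : X →[H] A.restrict H}
    {ev : P.restrict H →[H] X} {π : P →[G] A} (hc : IsCoind t ev π) (B : FinGSet G) :
    IsCoind (sumRes (B := B) t) (resSum ev) (NormSystem.sumMap π (MulActionHom.id G)) := by
  refine ⟨?_, ?_⟩
  · rintro (s | b)
    · exact congrArg Sum.inl (hc.1 s)
    · rfl
  · rintro (a | b) F hF hF'
    · have : ∀ g : G, ∃ x : X, F g = Sum.inl x := by
        intro g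
        rcases hx : F g with x | b
        · exact ⟨x, rfl⟩
        · have := hF' g
          rw [hx] at this
          exact absurd this Sum.inr_ne_inl
      choose F' hF2 using this
      obtain ⟨s, ⟨h1, h2⟩, -⟩ := hc.2 a F'
        (fun h g => Sum.inl_injective ((hF2 _).symm.trans ((hF h g).trans (by rw [hF2]; rfl))))
        (fun g => Sum.inl_injective (by
          have := hF' g
          rw [hF2] at this
          exact this))
      refine ⟨Sum.inl s, ⟨congrArg Sum.inl h1, fun g => ?_⟩, ?_⟩
      · rw [hF2]
        exact congrArg Sum.inl (h2 g)
      · rintro (s' | b) ⟨h3, h4⟩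
        · refine congrArg Sum.inl (hc.ext ?_ fun g => ?_)
          · exact (Sum.inl_injective h3).trans h1.symm
          · have := h4 g
            rw [hF2] at this
            exact (Sum.inl_injective this).trans (h2 g).symm
        · exact absurd h3 Sum.inr_ne_inl
    · refine ⟨Sum.inr b, ⟨rfl, fun g => ?_⟩, ?_⟩
      · have := hF' g
        rcases hx : F g with x | b'
        · rw [hx] at this
          exact absurd this Sum.inl_ne_inr
        · rw [hx] at this
          exact congrArg Sum.inr (Sum.inr_injective this).symm
      · rintro (s' | b') ⟨h3, -⟩
        · exact absurd h3 Sum.inl_ne_inr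
        · exact congrArg Sum.inr (Sum.inr_injective h3)

theorem NStep.sum_left {R : TambaraFunctor.{u} H} {Y Z : FinGSet G} {a a' : (preNorm H R).obj Y}
    (h : NStep R a a') {z z' : (preNorm H R).obj (Y.sum Z)}
    (h1 : (preNorm H R).res inl z = a) (h1' : (preNorm H R).res inl z' = a')
    (h2 : (preNorm H R).res inr z = (preNorm H R).res inr z') : NStep R z z' := by
  obtain @⟨A, P, X, p, t, ev, π, r, hc⟩ := h
  generalize hb : (preNorm H R).res inr z' = b at h2
  induction b using NormSystem.Free.ind with | h B q n =>
  obtain ⟨l, ⟨hl1, hl2⟩, -⟩ := R.obj_sum r (show R.obj (B.restrict H) from n)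
  have e1 := NormSystem.eq_mk_sum (M := NormSystem.onRestrict H R.toNormSystem)
    (l := R.tr (sumRes (B := B) t) l) (m := R.tr t r) (n := n) ⟨by
      have hp : IsPb (inl : X →[H] X.sum (B.restrict H)) t (sumRes (B := B) t)
          (restrictHom H (inl : A →[G] A.sum B)) := by
        refine ⟨fun _ => rfl, ?_⟩
        rintro (x | b) a h
        · exact ⟨x, ⟨rfl, Sum.inl_injective h⟩, fun _ h' => Sum.inl_injective h'.1⟩
        · exact absurd h Sum.inr_ne_inl
      exact (R.res_tr _ _ _ _ hp l).trans (by rw [hl1]), by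
      have hp : IsPb (inr : B.restrict H →[H] X.sum (B.restrict H)) (MulActionHom.id H)
          (sumRes (B := B) t) (restrictHom H (inr : B →[G] A.sum B)) := by
        refine ⟨fun _ => rfl, ?_⟩
        rintro (x | b) a h
        · exact absurd h Sum.inl_ne_inr
        · exact ⟨b, ⟨rfl, Sum.inr_injective h⟩, fun _ h' => Sum.inr_injective h'.1⟩
      exact (R.res_tr _ _ _ _ hp l).trans (by rw [hl2, R.tr_id])⟩ h1 h2
  have e2 := NormSystem.eq_mk_sum (M := NormSystem.onRestrict H R.toNormSystem)
    (l := R.res (resSum (B := B) ev) l) (m := R.res ev r) (n := n) ⟨by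
      refine (R.res_comp _ _ _).trans ?_
      rw [← hl1, R.res_comp]; rfl, by
      refine (R.res_comp _ _ _).trans ?_
      rw [← hl2]; rfl⟩ h1' hb
  have key := NStep.mk (NormSystem.sumMap p q) _ _ _ l (isCoind_sum hc B)
  rw [e1, e2]
  have e3 : NormSystem.sumMap (p.comp π) q =
      (NormSystem.sumMap p q).comp (NormSystem.sumMap π (MulActionHom.id G)) := by
    refine MulActionHom.ext ?_
    rintro (x | x) <;> rfl
  rw [e3]
  exact key

theorem NRel.res {R : TambaraFunctor.{u} H} {Y Y' : FinGSet G} (f : Y' →[G] Y)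
    {a b : (preNorm H R).obj Y} (h : NRel R a b) :
    NRel R ((preNorm H R).res f a) ((preNorm H R).res f b) := by
  induction h with
  | rel _ _ h => exact .rel _ _ (h.res f)
  | refl => exact .refl _
  | symm _ _ _ h => exact .symm _ _ h
  | trans _ _ _ _ _ h h' => exact .trans _ _ _ h h'

theorem NRel.tr {R : TambaraFunctor.{u} H} {Y Y' : FinGSet G} (f : Y →[G] Y')
    {a b : (preNorm H R).obj Y} (h : NRel R a b) :
    NRel R ((preNorm H R).tr f a) ((preNorm H R).tr f b) := by
  induction h with
  | rel _ _ h => exact .rel _ _ (h.tr f)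
  | refl => exact .refl _
  | symm _ _ _ h => exact .symm _ _ h
  | trans _ _ _ _ _ h h' => exact .trans _ _ _ h h'

theorem NRel.nm {R : TambaraFunctor.{u} H} {Y Y' : FinGSet G} (f : Y →[G] Y')
    {a b : (preNorm H R).obj Y} (h : NRel R a b) :
    NRel R ((preNorm H R).nm f a) ((preNorm H R).nm f b) := by
  induction h with
  | rel _ _ h => exact .rel _ _ (h.nm f)
  | refl => exact .refl _
  | symm _ _ _ h => exact .symm _ _ h
  | trans _ _ _ _ _ h h' => exact .trans _ _ _ h h'

theorem NRel.sum_left {R : TambaraFunctor.{u} H} {Y Z : FinGSet G} {a a' : (preNorm H R).obj Y}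
    (h : NRel R a a') : ∀ {z z' : (preNorm H R).obj (Y.sum Z)},
    (preNorm H R).res inl z = a → (preNorm H R).res inl z' = a' →
    (preNorm H R).res inr z = (preNorm H R).res inr z' → NRel R z z' := by
  induction h with
  | rel _ _ h => exact fun h1 h2 h3 => .rel _ _ (h.sum_left h1 h2 h3)
  | refl a =>
    intro z z' h1 h2 h3
    rw [((preNorm H R).obj_sum a ((preNorm H R).res inr z')).unique ⟨h1, h3⟩ ⟨h2, rfl⟩]
    exact .refl _
  | symm _ _ _ h => exact fun h1 h2 h3 => .symm _ _ (h h2 h1 h3.symm)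
  | trans x y w _ _ h h' =>
    intro z z' h1 h2 h3
    obtain ⟨z'', ⟨h4, h5⟩, -⟩ := (preNorm H R).obj_sum y ((preNorm H R).res inr z')
    exact .trans _ _ _ (h h1 h4 (h3.trans h5.symm)) (h' h4 h2 h5)

/-- The equivalence relation defining the norm is a congruence. -/
def normCongruence (H : Subgroup G) (R : TambaraFunctor.{u} H) : (preNorm H R).Congruence where
  r := NRel R
  iseqv := Relation.EqvGen.is_equivalence _
  res := NRel.res
  tr := NRel.tr
  nm := NRel.nm
  sum {Y Z a b} h1 h2 := by
    obtain ⟨c, ⟨h3, h4⟩, -⟩ :=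
      (preNorm H R).obj_sum ((preNorm H R).res inl b) ((preNorm H R).res inr a)
    refine .trans _ _ _ (h1.sum_left rfl h3 h4.symm) ?_
    have hs : ∀ z : (preNorm H R).obj (Y.sum Z),
        (preNorm H R).res (desc inr inl : Y.sum Z →[G] Z.sum Y)
          ((preNorm H R).res (desc inr inl : Z.sum Y →[G] Y.sum Z) z) = z := by
      intro z
      rw [(preNorm H R).res_comp]
      have : (desc inr inl : Z.sum Y →[G] Y.sum Z).comp (desc inr inl : Y.sum Z →[G] Z.sum Y) =
          MulActionHom.id G := by
        refine MulActionHom.ext ?_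
        rintro (x | x) <;> rfl
      rw [this, (preNorm H R).res_id]
    rw [← hs c, ← hs b]
    refine NRel.res _ (NRel.sum_left h2 ?_ ?_ ?_)
    · rw [(preNorm H R).res_comp, ← h4]; rfl
    · rw [(preNorm H R).res_comp]; rfl
    · rw [(preNorm H R).res_comp, (preNorm H R).res_comp]; exact h3

theorem exists_isCoind [Finite G] {A : FinGSet G} {X : FinGSet H} (t : X →[H] A.restrict H) :
    ∃ (P : FinGSet G) (ev : P.restrict H →[H] X) (π : P →[G] A), IsCoind t ev π := by
  let T := {x : A × (G → X) // (∀ (h : H) (g : G), x.2 (h * g) = h • x.2 g) ∧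
    ∀ g : G, t (x.2 g) = g • x.1}
  let _ : MulAction G T :=
    { smul := fun c x => ⟨(c • x.1.1, fun g => x.1.2 (g * c)), by
        refine ⟨fun h g => ?_, fun g => ?_⟩
        · show x.1.2 (h * g * c) = h • x.1.2 (g * c)
          rw [mul_assoc, x.2.1]
        · exact (x.2.2 (g * c)).trans (mul_smul g c x.1.1)⟩
      one_smul := fun x => Subtype.ext (Prod.ext (one_smul G _) (funext fun g =>
        congrArg x.1.2 (mul_one g)))
      mul_smul := fun a b x => Subtype.ext (Prod.ext (mul_smul a b _) (funext fun g =>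
        congrArg x.1.2 (mul_assoc g a b).symm)) }
  have e : ∀ (g : G) (s : T), (g • s).1.2 1 = s.1.2 g := fun g s => congrArg s.1.2 (one_mul g)
  refine ⟨⟨T⟩, ⟨fun x => (show T from x).1.2 1, fun h x => ?_⟩, ⟨fun x => (show T from x).1.1,
    fun _ _ => rfl⟩, ?_, ?_⟩
  · refine (e h x).trans (Eq.trans ?_ ((show T from x).2.1 h 1))
    rw [mul_one]
  · intro s
    exact ((show T from s).2.2 1).trans (one_smul G (show T from s).1.1)
  · intro a F hF hF'
    refine ⟨(⟨(a, F), hF, hF'⟩ : T), ⟨rfl, fun g => e g (⟨(a, F), hF, hF'⟩ : T)⟩, ?_⟩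
    rintro s ⟨h1, h2⟩
    exact Subtype.ext (Prod.ext h1 (funext fun g => (e g s).symm.trans (h2 g)))

/-- The norm `N_H^G R` of an `H`-Tambara functor `R`, as a `G`-Tambara functor.

The underlying Mackey functor is the left Kan extension of `R`, as a functor on the category of spans
of finite `H`-sets, along coinduction `Map^H(G, -)` from `H`-sets to `G`-sets.
By the usual coend formula an element of the Kan extension at `Y` is represented
by an `H`-set `X`, an `r ∈ R(X)` and a span `Map^H(G, X) ← A → Y`. A map `A → Map^H(G, X)` is the same
thing as an `H`-map `u : A → X`, and the relations for spans `X ← X' = X'` replace `(X, u, r)` by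
`(res A, id, R_u r)`, so that the elements are represented by finite `G`-sets `A → Y` labelled by
elements `r ∈ R(res A)`; the relations for spans `X = X → X'` are generated by `NStep`.

On representatives, restriction is pullback, transfer is composition, and the norm is the
dependent product labelled by the norm of the pulled back label. -/
def norm [Finite G] (H : Subgroup G) (R : TambaraFunctor.{u} H) :
    TambaraFunctor.{max 1 u} G where
  toSemiTambara := (preNorm H R).quot (normCongruence H R)
  exists_neg {Y} x := by
    induction x using Quotient.ind with | _ x =>
    induction x using NormSystem.Free.ind with | h A p m =>
    obtain ⟨z, o, hz, ho⟩ := R.exists_neg (show R.obj (A.restrict H) from m)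
    obtain ⟨P, ev, π, hc⟩ := exists_isCoind (fold (A.restrict H) : _ →[H] A.restrict H)
    have hc0 : IsCoind (fromEmpty (A.restrict H) : _ →[H] A.restrict H)
        (⟨fun x => x, fun _ x => Empty.elim x⟩ : (empty G).restrict H →[H] empty H)
        (fromEmpty A) :=
      ⟨fun x => Empty.elim x, fun a F _ _ => Empty.elim (F 1)⟩
    have s1 := NStep.mk p _ _ _ z hc
    have s2 := NStep.mk p _ _ _ o hc0
    rw [ho] at s1
    have s3 : NRel R _ _ := .trans _ _ _ (.symm _ _ (.rel _ _ s1)) (.rel _ _ s2)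
    obtain ⟨j, hj⟩ := exists_hom (fun (a : A) (ε : P) => π ε = a ∧ ∀ g : G,
        ev (g • ε : P) = (inl : A.restrict H →[H] _) (g • a : A)) (by
          rintro c a ε ⟨h1, h2⟩
          refine ⟨by rw [map_smul, h1], fun g => ?_⟩
          rw [← mul_smul, h2, mul_smul]) (fun a =>
      hc.2 a (fun g => (inl : A.restrict H →[H] _) (g • a : A))
        (fun h g => congrArg Sum.inl (mul_smul (h : G) g a)) (fun g => rfl))
    have hji : Function.Injective j := fun a b hab => by
      rw [← (hj a).1, ← (hj b).1, hab]
    let C : Type := {ε : P // ∀ a, j a ≠ ε}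
    let _ : MulAction G C :=
      { smul := fun c ε => ⟨c • ε.1, fun a ha => ε.2 (c⁻¹ • a) (by
          rw [map_smul, ha, inv_smul_smul])⟩
        one_smul := fun ε => Subtype.ext (one_smul G ε.1)
        mul_smul := fun a b ε => Subtype.ext (mul_smul a b ε.1) }
    let ι : (⟨C⟩ : FinGSet G) →[G] P := ⟨fun ε => (show C from ε).1, fun _ _ => rfl⟩
    have hb : Function.Bijective (desc j ι) := by
      refine ⟨?_, fun ε => ?_⟩
      · rintro (a | a) (b | b) hab
        · exact congrArg Sum.inl (hji hab)
        · exact absurd hab ((show C from b).2 a)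
        · exact absurd hab.symm ((show C from a).2 b)
        · exact congrArg Sum.inr (Subtype.ext hab)
      · by_cases h : ∃ a, j a = ε
        · obtain ⟨a, rfl⟩ := h
          exact ⟨Sum.inl a, rfl⟩
        · push Not at h
          exact ⟨Sum.inr ⟨ε, h⟩, rfl⟩
    refine ⟨Quotient.mk _ (NormSystem.cls (M := NormSystem.onRestrict H R.toNormSystem)
      (A.sum ⟨C⟩) (NormSystem.sumMap p ((p.comp π).comp ι))
      (R.res (restrictHom H (desc j ι)) (R.res ev z))), Quotient.mk _
      (NormSystem.cls (M := NormSystem.onRestrict H R.toNormSystem) (empty G) (MulActionHom.id G)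
      (R.res (⟨fun x => x, fun _ x => Empty.elim x⟩ : (empty G).restrict H →[H] empty H) o)),
      ?_, ?_⟩
    · refine congrArg (Quotient.mk _) ((NormSystem.fRes_inl_mk_sum _).trans ?_)
      congr 1
      refine (R.res_comp _ _ _).trans ((R.res_comp _ _ _).trans ?_)
      rw [← hz]
      congr 1
      refine MulActionHom.ext fun a => ?_
      have h1 := (hj a).2 1
      have h2 : (1 : G) • (show A from a) = a := one_smul G (show A from a)
      have h3 : (1 : G) • j a = j a := one_smul G (j a)
      exact (congrArg ev h3).symm.trans (h1.trans (congrArg Sum.inl h2))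
    · refine Quotient.sound ?_
      have e1 := NormSystem.mk_eq (M := NormSystem.onRestrict H R.toNormSystem)
        (p := (fold Y).comp (NormSystem.sumMap p ((p.comp π).comp ι)))
        (m := R.res (restrictHom H (desc j ι)) (R.res ev z)) (q := p.comp π) (n := R.res ev z)
        (desc j ι) hb (by
          rintro (a | a)
          · exact congrArg p (hj a).1
          · rfl) rfl
      have e2 : p.comp (fromEmpty A) = (fromEmpty Y).comp (MulActionHom.id G) :=
        MulActionHom.ext fun x => Empty.elim x
      rw [← e1, e2] at s3
      exact s3

end TambaraFunctor

/-! ### The constant Tambara functor `ℤ` -/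

section ConstZ

variable {G : Type} [Group G]

@[to_additive]
theorem finprod_fiber_pb {M : Type} [CommMonoid M] {P X Y Z : Type} {f' : P → X} {g' : P → Y}
    {f : X → Z} {g : Y → Z} (H : IsPb f' g' f g) (φ : X → M) (y : Y) :
    ∏ᶠ x : {x // f x = g y}, φ x = ∏ᶠ x : {p // g' p = y}, φ (f' x) := by
  symm
  refine finprod_eq_of_bijective (fun p : {p // g' p = y} =>
    (⟨f' p, by rw [H.1, p.2]⟩ : {x // f x = g y})) ⟨fun p p' h => ?_, fun x => ?_⟩ fun _ => rfl
  · exact Subtype.ext (H.ext (congrArg Subtype.val h) (p.2.trans p'.2.symm))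
  · obtain ⟨p, ⟨h1, h2⟩, -⟩ := H.2 x y x.2
    exact ⟨⟨p, h2⟩, Subtype.ext h1⟩

@[to_additive]
theorem finprod_fiber_comp {M : Type} [CommMonoid M] {X Y Z : Type} [Finite X] [Finite Y]
    (f : X → Y) (g : Y → Z) (φ : X → M) (z : Z) :
    ∏ᶠ y : {y // g y = z}, ∏ᶠ x : {x // f x = y}, φ x = ∏ᶠ x : {x // g (f x) = z}, φ x := by
  classical
  have := Fintype.ofFinite X
  have := Fintype.ofFinite {y // g y = z}
  simp only [finprod_eq_prod_of_fintype]
  rw [← Fintype.prod_sigma' (fun (y : {y // g y = z}) (x : {x // f x = y}) => φ x)]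
  refine Fintype.prod_bijective
    (fun p : (y : {y // g y = z}) × {x // f x = y} =>
      (⟨p.2, by rw [p.2.2, p.1.2]⟩ : {x // g (f x) = z})) ⟨?_, ?_⟩ _ _ fun _ => rfl
  · rintro ⟨⟨y, hy⟩, x, hx⟩ ⟨⟨y', hy'⟩, x', hx'⟩ h
    have h : x = x' := congrArg Subtype.val h
    have hx : f x = y := hx
    have hx' : f x' = y' := hx'
    subst h
    subst hx
    subst hx'
    rfl
  · rintro ⟨x, hx⟩
    exact ⟨⟨⟨f x, hx⟩, ⟨x, rfl⟩⟩, rfl⟩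

@[to_additive]
theorem finprod_fiber_id {M : Type} [CommMonoid M] {X : Type} (φ : X → M) (y : X) :
    ∏ᶠ x : {x // x = y}, φ x = φ y :=
  (finprod_unique (fun x : {x // x = y} => φ x)).trans rfl

@[to_additive]
theorem finprod_fiber_perm {M : Type} [CommMonoid M] {X Y : Type} (f : X → Y) (φ : X → M)
    (σ : X → X) (τ : Y → Y) (hσ : Function.Bijective σ) (hτ : Function.Injective τ)
    (h : ∀ x, f (σ x) = τ (f x)) (hφ : ∀ x, φ (σ x) = φ x) (y : Y) :
    ∏ᶠ x : {x // f x = τ y}, φ x = ∏ᶠ x : {x // f x = y}, φ x := by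
  symm
  refine finprod_eq_of_bijective (fun x : {x // f x = y} =>
    (⟨σ x.1, by rw [h, x.2]⟩ : {x // f x = τ y})) ⟨fun p p' h => ?_, fun x => ?_⟩
      fun x => (hφ x).symm
  · exact Subtype.ext (hσ.1 (congrArg Subtype.val h))
  · obtain ⟨x', hx'⟩ := hσ.2 x.1
    exact ⟨⟨x', hτ (by rw [← h, hx', x.2])⟩, Subtype.ext hx'⟩

theorem finprod_finsum_fiber {A X Y E P : Type} [Finite A] [Finite X] [Finite E] [Finite P]
    {h : A → X} {f : X → Y} {e : E → A} {q : E → P} {p : P → Y} (H : IsExp h f e q p)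
    (φ : A → ℤ) (y : Y) :
    ∏ᶠ x : {x // f x = y}, ∑ᶠ a : {a // h a = x}, φ a =
      ∑ᶠ π : {π // p π = y}, ∏ᶠ ε : {ε // q ε = π}, φ (e ε) := by
  classical
  have := Fintype.ofFinite A
  have := Fintype.ofFinite E
  have := Fintype.ofFinite {x // f x = y}
  have := Fintype.ofFinite {π // p π = y}
  simp only [finprod_eq_prod_of_fintype, finsum_eq_sum_of_fintype]
  rw [Finset.prod_univ_sum, Fintype.piFinset_univ]
  choose ε hε1 hε2 using fun (π : {π // p π = y}) (x : {x // f x = y}) =>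
    H.exists_pt (x := x.1) (π := π.1) (x.2.trans π.2.symm)
  symm
  refine Fintype.sum_bijective (fun (π : {π // p π = y}) (x : {x // f x = y}) =>
    (⟨e (ε π x), hε2 π x⟩ : {a // h a = x})) ⟨fun π π' hh => ?_, fun s => ?_⟩ _ _ fun π => ?_
  · refine Subtype.ext (H.ext (π.2.trans π'.2.symm) fun δ hδ => ?_)
    have hx : f (h (e δ)) = y := by rw [H.comm, hδ, π.2]
    refine ⟨ε π' ⟨_, hx⟩, hε1 _ _, ?_⟩
    have h1 : e (ε π ⟨_, hx⟩) = e (ε π' ⟨_, hx⟩) := congrArg Subtype.val (congrFun hh ⟨_, hx⟩)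
    rw [← h1]
    exact congrArg e (H.inj ((hε1 _ _).trans hδ.symm) (hε2 _ _))
  · obtain ⟨π, hπ, hπ'⟩ := H.exists_sec y (fun a => ∃ x, (s x).1 = a)
      (fun x hx => ⟨s ⟨x, hx⟩, ⟨_, rfl⟩, (s ⟨x, hx⟩).2⟩)
    refine ⟨⟨π, hπ⟩, funext fun x => Subtype.ext ?_⟩
    obtain ⟨x', hx'⟩ := hπ' (ε ⟨π, hπ⟩ x) (hε1 _ _)
    have : x' = x := Subtype.ext (by rw [← (s x').2, hx', hε2])
    subst this
    exact hx'.symm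
  · refine Fintype.prod_bijective (fun δ : {ε // q ε = π} =>
      (⟨h (e δ), by rw [H.comm, δ.2, π.2]⟩ : {x // f x = y})) ⟨fun δ δ' hd => ?_, fun x => ?_⟩ _ _
        fun δ => ?_
    · exact Subtype.ext (H.inj (δ.2.trans δ'.2.symm) (congrArg Subtype.val hd))
    · exact ⟨⟨ε π x, hε1 _ _⟩, Subtype.ext (hε2 _ _)⟩
    · exact congrArg (fun δ => φ (e δ)) (H.inj (δ.2.trans (hε1 π ⟨h (e δ), _⟩).symm)
        (hε2 π ⟨h (e δ), _⟩).symm)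

/-- The constant `G`-Tambara functor `ℤ`: the value at `X` is the ring of `G`-invariant functions
`X → ℤ`, so the value at every orbit is `ℤ`; restrictions are given by composition, and transfers
and norms by sums and products over fibres. -/
noncomputable def constZ (G : Type) [Group G] : TambaraFunctor.{0} G where
  obj X := {φ : X → ℤ // ∀ (g : G) x, φ (g • x) = φ x}
  res f φ := ⟨fun x => φ.1 (f x), fun g x => by simp only [map_smul, φ.2]⟩
  nm f φ := ⟨fun y => ∏ᶠ x : {x // f x = y}, φ.1 x, fun g y => finprod_fiber_perm f φ.1 _ _
    (MulAction.bijective g) (MulAction.injective g) (map_smul f g) (φ.2 g) y⟩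
  tr f φ := ⟨fun y => ∑ᶠ x : {x // f x = y}, φ.1 x, fun g y => finsum_fiber_perm f φ.1 _ _
    (MulAction.bijective g) (MulAction.injective g) (map_smul f g) (φ.2 g) y⟩
  res_id _ := rfl
  res_comp _ _ _ := rfl
  nm_id φ := Subtype.ext (funext fun y => finprod_fiber_id φ.1 y)
  nm_comp f g φ := Subtype.ext (funext fun z => finprod_fiber_comp f g φ.1 z)
  res_nm f' g' f g H φ := Subtype.ext (funext fun y => finprod_fiber_pb H φ.1 y)
  tr_id φ := Subtype.ext (funext fun y => finsum_fiber_id φ.1 y)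
  tr_comp f g φ := Subtype.ext (funext fun z => finsum_fiber_comp f g φ.1 z)
  res_tr f' g' f g H φ := Subtype.ext (funext fun y => finsum_fiber_pb H φ.1 y)
  nm_tr h f e q p H φ := Subtype.ext (funext fun y => finprod_finsum_fiber H φ.1 y)
  obj_empty X hX := ⟨⟨fun _ => 0, fun _ _ => rfl⟩, trivial, fun φ _ =>
    Subtype.ext (funext fun x => hX.elim x)⟩
  obj_sum {X Y} φ ψ := ⟨⟨Sum.elim φ.1 ψ.1, by
    rintro g (x | x)
    · exact φ.2 g x
    · exact ψ.2 g x⟩, ⟨rfl, rfl⟩, by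
    rintro χ ⟨rfl, rfl⟩
    refine Subtype.ext (funext ?_)
    rintro (x | x) <;> rfl⟩
  exists_neg {X} φ := ⟨⟨Sum.elim φ.1 (fun x => - φ.1 x), by
    rintro g (x | x)
    · exact φ.2 g x
    · exact congrArg Neg.neg (φ.2 g x)⟩, ⟨fun _ => 0, fun _ _ => rfl⟩, rfl, by
    refine Subtype.ext (funext fun y => ?_)
    have h1 : ∑ᶠ x : {x // fromEmpty X x = y}, (0 : ℤ) = 0 := finsum_zero
    refine Eq.trans ?_ h1.symm
    have h2 : ∑ᶠ b : Bool, (if b then φ.1 y else - φ.1 y) =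
        ∑ᶠ x : {x : X.sum X // fold X x = y}, Sum.elim φ.1 (fun x => - φ.1 x) x.1 := by
      refine finsum_eq_of_bijective (fun b : Bool =>
        (⟨if b then Sum.inl y else Sum.inr y, by cases b <;> rfl⟩ : {x : X.sum X // fold X x = y}))
        ⟨?_, ?_⟩ ?_
      · rintro (_ | _) (_ | _) h
        · rfl
        · exact absurd (congrArg Subtype.val h) Sum.inr_ne_inl
        · exact absurd (congrArg Subtype.val h) Sum.inl_ne_inr
        · rfl
      · rintro ⟨x | x, hx⟩
        · exact ⟨true, Subtype.ext (congrArg Sum.inl (show x = y from hx).symm)⟩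
        · exact ⟨false, Subtype.ext (congrArg Sum.inr (show x = y from hx).symm)⟩
      · rintro (_ | _) <;> rfl
    refine h2.symm.trans ?_
    rw [finsum_eq_sum_of_fintype]
    simp⟩

end ConstZ

/-! ### The Burnside Tambara functor -/

section Burnside

variable {G : Type} [Group G]

/-- The trivial system of labels. -/
def trivialLabels (G : Type) [Group G] : NormSystem.{0} G where
  obj _ := Unit
  res _ _ := ()
  nm _ _ := ()
  res_id _ := rfl
  res_comp _ _ _ := rfl
  nm_id _ := rfl
  nm_comp _ _ _ := rfl
  res_nm _ _ _ _ _ _ := rfl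
  obj_empty _ _ := ⟨(), trivial, fun _ _ => rfl⟩
  obj_sum _ _ := ⟨(), ⟨rfl, rfl⟩, fun _ _ => rfl⟩

/-- Isomorphism classes of finite `G`-sets over `X`. -/
abbrev GSetsOver (X : FinGSet G) : Type 1 := (trivialLabels G).Free X

/-- The semi-Tambara functor of isomorphism classes of finite `G`-sets over `X`: restriction is
pullback, transfer is composition, and the norm is the dependent product. -/
abbrev gsets (G : Type) [Group G] : SemiTambara.{1} G := (trivialLabels G).free

/-- The isomorphism class of a finite `G`-set over `X`. -/
def gcls {X : FinGSet G} (A : FinGSet G) (p : A →[G] X) : GSetsOver X :=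
  NormSystem.cls (M := trivialLabels G) A p ()

theorem gcls_eq {X A B : FinGSet G} {p : A →[G] X} {q : B →[G] X} (φ : A →[G] B)
    (hφ : Function.Bijective φ) (h : ∀ a, q (φ a) = p a) : gcls A p = gcls B q :=
  NormSystem.mk_eq φ hφ h rfl

theorem gcls_ind {X : FinGSet G} {C : GSetsOver X → Prop}
    (h : ∀ (A : FinGSet G) (p : A →[G] X), C (gcls A p)) (x : GSetsOver X) : C x :=
  NormSystem.Free.ind (fun A p _ => h A p) x

/-- Disjoint union. -/
instance {X : FinGSet G} : Add (GSetsOver X) :=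
  ⟨Quotient.map₂ (fun s t => ⟨s.A.sum t.A, desc s.p t.p, ()⟩) (by
    rintro s s' ⟨φ, hφ, h1, -⟩ t t' ⟨ψ, hψ, h2, -⟩
    refine ⟨NormSystem.sumMap φ ψ, ?_, ?_, rfl⟩
    · have : ⇑(NormSystem.sumMap φ ψ) = Sum.map φ ψ := by
        funext x; rcases x with x | x <;> rfl
      rw [this]
      exact ⟨Sum.map_injective.2 ⟨hφ.1, hψ.1⟩, Sum.map_surjective.2 ⟨hφ.2, hψ.2⟩⟩
    · rintro (x | x)
      · exact h1 x
      · exact h2 x)⟩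

instance {X : FinGSet G} : Zero (GSetsOver X) := ⟨gcls (empty G) (fromEmpty X)⟩

theorem gcls_add {X A B : FinGSet G} (p : A →[G] X) (q : B →[G] X) :
    gcls A p + gcls B q = gcls (A.sum B) (desc p q) := rfl

theorem gcls_add_comm {X : FinGSet G} (a b : GSetsOver X) : a + b = b + a := by
  induction a using gcls_ind with | h A p =>
  induction b using gcls_ind with | h B q =>
  refine gcls_eq (desc inr inl) ?_ (by rintro (x | x) <;> rfl)
  have : ⇑(desc inr inl : A.sum B →[G] B.sum A) = Sum.swap := by
    funext x; rcases x with x | x <;> rfl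
  rw [this]
  exact (Equiv.sumComm A B).bijective

instance {X : FinGSet G} : AddCommMonoid (GSetsOver X) where
  add_assoc a b c := by
    induction a using gcls_ind with | h A p =>
    induction b using gcls_ind with | h B q =>
    induction c using gcls_ind with | h C r =>
    refine gcls_eq (desc (desc inl (inr.comp inl)) (inr.comp inr)) ?_
      (by rintro ((x | x) | x) <;> rfl)
    have : ⇑(desc (desc inl (inr.comp inl)) (inr.comp inr) : (A.sum B).sum C →[G] A.sum (B.sum C)) =
        Equiv.sumAssoc A B C := by
      funext x; rcases x with (x | x) | x <;> rfl
    rw [this]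
    exact (Equiv.sumAssoc A B C).bijective
  zero_add a := by
    induction a using gcls_ind with | h A p =>
    refine (gcls_eq inr ⟨Sum.inr_injective, ?_⟩ (fun _ => rfl)).symm
    rintro (x | x)
    · exact Empty.elim x
    · exact ⟨x, rfl⟩
  add_zero a := by
    induction a using gcls_ind with | h A p =>
    refine (gcls_eq inl ⟨Sum.inl_injective, ?_⟩ (fun _ => rfl)).symm
    rintro (x | x)
    · exact ⟨x, rfl⟩
    · exact Empty.elim x
  add_comm := gcls_add_comm
  nsmul := nsmulRec

/-- The number of points of `A` over `x` which are fixed by `K`. -/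
noncomputable def fixCount {X A : FinGSet G} (p : A →[G] X) (i : Subgroup G × X) : ℤ :=
  Nat.card {a : A // p a = i.2 ∧ ∀ k ∈ i.1, k • a = a}

theorem fixCount_congr {X Y A B : FinGSet G} {p : A →[G] X} {q : B →[G] Y} (K : Subgroup G) {x : X}
    {y : Y} (φ : {a : A // p a = x} → {b : B // q b = y}) (hφ : Function.Bijective φ)
    (h : ∀ a, (∀ k ∈ K, k • (φ a).1 = (φ a).1) ↔ ∀ k ∈ K, k • a.1 = a.1) :
    fixCount p (K, x) = fixCount q (K, y) := by
  refine congrArg Nat.cast (Nat.card_eq_of_bijective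
    (fun a => ⟨(φ ⟨a.1, a.2.1⟩).1, (φ ⟨a.1, a.2.1⟩).2, (h _).2 a.2.2⟩) ⟨fun a b hab => ?_, fun b => ?_⟩)
  · have h1 : (φ ⟨a.1, a.2.1⟩).1 = (φ ⟨b.1, b.2.1⟩).1 := congrArg (fun a => a.1) hab
    have := hφ.1 (Subtype.ext h1)
    exact Subtype.ext (congrArg (fun a => a.1) this)
  · obtain ⟨a, ha⟩ := hφ.2 ⟨b.1, b.2.1⟩
    refine ⟨⟨a.1, a.2, (h a).1 ?_⟩, ?_⟩
    · rw [ha]; exact b.2.2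
    · exact Subtype.ext (congrArg (fun a => a.1) ha)

/-- The marks of a finite `G`-set over `X`. -/
noncomputable def marks (X : FinGSet G) : GSetsOver X →+ (Subgroup G × X → ℤ) where
  toFun := Quotient.lift (fun s => fixCount s.p) (by
    rintro s t ⟨φ, hφ, h, -⟩
    funext ⟨K, x⟩
    refine fixCount_congr K (fun a => ⟨φ a.1, (h a.1).trans a.2⟩) ⟨fun a b hab => ?_, fun b => ?_⟩ ?_
    · exact Subtype.ext (hφ.1 (congrArg Subtype.val hab))
    · obtain ⟨a, ha⟩ := hφ.2 b.1
      exact ⟨⟨a, by rw [← h, ha, b.2]⟩, Subtype.ext ha⟩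
    · intro a
      refine forall₂_congr fun k _ => ?_
      rw [← map_smul]
      exact hφ.1.eq_iff)
  map_zero' := by
    funext i
    show fixCount (fromEmpty X) i = 0
    have : IsEmpty {a : empty G // fromEmpty X a = i.2 ∧ ∀ k ∈ i.1, k • a = a} :=
      ⟨fun a => Empty.elim a.1⟩
    rw [fixCount, Nat.card_of_isEmpty]; rfl
  map_add' a b := by
    induction a using gcls_ind with | h A p =>
    induction b using gcls_ind with | h B q =>
    funext i
    show fixCount (desc p q) i = fixCount p i + fixCount q i
    unfold fixCount
    rw [← Nat.cast_add, ← Nat.card_sum]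
    refine congrArg Nat.cast (Nat.card_eq_of_bijective
      (Sum.elim (fun a => ⟨Sum.inl a.1, a.2.1, fun k hk => congrArg Sum.inl (a.2.2 k hk)⟩)
        (fun a => ⟨Sum.inr a.1, a.2.1, fun k hk => congrArg Sum.inr (a.2.2 k hk)⟩)) ⟨?_, ?_⟩).symm
    · rintro (a | a) (b | b) hab
      · exact congrArg Sum.inl (Subtype.ext (Sum.inl_injective (congrArg Subtype.val hab)))
      · exact absurd (congrArg Subtype.val hab) Sum.inl_ne_inr
      · exact absurd (congrArg Subtype.val hab) Sum.inr_ne_inl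
      · exact congrArg Sum.inr (Subtype.ext (Sum.inr_injective (congrArg Subtype.val hab)))
    · rintro ⟨a | a, h1, h2⟩
      · exact ⟨Sum.inl ⟨a, h1, fun k hk => Sum.inl_injective (h2 k hk)⟩, rfl⟩
      · exact ⟨Sum.inr ⟨a, h1, fun k hk => Sum.inr_injective (h2 k hk)⟩, rfl⟩

theorem marks_gcls {X A : FinGSet G} (p : A →[G] X) : marks X (gcls A p) = fixCount p := rfl

theorem fixCount_ne_zero {X A : FinGSet G} {p : A →[G] X} {i : Subgroup G × X} :
    fixCount p i ≠ 0 ↔ ∃ a, p a = i.2 ∧ ∀ k ∈ i.1, k • a = a := by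
  rw [fixCount, Nat.cast_ne_zero, ← Nat.pos_iff_ne_zero, Nat.card_pos_iff]
  exact ⟨fun h => let ⟨⟨a, ha⟩⟩ := h.1; ⟨a, ha⟩, fun ⟨a, ha⟩ => ⟨⟨⟨a, ha⟩⟩, inferInstance⟩⟩

theorem marks_res {X Y : FinGSet G} (f : X →[G] Y) (a : GSetsOver Y) (K : Subgroup G) (x : X)
    (hx : ∀ k ∈ K, k • x = x) :
    marks X ((trivialLabels G).fRes f a) (K, x) = marks Y a (K, f x) := by
  induction a using gcls_ind with | h A p =>
  show fixCount (pbSnd p f) (K, x) = fixCount p (K, f x)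
  have H := isPb_pb p f
  refine fixCount_congr K (fun a => ⟨pbFst p f a.1, (H.1 a.1).trans (congrArg f a.2)⟩)
    ⟨fun a b hab => ?_, fun b => ?_⟩ ?_
  · exact Subtype.ext (H.ext (congrArg Subtype.val hab) (a.2.trans b.2.symm))
  · obtain ⟨c, ⟨h1, h2⟩, -⟩ := H.2 b.1 x b.2
    exact ⟨⟨c, h2⟩, Subtype.ext h1⟩
  · intro a
    refine forall₂_congr fun k hk => ?_
    rw [← map_smul]
    refine ⟨fun h => H.ext h ?_, fun h => congrArg (pbFst p f) h⟩
    rw [map_smul, a.2, hx k hk]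

theorem marks_eq_zero {X : FinGSet G} (a : GSetsOver X) {i : Subgroup G × X}
    (hi : ¬ ∀ k ∈ i.1, k • i.2 = i.2) : marks X a i = 0 := by
  induction a using gcls_ind with | h A p =>
  by_contra h
  obtain ⟨a, h1, h2⟩ := fixCount_ne_zero.1 h
  exact hi fun k hk => by rw [← h1, ← map_smul, h2 k hk]

theorem marks_res_eq {X Y : FinGSet G} (f : X →[G] Y) (a : GSetsOver Y) (i : Subgroup G × X)
    [Decidable (∀ k ∈ i.1, k • i.2 = i.2)] : marks X ((trivialLabels G).fRes f a) i =
      if ∀ k ∈ i.1, k • i.2 = i.2 then marks Y a (i.1, f i.2) else 0 := by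
  split_ifs with hi
  · exact marks_res f a i.1 i.2 hi
  · exact marks_eq_zero _ hi

theorem marks_tr {X Y : FinGSet G} (f : X →[G] Y) (a : GSetsOver X) (K : Subgroup G) (y : Y) :
    marks Y ((trivialLabels G).fTr f a) (K, y) = ∑ᶠ x : {x // f x = y}, marks X a (K, x.1) := by
  classical
  have := Fintype.ofFinite {x // f x = y}
  induction a using gcls_ind with | h A p =>
  show fixCount (f.comp p) (K, y) = ∑ᶠ x : {x // f x = y}, fixCount p (K, x.1)
  rw [finsum_eq_sum_of_fintype]
  unfold fixCount
  rw [← Nat.cast_sum, ← Nat.card_sigma]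
  refine congrArg Nat.cast (Nat.card_eq_of_bijective (fun a => ⟨⟨p a.1, a.2.1⟩, a.1, rfl, a.2.2⟩)
    ⟨fun a b hab => ?_, ?_⟩)
  · have : ∀ c d : (x : {x // f x = y}) × {a : A // p a = x.1 ∧ ∀ k ∈ K, k • a = a}, c = d →
      c.2.1 = d.2.1 := by rintro c d rfl; rfl
    exact Subtype.ext (this _ _ hab)
  · rintro ⟨⟨x, hx⟩, a, h1, h⟩
    have h1 : p a = x := h1
    subst h1
    exact ⟨⟨a, hx, h⟩, rfl⟩

/-- The marks of a dependent product are polynomials in marks. -/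
theorem marks_nm {X Y : FinGSet G} (f : X →[G] Y) (i : Subgroup G × Y) :
    ∃ P : MvPolynomial (Subgroup G × X) ℤ, ∀ a : GSetsOver X,
      marks Y ((trivialLabels G).fNm f a) i = MvPolynomial.eval (marks X a) P := by
  classical
  obtain ⟨K, y⟩ := i
  by_cases hy : ∀ k ∈ K, k • y = y
  swap
  · exact ⟨0, fun a => by rw [map_zero]; exact marks_eq_zero _ hy⟩
  let F := {x : X // f x = y}
  let S : Setoid F :=
    ⟨fun x x' => ∃ k ∈ K, k • x.1 = x'.1, fun x => ⟨1, K.one_mem, one_smul G x.1⟩,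
      fun {x x'} ⟨k, hk, h⟩ => ⟨k⁻¹, K.inv_mem hk, by rw [← h, inv_smul_smul]⟩,
      fun {x x' x''} ⟨k, hk, h⟩ ⟨l, hl, h'⟩ => ⟨l * k, K.mul_mem hl hk, by rw [mul_smul, h, h']⟩⟩
  let Q := Quotient S
  have := Fintype.ofFinite Q
  let rep : Q → F := Quotient.out
  have hrep : ∀ x : F, ∃ (O : Q) (k : G), k ∈ K ∧ k • (rep O).1 = x.1 := fun x =>
    have hx : ∃ k ∈ K, k • (rep (Quotient.mk S x)).1 = x.1 :=
      Quotient.exact (Quotient.out_eq (Quotient.mk S x))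
    let ⟨k, hk, h⟩ := hx
    ⟨Quotient.mk S x, k, hk, h⟩
  have hrep' : ∀ (O O' : Q) (k k' : G), k ∈ K → k' ∈ K → k • (rep O).1 = k' • (rep O').1 →
      O = O' := by
    intro O O' k k' hk hk' h
    rw [← Quotient.out_eq O, ← Quotient.out_eq O']
    refine Quotient.sound ⟨k'⁻¹ * k, K.mul_mem (K.inv_mem hk') hk, ?_⟩
    rw [mul_smul]
    exact (congrArg (k'⁻¹ • ·) h).trans (inv_smul_smul k' _)
  refine ⟨∏ O : Q, MvPolynomial.X (K ⊓ MulAction.stabilizer G (rep O).1, (rep O).1), fun a => ?_⟩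
  induction a using gcls_ind with | h A h =>
  rw [map_prod]
  simp only [MvPolynomial.eval_X]
  show fixCount (expoP h f) (K, y) =
    ∏ O : Q, fixCount h (K ⊓ MulAction.stabilizer G (rep O).1, (rep O).1)
  unfold fixCount
  rw [← Nat.cast_prod, ← Nat.card_pi]
  have H := isExp_expo h f
  choose ε hε1 hε2 using fun (π : {π : expo h f // expoP h f π = y ∧ ∀ k ∈ K, k • π = π}) (x : F) =>
    H.exists_pt (x := x.1) (π := π.1) (x.2.trans π.2.1.symm)
  have key : ∀ (π : {π : expo h f // expoP h f π = y ∧ ∀ k ∈ K, k • π = π}) (x x' : F) (k : G),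
      k ∈ K → k • x.1 = x'.1 → k • expoEv h f (ε π x) = expoEv h f (ε π x') := by
    intro π x x' k hk hx
    rw [← map_smul]
    refine congrArg _ (H.inj ?_ ?_)
    · rw [map_smul, hε1, hε1, π.2.2 k hk]
    · rw [map_smul, map_smul, hε2, hε2, hx]
  refine congrArg Nat.cast (Nat.card_eq_of_bijective (fun π O => ⟨expoEv h f (ε π (rep O)),
    hε2 _ _, fun k hk => key _ _ _ k hk.1 hk.2⟩) ⟨fun π π' hh => ?_, fun s => ?_⟩)
  · refine Subtype.ext (H.ext (π.2.1.trans π'.2.1.symm) fun δ hδ => ?_)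
    have hx : f (h (expoEv h f δ)) = y := by rw [H.comm, hδ, π.2.1]
    obtain ⟨O, k, hk, hO⟩ := hrep ⟨_, hx⟩
    refine ⟨ε π' ⟨_, hx⟩, hε1 _ _, ?_⟩
    have h1 : expoEv h f (ε π (rep O)) = expoEv h f (ε π' (rep O)) :=
      congrArg Subtype.val (congrFun hh O)
    rw [← key π' (rep O) ⟨_, hx⟩ k hk hO, ← h1, key π (rep O) ⟨_, hx⟩ k hk hO]
    exact congrArg _ (H.inj ((hε1 _ _).trans hδ.symm) (hε2 _ _))
  · let T : A → Prop := fun a => ∃ (O : Q) (k : G), k ∈ K ∧ k • (s O).1 = a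
    have hT : ∀ a a', T a → T a' → h a = h a' → a = a' := by
      rintro _ _ ⟨O, k, hk, rfl⟩ ⟨O', k', hk', rfl⟩ hh
      rw [map_smul, map_smul, (s O).2.1, (s O').2.1] at hh
      obtain rfl := hrep' O O' k k' hk hk' hh
      have h2 := (s O).2.2 (k'⁻¹ * k) ⟨K.mul_mem (K.inv_mem hk') hk, by
        show (k'⁻¹ * k) • (rep O).1 = _
        rw [mul_smul, hh, inv_smul_smul]⟩
      rw [mul_smul, inv_smul_eq_iff] at h2
      exact h2
    obtain ⟨π, hπ, hπ'⟩ := H.exists_sec y T (fun x hx => by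
      obtain ⟨O, k, hk, hO⟩ := hrep ⟨x, hx⟩
      exact ⟨k • (s O).1, ⟨O, k, hk, rfl⟩, by rw [map_smul, (s O).2.1, hO]⟩)
    have hfix : ∀ k ∈ K, k • π = π := by
      intro k hk
      have hpk : expoP h f (k • π) = expoP h f π := by rw [map_smul, hπ, hy k hk]
      refine H.ext hpk fun δ hδ => ?_
      obtain ⟨δ', h1, h2⟩ := H.exists_pt (x := h (expoEv h f δ)) (π := π)
        (by rw [H.comm, hδ, hpk])
      refine ⟨δ', h1, hT _ _ (hπ' _ h1) ?_ h2⟩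
      obtain ⟨O, l, hl, h3⟩ := hπ' (k⁻¹ • δ) (by rw [map_smul, hδ, inv_smul_smul])
      refine ⟨O, k * l, K.mul_mem hk hl, ?_⟩
      rw [mul_smul, h3, map_smul, smul_inv_smul]
    refine ⟨⟨π, hπ, hfix⟩, funext fun O => Subtype.ext ?_⟩
    refine hT _ _ (hπ' _ (hε1 _ _)) ⟨O, 1, K.one_mem, one_smul G _⟩ ?_
    exact (hε2 _ _).trans (s O).2.1.symm

/-- The part of a finite `G`-set on which an invariant predicate holds. -/
def FinGSet.part {A : FinGSet G} (S : A → Prop) (hS : ∀ (g : G) a, S a → S (g • a)) : FinGSet G :=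
  letI : MulAction G {a // S a} :=
    { smul := fun g a => ⟨g • a.1, hS g _ a.2⟩
      one_smul := fun a => Subtype.ext (one_smul G a.1)
      mul_smul := fun g k a => Subtype.ext (mul_smul g k a.1) }
  ⟨{a // S a}⟩

def FinGSet.partMap {A : FinGSet G} (S : A → Prop) (hS : ∀ (g : G) a, S a → S (g • a)) :
    FinGSet.part S hS →[G] A := ⟨fun a => a.1, fun _ _ => rfl⟩

theorem gcls_split {X A : FinGSet G} (p : A →[G] X) (S : A → Prop)
    (hS : ∀ (g : G) a, S a → S (g • a)) (hS' : ∀ (g : G) a, ¬ S a → ¬ S (g • a)) :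
    gcls A p = gcls (part S hS) (p.comp (partMap S hS)) +
      gcls (part (fun a => ¬ S a) hS') (p.comp (partMap _ hS')) := by
  symm
  refine gcls_eq (desc (partMap S hS) (partMap _ hS')) ⟨?_, fun a => ?_⟩
    (by rintro (x | x) <;> rfl)
  · rintro (a | a) (b | b) hab
    · exact congrArg Sum.inl (Subtype.ext hab)
    · exact absurd a.2 (by rw [show a.1 = b.1 from hab]; exact b.2)
    · exact absurd b.2 (by rw [← show a.1 = b.1 from hab]; exact a.2)
    · exact congrArg Sum.inr (Subtype.ext hab)
  · by_cases h : S a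
    · exact ⟨Sum.inl ⟨a, h⟩, rfl⟩
    · exact ⟨Sum.inr ⟨a, h⟩, rfl⟩

/-- A finite `G`-set over `X` is determined by its marks. -/
theorem marks_injective [Finite G] (X : FinGSet G) : Function.Injective (marks X) := by
  have main : ∀ (n : ℕ) (A : FinGSet G) (p : A →[G] X) (B : FinGSet G) (q : B →[G] X),
      Nat.card A = n → marks X (gcls A p) = marks X (gcls B q) → gcls A p = gcls B q := by
    intro n
    induction n using Nat.strong_induction_on with | _ n ih =>
    intro A p B q hn hm
    have e1 : ∀ i : Subgroup G × X, (∃ a, p a = i.2 ∧ ∀ k ∈ i.1, k • a = a) ↔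
        ∃ b, q b = i.2 ∧ ∀ k ∈ i.1, k • b = b := fun i => by
      rw [← fixCount_ne_zero, ← fixCount_ne_zero]
      exact not_congr (by rw [← marks_gcls, ← marks_gcls, hm])
    rcases isEmpty_or_nonempty A with hA | hA
    · refine gcls_eq ⟨fun a => hA.elim a, fun _ a => hA.elim a⟩ ⟨fun a => hA.elim a, fun b => ?_⟩
        (fun a => hA.elim a)
      obtain ⟨a, -⟩ := (e1 (⊥, q b)).2 ⟨b, rfl, fun k hk => by
        rw [Subgroup.mem_bot.1 hk, one_smul]⟩
      exact hA.elim a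
    · obtain ⟨a, ha⟩ := Finite.exists_max (fun a : A => Nat.card (MulAction.stabilizer G a))
      obtain ⟨b, hb, hab⟩ := (e1 (MulAction.stabilizer G a, p a)).1 ⟨a, rfl, fun k hk => hk⟩
      obtain ⟨a', -, hba⟩ := (e1 (MulAction.stabilizer G b, q b)).2 ⟨b, rfl, fun k hk => hk⟩
      have h1 : MulAction.stabilizer G a ≤ MulAction.stabilizer G b := hab
      have h2 : MulAction.stabilizer G b ≤ MulAction.stabilizer G a' := hba
      have h3 : MulAction.stabilizer G a = MulAction.stabilizer G a' :=
        Subgroup.eq_of_le_of_card_ge (h1.trans h2) (ha a')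
      have h4 : ∀ g : G, g • a = a ↔ g • b = b := fun g =>
        ⟨fun h => h1 h, fun h => by
          have : g ∈ MulAction.stabilizer G a := h3 ▸ h2 h
          exact this⟩
      have h5 : ∀ g k : G, g • a = k • a ↔ g • b = k • b := fun g k => by
        rw [← inv_smul_eq_iff, ← inv_smul_eq_iff (g := k), ← mul_smul, ← mul_smul, h4]
      have orb : ∀ {C : FinGSet G} (c : C) (g : G) (x : C), (∃ k : G, k • c = x) →
          ∃ k : G, k • c = g • x := fun c g x ⟨k, hk⟩ => ⟨g * k, by rw [mul_smul, hk]⟩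
      have orb' : ∀ {C : FinGSet G} (c : C) (g : G) (x : C), (¬ ∃ k : G, k • c = x) →
          ¬ ∃ k : G, k • c = g • x := fun c g x h h' => h (by
        have := orb c g⁻¹ _ h'
        rwa [inv_smul_smul] at this)
      have sA := gcls_split p (fun x => ∃ k : G, k • a = x) (orb a) (orb' a)
      have sB := gcls_split q (fun x => ∃ k : G, k • b = x) (orb b) (orb' b)
      have hO : gcls (part _ (orb a)) (p.comp (partMap _ (orb a))) =
          gcls (part _ (orb b)) (q.comp (partMap _ (orb b))) := by
        obtain ⟨φ, hφ⟩ := exists_hom (Q := part _ (orb a)) (P := part _ (orb b))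
          (fun x y => ∃ k : G, k • a = x.1 ∧ k • b = y.1)
          (fun g x y ⟨k, h, h'⟩ => ⟨g * k, (mul_smul g k a).trans (congrArg (g • ·) h),
            (mul_smul g k b).trans (congrArg (g • ·) h')⟩)
          (by
            rintro ⟨_, k, rfl⟩
            refine ⟨⟨k • b, k, rfl⟩, ⟨k, rfl, rfl⟩, ?_⟩
            rintro ⟨_, l, rfl⟩ ⟨j, hj, hj'⟩
            exact Subtype.ext (hj'.symm.trans ((h5 _ _).1 hj)))
        refine gcls_eq φ ⟨fun x y hxy => ?_, ?_⟩ fun x => ?_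
        · obtain ⟨k, hk, hk'⟩ := hφ x
          obtain ⟨l, hl, hl'⟩ := hφ y
          refine Subtype.ext (hk.symm.trans (((h5 _ _).2 ?_).trans hl))
          rw [hk', hl', hxy]
        · rintro ⟨_, k, rfl⟩
          refine ⟨⟨k • a, k, rfl⟩, ?_⟩
          obtain ⟨l, hl, hl'⟩ := hφ ⟨k • a, k, rfl⟩
          exact Subtype.ext (hl'.symm.trans ((h5 _ _).1 hl))
        · obtain ⟨k, hk, hk'⟩ := hφ x
          show q (φ x).1 = p x.1
          rw [← hk, ← hk', map_smul, map_smul, hb]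
      rw [sA, sB, hO] at hm ⊢
      rw [map_add, map_add, add_right_inj] at hm
      congr 1
      refine ih _ ?_ _ _ _ _ rfl hm
      rw [← hn]
      refine Finite.card_subtype_lt (x := a) ?_
      exact fun h => h ⟨1, one_smul G a⟩
  intro x y h
  induction x using gcls_ind with | h A p =>
  induction y using gcls_ind with | h B q =>
  exact main _ A p B q rfl h

/-- The value of the Burnside Tambara functor at `X`: the group completion of the monoid of
isomorphism classes of finite `G`-sets over `X` under disjoint union. -/
abbrev BurnsideGroup (X : FinGSet G) : Type 1 := Algebra.GrothendieckAddGroup (GSetsOver X)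

/-- The class of a finite `G`-set over `X` in the group completion. -/
noncomputable def bOf (X : FinGSet G) : GSetsOver X →+ BurnsideGroup X :=
  Algebra.GrothendieckAddGroup.of

/-- The marks of a virtual `G`-set over `X`. -/
noncomputable def ghost (X : FinGSet G) : BurnsideGroup X →+ (Subgroup G × X → ℤ) :=
  Algebra.GrothendieckAddGroup.lift (marks X)

theorem lift_bOf {X : FinGSet G} {M : Type*} [AddCommGroup M] (φ : GSetsOver X →+ M)
    (a : GSetsOver X) : Algebra.GrothendieckAddGroup.lift φ (bOf X a) = φ a :=
  DFunLike.congr_fun (Algebra.GrothendieckAddGroup.lift.symm_apply_apply φ) a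

theorem ghost_bOf {X : FinGSet G} (a : GSetsOver X) : ghost X (bOf X a) = marks X a := lift_bOf _ _

theorem exists_bOf_sub {X : FinGSet G} (κ : BurnsideGroup X) :
    ∃ a b, κ = bOf X a - bOf X b := by
  obtain ⟨⟨a, b⟩, h⟩ := (AddLocalization.addMonoidOf (⊤ : AddSubmonoid (GSetsOver X))).surj κ
  exact ⟨a, b.1, eq_sub_of_add_eq h⟩

/-- A map between Burnside groups which is polynomial in terms of marks. -/
def IsMarkPoly {X Y : FinGSet G} (F : BurnsideGroup X → BurnsideGroup Y) : Prop :=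
  ∀ i, ∃ P : MvPolynomial (Subgroup G × X) ℤ, ∀ κ, ghost Y (F κ) i =
    MvPolynomial.eval (ghost X κ) P

theorem IsMarkPoly.id (X : FinGSet G) : IsMarkPoly (fun κ : BurnsideGroup X => κ) :=
  fun i => ⟨MvPolynomial.X i, fun κ => by rw [MvPolynomial.eval_X]⟩

theorem IsMarkPoly.comp {X Y Z : FinGSet G} {F : BurnsideGroup Y → BurnsideGroup Z}
    {F' : BurnsideGroup X → BurnsideGroup Y} (h : IsMarkPoly F) (h' : IsMarkPoly F') :
    IsMarkPoly fun κ => F (F' κ) := by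
  intro i
  obtain ⟨P, hP⟩ := h i
  choose Q hQ using h'
  refine ⟨MvPolynomial.bind₁ Q P, fun κ => ?_⟩
  rw [hP]
  have : ghost Y (F' κ) = fun j => MvPolynomial.eval (ghost X κ) (Q j) := funext fun j => hQ j κ
  rw [this]
  have h1 := MvPolynomial.eval₂Hom_bind₁ (RingHom.id ℤ) (ghost X κ) Q P
  exact h1.symm

/-- The values of a polynomial along a line form a polynomial in one variable. -/
theorem exists_line {ι : Type*} (P : MvPolynomial ι ℤ) (u w : ι → ℤ) :
    ∃ p : Polynomial ℤ, ∀ t : ℤ, p.eval t = MvPolynomial.eval (fun i => u i + t * w i) P := by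
  refine ⟨MvPolynomial.aeval (fun i => Polynomial.C (u i) + Polynomial.X * Polynomial.C (w i)) P,
    fun t => ?_⟩
  have := MvPolynomial.map_aeval (fun i => Polynomial.C (u i) + Polynomial.X * Polynomial.C (w i))
    (Polynomial.evalRingHom t) P
  refine this.trans ?_
  rw [MvPolynomial.coe_eval₂Hom, ← MvPolynomial.eval₂_id]
  congr 1
  · exact RingHom.ext_int _ _
  · funext i
    simp

theorem ghost_line {X : FinGSet G} (a b : GSetsOver X) (n : ℕ) :
    ghost X (bOf X (a + n • b)) = fun i => marks X a i + n * marks X b i := by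
  funext i
  rw [ghost_bOf, map_add, map_nsmul]
  simp

theorem ghost_sub {X : FinGSet G} (a b : GSetsOver X) :
    ghost X (bOf X a - bOf X b) = fun i => marks X a i + (-1) * marks X b i := by
  funext i
  rw [map_sub, ghost_bOf, ghost_bOf, Pi.sub_apply]
  ring

theorem ghost_eq_zero {X : FinGSet G} (κ : BurnsideGroup X) {i : Subgroup G × X}
    (hi : ¬ ∀ k ∈ i.1, k • i.2 = i.2) : ghost X κ i = 0 := by
  obtain ⟨a, b, rfl⟩ := exists_bOf_sub κ
  rw [map_sub, ghost_bOf, ghost_bOf, Pi.sub_apply, marks_eq_zero _ hi, marks_eq_zero _ hi, sub_zero]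

variable [Finite G]

/-- The restriction of isomorphism classes of finite `G`-sets, as an additive map. -/
def resHom {X Y : FinGSet G} (f : X →[G] Y) : GSetsOver Y →+ GSetsOver X where
  toFun := (trivialLabels G).fRes f
  map_zero' := by
    classical
    refine marks_injective _ (funext fun i => ?_)
    rw [marks_res_eq, map_zero, map_zero]
    split_ifs <;> rfl
  map_add' a b := by
    classical
    refine marks_injective _ (funext fun i => ?_)
    rw [map_add, Pi.add_apply, marks_res_eq, marks_res_eq, marks_res_eq, map_add]
    split_ifs
    · rfl
    · exact (add_zero 0).symm

/-- The transfer of isomorphism classes of finite `G`-sets, as an additive map. -/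
def trHom {X Y : FinGSet G} (f : X →[G] Y) : GSetsOver X →+ GSetsOver Y where
  toFun := (trivialLabels G).fTr f
  map_zero' := by
    refine marks_injective _ (funext fun i => ?_)
    rw [← Prod.mk.eta (p := i), marks_tr, map_zero, map_zero]
    exact finsum_zero
  map_add' a b := by
    refine marks_injective _ (funext fun i => ?_)
    rw [map_add, Pi.add_apply, ← Prod.mk.eta (p := i), marks_tr, marks_tr, marks_tr, map_add]
    exact finsum_add_distrib (Set.toFinite (Function.support _))
      (Set.toFinite (Function.support _))

/-- Restriction in the Burnside Tambara functor. -/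
noncomputable def bRes {X Y : FinGSet G} (f : X →[G] Y) : BurnsideGroup Y →+ BurnsideGroup X :=
  Algebra.GrothendieckAddGroup.lift ((bOf X).comp (resHom f))

/-- Transfer in the Burnside Tambara functor. -/
noncomputable def bTr {X Y : FinGSet G} (f : X →[G] Y) : BurnsideGroup X →+ BurnsideGroup Y :=
  Algebra.GrothendieckAddGroup.lift ((bOf Y).comp (trHom f))

theorem bRes_bOf {X Y : FinGSet G} (f : X →[G] Y) (a : GSetsOver Y) :
    bRes f (bOf Y a) = bOf X ((trivialLabels G).fRes f a) := lift_bOf _ _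

theorem bTr_bOf {X Y : FinGSet G} (f : X →[G] Y) (a : GSetsOver X) :
    bTr f (bOf X a) = bOf Y ((trivialLabels G).fTr f a) := lift_bOf _ _

theorem ghost_injective (X : FinGSet G) : Function.Injective (ghost X) := by
  refine (injective_iff_map_eq_zero _).2 fun κ h => ?_
  obtain ⟨a, b, rfl⟩ := exists_bOf_sub κ
  rw [map_sub, ghost_bOf, ghost_bOf, sub_eq_zero] at h
  rw [marks_injective X h, sub_self]

theorem ghost_bRes {X Y : FinGSet G} (f : X →[G] Y) (κ : BurnsideGroup Y) {i : Subgroup G × X}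
    (hi : ∀ k ∈ i.1, k • i.2 = i.2) : ghost X (bRes f κ) i = ghost Y κ (i.1, f i.2) := by
  obtain ⟨a, b, rfl⟩ := exists_bOf_sub κ
  simp only [map_sub, bRes_bOf, ghost_bOf, Pi.sub_apply]
  rw [← Prod.mk.eta (p := i), marks_res _ _ _ _ hi, marks_res _ _ _ _ hi]

theorem ghost_bTr {X Y : FinGSet G} (f : X →[G] Y) (κ : BurnsideGroup X) (K : Subgroup G) (y : Y) :
    ghost Y (bTr f κ) (K, y) = ∑ᶠ x : {x // f x = y}, ghost X κ (K, x.1) := by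
  obtain ⟨a, b, rfl⟩ := exists_bOf_sub κ
  simp only [map_sub, bTr_bOf, ghost_bOf, Pi.sub_apply]
  rw [marks_tr, marks_tr]
  exact (finsum_sub_distrib (Set.toFinite (Function.support _))
    (Set.toFinite (Function.support _))).symm

theorem isMarkPoly_bRes {X Y : FinGSet G} (f : X →[G] Y) : IsMarkPoly (bRes f) := by
  intro i
  by_cases hi : ∀ k ∈ i.1, k • i.2 = i.2
  · exact ⟨MvPolynomial.X (i.1, f i.2), fun κ => by rw [MvPolynomial.eval_X, ghost_bRes f κ hi]⟩
  · exact ⟨0, fun κ => by rw [map_zero, ghost_eq_zero _ hi]⟩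

theorem isMarkPoly_bTr {X Y : FinGSet G} (f : X →[G] Y) : IsMarkPoly (bTr f) := by
  rintro ⟨K, y⟩
  have := Fintype.ofFinite {x // f x = y}
  refine ⟨∑ x : {x // f x = y}, MvPolynomial.X (K, x.1), fun κ => ?_⟩
  rw [ghost_bTr, finsum_eq_sum_of_fintype, map_sum]
  simp only [MvPolynomial.eval_X]

/-- Polynomial maps which agree on all `G`-sets are equal. -/
theorem IsMarkPoly.ext {X Y : FinGSet G} {F F' : BurnsideGroup X → BurnsideGroup Y} (h : IsMarkPoly F)
    (h' : IsMarkPoly F') (hF : ∀ a, F (bOf X a) = F' (bOf X a)) (κ : BurnsideGroup X) : F κ = F' κ := by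
  refine ghost_injective _ (funext fun i => ?_)
  obtain ⟨P, hP⟩ := h i
  obtain ⟨P', hP'⟩ := h' i
  obtain ⟨a, b, rfl⟩ := exists_bOf_sub κ
  obtain ⟨p, hp⟩ := exists_line P (marks X a) (marks X b)
  obtain ⟨p', hp'⟩ := exists_line P' (marks X a) (marks X b)
  rw [hP, hP', ghost_sub, ← hp, ← hp']
  congr 1
  refine Polynomial.eq_of_infinite_eval_eq _ _ (Set.infinite_of_injective_forall_mem
    (f := fun n : ℕ => (n : ℤ)) Nat.cast_injective fun n => ?_)
  show p.eval (n : ℤ) = p'.eval (n : ℤ)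
  rw [hp, hp', ← ghost_line, ← hP, ← hP', hF]

/-- The norm extends to the group completion, as a polynomial map. -/
theorem exists_bNm {X Y : FinGSet G} (f : X →[G] Y) (κ : BurnsideGroup X) :
    ∃ l : BurnsideGroup Y, ∀ i, ghost Y l i =
      MvPolynomial.eval (ghost X κ) (marks_nm f i).choose := by
  have := Fintype.ofFinite (Subgroup G × Y)
  obtain ⟨a, b, rfl⟩ := exists_bOf_sub κ
  choose p hp using fun i => exists_line (marks_nm f i).choose (marks X a) (marks X b)
  obtain ⟨N, hN⟩ : ∃ N, ∀ i, (p i).natDegree < N :=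
    ⟨(Finset.univ.sup fun i => (p i).natDegree) + 1, fun i =>
      Nat.lt_succ_of_le (Finset.le_sup (f := fun i => (p i).natDegree) (Finset.mem_univ i))⟩
  refine ⟨- ∑ k ∈ Finset.range N, ((-1 : ℤ) ^ (k + 1) * (N.choose (k + 1) : ℤ)) •
    bOf Y ((trivialLabels G).fNm f (a + k • b)), fun i => ?_⟩
  rw [ghost_sub, ← hp, map_neg, map_sum, Pi.neg_apply, Finset.sum_apply]
  have h1 : ∀ k : ℕ, ghost Y (((-1 : ℤ) ^ (k + 1) * (N.choose (k + 1) : ℤ)) •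
      bOf Y ((trivialLabels G).fNm f (a + k • b))) i =
      (-1 : ℤ) ^ (k + 1) * (N.choose (k + 1) : ℤ) * (p i).eval (k : ℤ) := fun k => by
    rw [map_zsmul, Pi.smul_apply, ghost_bOf, (marks_nm f i).choose_spec, hp, ← ghost_line,
      ghost_bOf, smul_eq_mul]
  simp only [h1]
  have h2 := congrFun (Polynomial.fwdDiff_iter_eq_zero_of_degree_lt (hN i)) (-1)
  rw [fwdDiff_iter_eq_sum_shift, Finset.sum_range_succ'] at h2
  have h3 : ∑ k ∈ Finset.range N, ((-1 : ℤ) ^ (N - (k + 1)) * (N.choose (k + 1) : ℤ)) •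
      (p i).eval (-1 + (k + 1) • (1 : ℤ)) = (-1) ^ N * ∑ k ∈ Finset.range N,
      (-1 : ℤ) ^ (k + 1) * (N.choose (k + 1) : ℤ) * (p i).eval (k : ℤ) := by
    rw [Finset.mul_sum]
    refine Finset.sum_congr rfl fun k hk => ?_
    have hk' : k + 1 ≤ N := Finset.mem_range.1 hk
    have e1 : (-1 : ℤ) ^ (N - (k + 1)) = (-1) ^ N * (-1) ^ (k + 1) := by
      conv_rhs => rw [← Nat.sub_add_cancel hk', pow_add, mul_assoc, ← mul_pow]
      simp
    have e2 : (-1 : ℤ) + (k + 1) • (1 : ℤ) = k := by simp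
    rw [e1, e2, smul_eq_mul]
    ring
  rw [h3] at h2
  simp only [Nat.sub_zero, Nat.choose_zero_right, Nat.cast_one, mul_one, zero_smul, add_zero,
    smul_eq_mul, Pi.zero_apply, ← mul_add] at h2
  have h4 := (mul_eq_zero.1 h2).resolve_left (pow_ne_zero _ (by norm_num))
  linarith

/-- Norm in the Burnside Tambara functor: the extension of the dependent product from finite
`G`-sets to virtual finite `G`-sets, which is the only one that is polynomial in terms of marks. -/
noncomputable def bNm {X Y : FinGSet G} (f : X →[G] Y) (κ : BurnsideGroup X) : BurnsideGroup Y :=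
  (exists_bNm f κ).choose

theorem isMarkPoly_bNm {X Y : FinGSet G} (f : X →[G] Y) : IsMarkPoly (bNm f) :=
  fun i => ⟨_, fun κ => (exists_bNm f κ).choose_spec i⟩

theorem bNm_bOf {X Y : FinGSet G} (f : X →[G] Y) (a : GSetsOver X) :
    bNm f (bOf X a) = bOf Y ((trivialLabels G).fNm f a) := by
  refine ghost_injective _ (funext fun i => ?_)
  rw [bNm, (exists_bNm f _).choose_spec, ghost_bOf, ghost_bOf]
  exact ((marks_nm f i).choose_spec a).symm

theorem ghost_ext {X : FinGSet G} {κ l : BurnsideGroup X}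
    (h : ∀ (K : Subgroup G) (x : X), (∀ k ∈ K, k • x = x) → ghost X κ (K, x) = ghost X l (K, x)) :
    κ = l := by
  refine ghost_injective _ (funext fun i => ?_)
  by_cases hi : ∀ k ∈ i.1, k • i.2 = i.2
  · exact h i.1 i.2 hi
  · rw [ghost_eq_zero _ hi, ghost_eq_zero _ hi]

theorem ghost_bTr_inl_add {X Y : FinGSet G} (κ : BurnsideGroup X) (l : BurnsideGroup Y)
    (K : Subgroup G) (x : X.sum Y) :
    ghost (X.sum Y) (bTr inl κ + bTr inr l) (K, x) =
      Sum.elim (fun x => ghost X κ (K, x)) (fun y => ghost Y l (K, y)) x := by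
  rw [map_add, Pi.add_apply, ghost_bTr, ghost_bTr]
  rcases x with x | y
  · have h1 : IsEmpty {y : Y // (inr : Y →[G] X.sum Y) y = Sum.inl x} := ⟨fun y => Sum.inr_ne_inl y.2⟩
    let _ : Unique {x' : X // (inl : X →[G] X.sum Y) x' = Sum.inl x} :=
      ⟨⟨⟨x, rfl⟩⟩, fun z => Subtype.ext (Sum.inl_injective z.2)⟩
    exact (congrArg₂ (· + ·) (finsum_unique _) (finsum_of_isEmpty _)).trans (add_zero _)
  · have h1 : IsEmpty {x : X // (inl : X →[G] X.sum Y) x = Sum.inr y} := ⟨fun x => Sum.inl_ne_inr x.2⟩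
    let _ : Unique {y' : Y // (inr : Y →[G] X.sum Y) y' = Sum.inr y} :=
      ⟨⟨⟨y, rfl⟩⟩, fun z => Subtype.ext (Sum.inr_injective z.2)⟩
    exact (congrArg₂ (· + ·) (finsum_of_isEmpty _) (finsum_unique _)).trans (zero_add _)

/-- The Burnside Tambara functor `A`: the group completion of the semi-Tambara functor `gsets G`.
Its value at `X` is the Grothendieck group of finite `G`-sets over `X`. -/
noncomputable def burnside (G : Type) [Group G] [Finite G] : TambaraFunctor.{1} G where
  obj X := BurnsideGroup X
  res f := bRes f
  tr f := bTr f
  nm f := bNm f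
  res_id {X} κ := (isMarkPoly_bRes _).ext (.id X) (fun a => by
    rw [bRes_bOf]; exact congrArg _ ((gsets G).res_id a)) κ
  res_comp f g κ := ((isMarkPoly_bRes f).comp (isMarkPoly_bRes g)).ext (isMarkPoly_bRes _) (fun a => by
    rw [bRes_bOf, bRes_bOf, bRes_bOf]; exact congrArg _ ((gsets G).res_comp f g a)) κ
  tr_id {X} κ := (isMarkPoly_bTr _).ext (.id X) (fun a => by
    rw [bTr_bOf]; exact congrArg _ ((gsets G).tr_id a)) κ
  tr_comp f g κ := ((isMarkPoly_bTr g).comp (isMarkPoly_bTr f)).ext (isMarkPoly_bTr _) (fun a => by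
    rw [bTr_bOf, bTr_bOf, bTr_bOf]; exact congrArg _ ((gsets G).tr_comp f g a)) κ
  nm_id {X} κ := (isMarkPoly_bNm _).ext (.id X) (fun a => by
    rw [bNm_bOf]; exact congrArg _ ((gsets G).nm_id a)) κ
  nm_comp f g κ := ((isMarkPoly_bNm g).comp (isMarkPoly_bNm f)).ext (isMarkPoly_bNm _) (fun a => by
    rw [bNm_bOf, bNm_bOf, bNm_bOf]; exact congrArg _ ((gsets G).nm_comp f g a)) κ
  res_nm f' g' f g H κ := ((isMarkPoly_bRes g).comp (isMarkPoly_bNm f)).ext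
    ((isMarkPoly_bNm g').comp (isMarkPoly_bRes f')) (fun a => by
      rw [bNm_bOf, bRes_bOf, bRes_bOf, bNm_bOf]
      exact congrArg _ ((gsets G).res_nm f' g' f g H a)) κ
  res_tr f' g' f g H κ := ((isMarkPoly_bRes g).comp (isMarkPoly_bTr f)).ext
    ((isMarkPoly_bTr g').comp (isMarkPoly_bRes f')) (fun a => by
      rw [bTr_bOf, bRes_bOf, bRes_bOf, bTr_bOf]
      exact congrArg _ ((gsets G).res_tr f' g' f g H a)) κ
  nm_tr h f e q p H κ := ((isMarkPoly_bNm f).comp (isMarkPoly_bTr h)).ext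
    ((isMarkPoly_bTr p).comp ((isMarkPoly_bNm q).comp (isMarkPoly_bRes e))) (fun a => by
      rw [bTr_bOf, bNm_bOf, bRes_bOf, bNm_bOf, bTr_bOf]
      exact congrArg _ ((gsets G).nm_tr h f e q p H a)) κ
  obj_empty X hX := ⟨0, trivial, fun κ _ => ghost_ext fun _ x => hX.elim x⟩
  obj_sum {X Y} κ l := by
    refine ⟨bTr inl κ + bTr inr l, ⟨ghost_ext fun K x hx => ?_, ghost_ext fun K x hx => ?_⟩,
      fun z hz => ghost_ext fun K x hx => ?_⟩
    · rw [ghost_bRes _ _ hx, ghost_bTr_inl_add]; rfl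
    · rw [ghost_bRes _ _ hx, ghost_bTr_inl_add]; rfl
    · rw [ghost_bTr_inl_add, ← hz.1, ← hz.2]
      rcases x with x | x
      · exact (ghost_bRes inl z (i := (K, x)) fun k hk => Sum.inl_injective (hx k hk)).symm
      · exact (ghost_bRes inr z (i := (K, x)) fun k hk => Sum.inr_injective (hx k hk)).symm
  exists_neg {X} κ := by
    refine ⟨bTr inl κ + bTr inr (-κ), 0, ghost_ext fun K x hx => ?_, ?_⟩
    · rw [ghost_bRes _ _ hx, ghost_bTr_inl_add]; rfl
    · have h1 : ∀ (g : X →[G] X.sum X), (fold X).comp g = MulActionHom.id G → ∀ l : BurnsideGroup X,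
          bTr (fold X) (bTr g l) = l := fun g hg l =>
        ((isMarkPoly_bTr (fold X)).comp (isMarkPoly_bTr g)).ext (.id X) (fun a => by
          rw [bTr_bOf, bTr_bOf]
          refine congrArg _ (((gsets G).tr_comp g (fold X) a).trans ?_)
          rw [hg]
          exact (gsets G).tr_id a) l
      rw [map_add, map_zero, h1 inl rfl, h1 inr rfl, add_neg_cancel]

/-- The class `[T] ∈ A(G/G)` of a finite `G`-set `T`. -/
noncomputable def burnsideCls (T : FinGSet G) : BurnsideGroup (pt G) := bOf _ (gcls T (toPt T))

/-- Multiplication by `[T]` on `A(X)`: the map `[B → X] ↦ [B × T → X]`, written as restriction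
followed by transfer along the projection `X × T → X`. -/
noncomputable def burnsideMul (T : FinGSet G) {X : FinGSet G} (z : BurnsideGroup X) :
    BurnsideGroup X :=
  bTr (fst : X.prod T →[G] X) (bRes fst z)

end Burnside

/-!
Write `G = D_{2m}` with `m` odd, `H = ⟨τ⟩`, and `d = 2 - [G/μ_m]`.

*The quotient.* Restriction to the rotations is compatible with the whole Tambara structure; here it
is `rotRes X : A(X) → A(X × G/μ_m)`. It kills `d`, so it factors through the quotient by the ideal
generated by `d`. Conversely an element killed by `rotRes` is a multiple of `d`. Indeed, let `A` and
`B` be `G`-sets over `X` which are isomorphic as `μ_m`-sets over `X`, and let `a : A` have a maximal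
group of rotations in its stabilizer. There is a point `b : B` over the same point of `X` with the
same rotations in its stabilizer. If both stabilizers contain a reflection, `b` may be chosen with
the same stabilizer as `a`, because two reflections in a dihedral group of order twice an odd number
are conjugate by a rotation in the subgroup that they generate. If only that of `a` contains one,
the orbit of `b` is `[G/μ_m]` times the orbit of `a`, and differs by a multiple of `d` from twice
the orbit of `a`. So orbits can be cancelled one after the other (`map_eq_of_rotRes_eq`). This shows
that the quotient by the ideal is the additive cokernel of `d` (`toQuotient_eq_iff_exists`) and that
`rotRes` is injective on it (`quotRotRes_injective`).

*The comparison map.* An element of the norm of `ℤ` is the class of a `G`-set `p : A → Y` with an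
`H`-invariant label `φ : A → ℤ`. Let `ε : G ×_H A → A` be the action map. The label `φ` corresponds
to a `G`-invariant function on `G ×_H A`, and this function to a virtual `G`-set over `G ×_H A` on
whose fibres the stabilizers act trivially. The map `psi` sends the class of `(A, p, φ)` to the
transfer along `p` of the norm along `ε` of this virtual set. Invariant functions and virtual sets
have different transfers and norms, but over `G ×_H A` the difference is invisible to `rotRes`:
stabilizers in `G ×_H A` meet `μ_m` trivially, so that only the cardinalities of the fibres matter
(`rotRes_ind_eq`). Hence the relations between norms, transfers and restrictions in the Burnside
functor show that `psi` respects the relation which defines the norm, and that it is a map of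
Tambara functors.

*Bijectivity.* Let `phi : A(Y) → N(ℤ)(Y)` put the label `1` on a `G`-set. Then `psi ∘ phi` is the
quotient map, so `psi` is surjective, and it is injective if `phi` is surjective and kills the
multiples of `d`. Up to `G`-sets with smaller stabilizers, the class of a transitive `G`-set is
additive in the label at one `H`-orbit (`exists_nCls_add`), so `phi` is surjective by induction on
stabilizers. If all stabilizers in `A` consist of rotations, then `d [A] = 0` already. If a
transitive `A` has a point `a` fixed by `τ`, consider its class with label `2` at `a` and `1`
elsewhere. On the one hand it is `2 [A] + [P]`, and on the other hand it is `[P']`, where `P` and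
`P'` have smaller stabilizers than `A` and label `1` (`exists_nCls_add`, `exists_nCls_eq_one`).
Applying `psi` one finds that `[G/μ_m] [A] + [P]` and `[P']` agree on rotations, and by induction on
stabilizers they agree in the norm (`map_eq_of_rotRes_eq`); so `2 [A] = [G/μ_m] [A]` there
(`phi_dMul_of_transitive`).
-/

open DihedralGroup TambaraFunctor

/-! ### Rotations and reflections -/

namespace DihedralGroup

variable {m : ℕ}

/-- The subgroup `μ_m` of rotations. -/
abbrev rot (m : ℕ) : Subgroup (DihedralGroup m) := Subgroup.zpowers (r 1)

/-- The subgroup generated by the reflection `τ = sr 0`. -/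
abbrev refl (m : ℕ) : Subgroup (DihedralGroup m) := Subgroup.zpowers (sr 0)

theorem mem_rot {g : DihedralGroup m} : g ∈ rot m ↔ ∃ i, g = r i := by
  constructor
  · rintro ⟨k, rfl⟩
    exact ⟨_, r_one_zpow k⟩
  · rintro ⟨i, rfl⟩
    obtain ⟨k, rfl⟩ := ZMod.intCast_surjective i
    exact ⟨k, r_one_zpow k⟩

theorem notMem_rot {g : DihedralGroup m} : g ∉ rot m ↔ ∃ i, g = sr i := by
  rw [mem_rot]
  rcases g with i | i
  · simp
  · simp

theorem mem_refl {g : DihedralGroup m} : g ∈ refl m ↔ g = 1 ∨ g = sr 0 := by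
  constructor
  · rintro ⟨k, rfl⟩
    have h2 : (sr 0 : DihedralGroup m) ^ (2 : ℤ) = 1 := by
      rw [zpow_ofNat, pow_two, sr_mul_self]
    obtain ⟨l, rfl | rfl⟩ := Int.even_or_odd' k
    · left
      show (sr 0 : DihedralGroup m) ^ (2 * l) = 1
      rw [zpow_mul, h2, one_zpow]
    · right
      show (sr 0 : DihedralGroup m) ^ (2 * l + 1) = _
      rw [zpow_add, zpow_mul, h2, one_zpow, one_mul, zpow_one]
  · rintro (rfl | rfl)
    · exact one_mem _
    · exact Subgroup.mem_zpowers _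

theorem sr_notMem_rot (i : ZMod m) : sr i ∉ rot m := notMem_rot.2 ⟨i, rfl⟩

theorem mul_self_of_notMem_rot {g : DihedralGroup m} (hg : g ∉ rot m) : g * g = 1 := by
  obtain ⟨i, rfl⟩ := notMem_rot.1 hg
  exact sr_mul_self i

theorem mul_mem_rot_iff {g k : DihedralGroup m} : g * k ∈ rot m ↔ (g ∈ rot m ↔ k ∈ rot m) := by
  rcases g with i | i <;> rcases k with j | j <;> simp [mem_rot]

theorem mul_rot {g u : DihedralGroup m} (hg : g ∉ rot m) (hu : u ∈ rot m) : g * u = u⁻¹ * g := by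
  obtain ⟨i, rfl⟩ := notMem_rot.1 hg
  obtain ⟨j, rfl⟩ := mem_rot.1 hu
  simp

theorem conj_mem_rot {g u : DihedralGroup m} : g * u * g⁻¹ ∈ rot m ↔ u ∈ rot m := by
  simp only [mul_mem_rot_iff, inv_mem_iff]
  tauto

theorem rot_comm {u v : DihedralGroup m} (hu : u ∈ rot m) (hv : v ∈ rot m) : u * v = v * u := by
  obtain ⟨i, rfl⟩ := mem_rot.1 hu
  obtain ⟨j, rfl⟩ := mem_rot.1 hv
  simp [add_comm]

/-- For odd `m` every rotation is a square of a power of itself. -/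
theorem rot_sq (hm : Odd m) {u : DihedralGroup m} (hu : u ∈ rot m) :
    u ^ ((m + 1) / 2) * u ^ ((m + 1) / 2) = u := by
  obtain ⟨l, hl⟩ := hm
  have h1 : (m + 1) / 2 + (m + 1) / 2 = m + 1 := by omega
  obtain ⟨i, rfl⟩ := mem_rot.1 hu
  rw [← pow_add, h1, r_pow]
  simp

/-- For odd `m` any two reflections are conjugate, by a rotation in the subgroup that they
generate. -/
theorem conj_rot (hm : Odd m) {g k : DihedralGroup m} (hg : g ∉ rot m) (hk : k ∉ rot m) :
    ∃ l : ℕ, (k * g) ^ l ∈ rot m ∧ (k * g) ^ l * g * ((k * g) ^ l)⁻¹ = k := by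
  have h0 : k * g ∈ rot m := mul_mem_rot_iff.2 (by tauto)
  refine ⟨(m + 1) / 2, pow_mem h0 _, ?_⟩
  have h1 := mul_rot hg (inv_mem (pow_mem h0 ((m + 1) / 2)))
  rw [mul_assoc, h1, inv_inv, ← mul_assoc, rot_sq hm h0, mul_assoc, mul_self_of_notMem_rot hg,
    mul_one]

/-- The two-point set `D_{2m}/μ_m`. -/
abbrev orient (m : ℕ) [NeZero m] : FinGSet (DihedralGroup m) := orbit (rot m)

/-- The base point of `D_{2m}/μ_m`. -/
def orientPt (m : ℕ) [NeZero m] : orient m := ((1 : DihedralGroup m) : DihedralGroup m ⧸ rot m)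

variable [NeZero m]

theorem orient_cases (c : orient m) : ∃ g : DihedralGroup m, g • orientPt m = c := by
  obtain ⟨g, rfl⟩ := QuotientGroup.mk_surjective (show DihedralGroup m ⧸ rot m from c)
  exact ⟨g, congrArg (fun x : DihedralGroup m => (x : DihedralGroup m ⧸ rot m)) (mul_one g)⟩

theorem smul_orientPt {g k : DihedralGroup m} :
    g • orientPt m = k • orientPt m ↔ g⁻¹ * k ∈ rot m := by
  have h : ∀ g : DihedralGroup m, g • orientPt m = (g : DihedralGroup m ⧸ rot m) := fun g =>
    congrArg (fun x : DihedralGroup m => (x : DihedralGroup m ⧸ rot m)) (mul_one g)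
  rw [h, h]
  exact QuotientGroup.eq

theorem smul_orient_eq_iff {g : DihedralGroup m} (c : orient m) : g • c = c ↔ g ∈ rot m := by
  obtain ⟨k, rfl⟩ := orient_cases c
  rw [← mul_smul, smul_orientPt]
  simp only [mul_mem_rot_iff, inv_mem_iff]
  tauto

end DihedralGroup


/-! ### Restriction to rotations and multiplication by `2 - [D_{2m}/μ_m]` -/

section RotRes

variable {m : ℕ} [NeZero m]

/-- Restriction along the projection `X × D_{2m}/μ_m → X`. Up to the identification of
`D_{2m}`-sets over `D_{2m}/μ_m` with `μ_m`-sets, this is the restriction to the rotations. -/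
noncomputable def rotRes (X : FinGSet (DihedralGroup m)) :
    BurnsideGroup X →+ BurnsideGroup (X.prod (orient m)) :=
  bRes (fst : X.prod (orient m) →[DihedralGroup m] X)

/-- The points of `X × D_{2m}/μ_m` are fixed by rotations only, so `rotRes` remembers exactly the
marks at groups of rotations. -/
theorem rotRes_eq_iff {X : FinGSet (DihedralGroup m)} {κ l : BurnsideGroup X} :
    rotRes X κ = rotRes X l ↔ ∀ K : Subgroup (DihedralGroup m), K ≤ rot m → ∀ x : X,
      (∀ k ∈ K, k • x = x) → ghost X κ (K, x) = ghost X l (K, x) := by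
  constructor
  · intro h K hK x hx
    have hi : ∀ k ∈ K, k • ((x, orientPt m) : X.prod (orient m)) = (x, orientPt m) := fun k hk =>
      Prod.ext (hx k hk) ((smul_orient_eq_iff _).2 (hK hk))
    have h1 := ghost_bRes (fst : X.prod (orient m) →[DihedralGroup m] X) κ (i := (K, (x, orientPt m))) hi
    have h2 := ghost_bRes (fst : X.prod (orient m) →[DihedralGroup m] X) l (i := (K, (x, orientPt m))) hi
    exact h1.symm.trans ((congrArg (fun z : BurnsideGroup (X.prod (orient m)) =>
      ghost _ z (K, ((x, orientPt m) : X.prod (orient m)))) h).trans h2)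
  · intro h
    refine ghost_ext fun K z hz => ?_
    have hK : K ≤ rot m := fun k hk => (smul_orient_eq_iff z.2).1 (congrArg Prod.snd (hz k hk))
    have hx : ∀ k ∈ K, k • (fst z : X) = fst z := fun k hk => congrArg Prod.fst (hz k hk)
    have h1 := ghost_bRes (fst : X.prod (orient m) →[DihedralGroup m] X) κ (i := (K, z)) hz
    have h2 := ghost_bRes (fst : X.prod (orient m) →[DihedralGroup m] X) l (i := (K, z)) hz
    exact h1.trans ((h K hK (fst z) hx).trans h2.symm)

/-- Multiplication by `2 - [D_{2m}/μ_m]`. -/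
noncomputable def dMul (X : FinGSet (DihedralGroup m)) : BurnsideGroup X →+ BurnsideGroup X :=
  2 • AddMonoidHom.id _ - (bTr fst).comp (rotRes X)

theorem dMul_apply {X : FinGSet (DihedralGroup m)} (z : BurnsideGroup X) :
    dMul X z = 2 • z - burnsideMul (orient m) z := rfl

theorem card_orient : Nat.card (orient m) = 2 := by
  rw [Nat.card_eq_two_iff]
  refine ⟨orientPt m, sr (0 : ZMod m) • orientPt m, fun h => ?_, ?_⟩
  · have := (smul_orient_eq_iff _).1 h.symm
    exact sr_notMem_rot _ this
  · refine Set.eq_univ_of_forall fun c => ?_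
    obtain ⟨g, rfl⟩ := orient_cases c
    by_cases hg : g ∈ rot m
    · exact Or.inl ((smul_orient_eq_iff _).2 hg)
    · refine Or.inr (smul_orientPt.2 (mul_mem_rot_iff.2 ?_))
      rw [inv_mem_iff]
      exact ⟨fun h => absurd h hg, fun h => absurd h (sr_notMem_rot _)⟩

theorem ghost_burnsideMul {X : FinGSet (DihedralGroup m)} (z : BurnsideGroup X)
    {K : Subgroup (DihedralGroup m)} {x : X} (hx : ∀ k ∈ K, k • x = x) [Decidable (K ≤ rot m)] :
    ghost X (burnsideMul (orient m) z) (K, x) = if K ≤ rot m then 2 * ghost X z (K, x) else 0 := by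
  rw [burnsideMul, ghost_bTr]
  split_ifs with hK
  · have h1 : ∀ y : {y : X.prod (orient m) // fst y = x},
        ghost _ (bRes (fst : X.prod (orient m) →[DihedralGroup m] X) z) (K, y.1) =
          ghost X z (K, x) := by
      rintro ⟨⟨y, c⟩, rfl⟩
      exact ghost_bRes (fst : X.prod (orient m) →[DihedralGroup m] X) z (i := (K, (y, c)))
        fun k hk => Prod.ext (hx k hk) ((smul_orient_eq_iff _).2 (hK hk))
    rw [finsum_congr h1]
    have e : {y : X.prod (orient m) // (fst : _ →[DihedralGroup m] X) y = x} ≃ orient m :=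
      { toFun := fun y => y.1.2
        invFun := fun c => ⟨(x, c), rfl⟩
        left_inv := by rintro ⟨⟨y, c⟩, rfl⟩; rfl
        right_inv := fun _ => rfl }
    have := Fintype.ofFinite {y : X.prod (orient m) // (fst : _ →[DihedralGroup m] X) y = x}
    rw [finsum_eq_sum_of_fintype, Finset.sum_const, Finset.card_univ, ← Nat.card_eq_fintype_card,
      Nat.card_congr e, card_orient]
    simp
  · refine finsum_eq_zero_of_forall_eq_zero fun y => ghost_eq_zero _ fun h => hK fun k hk => ?_
    exact (smul_orient_eq_iff y.1.2).1 (congrArg Prod.snd (h k hk))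

theorem rotRes_dMul {X : FinGSet (DihedralGroup m)} (z : BurnsideGroup X) :
    rotRes X (dMul X z) = 0 := by
  classical
  rw [← map_zero (rotRes X), rotRes_eq_iff]
  intro K hK x hx
  rw [dMul_apply, map_sub, Pi.sub_apply, ghost_burnsideMul z hx, if_pos hK, map_nsmul, map_zero]
  simp

/-- The map `X × D_{2m}/μ_m → Y × D_{2m}/μ_m` induced by `f : X → Y`. -/
def prodOrient {X Y : FinGSet (DihedralGroup m)} (f : X →[DihedralGroup m] Y) :
    X.prod (orient m) →[DihedralGroup m] Y.prod (orient m) :=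
  ⟨fun x => (f x.1, x.2), fun g x => Prod.ext (map_smul f g x.1) rfl⟩

theorem isPb_prodOrient {X Y : FinGSet (DihedralGroup m)} (f : X →[DihedralGroup m] Y) :
    IsPb (fst : X.prod (orient m) →[DihedralGroup m] X) (prodOrient f) f fst := by
  refine ⟨fun _ => rfl, ?_⟩
  rintro x ⟨y, c⟩ rfl
  refine ⟨(x, c), ⟨rfl, rfl⟩, ?_⟩
  rintro ⟨x', c'⟩ ⟨rfl, h⟩
  have h' : c' = c := congrArg Prod.snd h
  exact Prod.ext rfl h'

/-- Multiplication by `[D_{2m}/μ_m]` on the class of a `D_{2m}`-set. -/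
theorem burnsideMul_bOf {X A : FinGSet (DihedralGroup m)} (p : A →[DihedralGroup m] X) :
    burnsideMul (orient m) (bOf X (gcls A p)) =
      bOf X (gcls (A.prod (orient m)) (p.comp fst)) := by
  rw [burnsideMul, bRes_bOf, bTr_bOf]
  exact congrArg (fun z => bOf X ((trivialLabels _).fTr fst z))
    (NormSystem.fRes_mk (M := trivialLabels _) (m := ()) (isPb_prodOrient p))

/-- The generator `2 - [D_{2m}/μ_m]`. -/
noncomputable def dGen (m : ℕ) [NeZero m] : BurnsideGroup (pt (DihedralGroup m)) :=
  2 • burnsideCls (pt (DihedralGroup m)) - burnsideCls (orient m)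

theorem bTr_bRes_dGen {X A : FinGSet (DihedralGroup m)} (p : A →[DihedralGroup m] X) :
    bTr p (bRes (toPt A) (dGen m)) = dMul X (bOf X (gcls A p)) := by
  have h : ∀ T : FinGSet (DihedralGroup m), bTr p (bRes (toPt A) (burnsideCls T)) =
      bOf X (gcls (A.prod T) (p.comp fst)) := by
    intro T
    rw [burnsideCls, bRes_bOf, bTr_bOf]
    have H : IsPb (snd : A.prod T →[DihedralGroup m] T) (fst : A.prod T →[DihedralGroup m] A)
        (toPt T) (toPt A) := by
      refine ⟨fun _ => rfl, fun t a _ => ⟨(a, t), ⟨rfl, rfl⟩, fun z hz => Prod.ext hz.2 hz.1⟩⟩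
    exact congrArg (fun z => bOf X ((trivialLabels _).fTr p z))
      (NormSystem.fRes_mk (M := trivialLabels _) (m := ()) H)
  have h1 : gcls (A.prod (pt _)) (p.comp fst) = gcls A p :=
    gcls_eq fst ⟨fun a b hab => Prod.ext hab rfl, fun a => ⟨(a, ()), rfl⟩⟩ fun _ => rfl
  rw [dGen, map_sub, map_sub, map_nsmul, map_nsmul, h, h, dMul_apply, burnsideMul_bOf, h1]

theorem ghost_dGen_of_le {K : Subgroup (DihedralGroup m)} (hK : K ≤ rot m)
    (x : pt (DihedralGroup m)) : ghost _ (dGen m) (K, x) = 0 := by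
  have h := bTr_bRes_dGen (MulActionHom.id _ : pt (DihedralGroup m) →[DihedralGroup m] _)
  have h2 : ghost _ (bTr (MulActionHom.id _) (bRes (toPt (pt (DihedralGroup m))) (dGen m))) (K, x) =
      ghost _ (dGen m) (K, x) := by
    rw [ghost_bTr]
    refine (finsum_fiber_id (fun y : pt (DihedralGroup m) =>
      ghost _ (bRes (toPt (pt (DihedralGroup m))) (dGen m)) (K, y)) x).trans ?_
    exact ghost_bRes (toPt (pt (DihedralGroup m))) (dGen m) (i := (K, x)) fun k _ => rfl
  rw [← h2, h]
  have h3 := rotRes_dMul (bOf _ (gcls (pt (DihedralGroup m)) (MulActionHom.id _)))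
  rw [← map_zero (rotRes _), rotRes_eq_iff] at h3
  exact (h3 K hK x fun k _ => rfl).trans (by rw [map_zero]; rfl)

end RotRes

/-! ### Addition and congruences in the Burnside Tambara functor -/

section BurnsideCongruence

variable {G : Type} [Group G] [Finite G]

theorem bTr_id {X : FinGSet G} (κ : BurnsideGroup X) : bTr (MulActionHom.id G) κ = κ :=
  (burnside G).tr_id κ

theorem bTr_bTr {X Y Z : FinGSet G} (f : X →[G] Y) (g : Y →[G] Z) (κ : BurnsideGroup X) :
    bTr g (bTr f κ) = bTr (g.comp f) κ := (burnside G).tr_comp f g κ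

theorem bRes_id {X : FinGSet G} (κ : BurnsideGroup X) : bRes (MulActionHom.id G) κ = κ :=
  (burnside G).res_id κ

theorem bRes_bRes {X Y Z : FinGSet G} (f : X →[G] Y) (g : Y →[G] Z) (κ : BurnsideGroup Z) :
    bRes f (bRes g κ) = bRes (g.comp f) κ := (burnside G).res_comp f g κ

theorem bNm_bNm {X Y Z : FinGSet G} (f : X →[G] Y) (g : Y →[G] Z) (κ : BurnsideGroup X) :
    bNm g (bNm f κ) = bNm (g.comp f) κ := (burnside G).nm_comp f g κ

theorem bRes_bTr {P X Y Z : FinGSet G} (f' : P →[G] X) (g' : P →[G] Y) (f : X →[G] Z)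
    (g : Y →[G] Z) (H : IsPb f' g' f g) (κ : BurnsideGroup X) :
    bRes g (bTr f κ) = bTr g' (bRes f' κ) := (burnside G).res_tr f' g' f g H κ

theorem bRes_bNm {P X Y Z : FinGSet G} (f' : P →[G] X) (g' : P →[G] Y) (f : X →[G] Z)
    (g : Y →[G] Z) (H : IsPb f' g' f g) (κ : BurnsideGroup X) :
    bRes g (bNm f κ) = bNm g' (bRes f' κ) := (burnside G).res_nm f' g' f g H κ

theorem bNm_bTr {A X Y E P : FinGSet G} (h : A →[G] X) (f : X →[G] Y) (e : E →[G] A) (q : E →[G] P)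
    (p : P →[G] Y) (H : IsExp h f e q p) (κ : BurnsideGroup A) :
    bNm f (bTr h κ) = bTr p (bNm q (bRes e κ)) := (burnside G).nm_tr h f e q p H κ

theorem burnside_zero (X : FinGSet G) : (burnside G).zero X = (0 : BurnsideGroup X) := by
  have h : ((burnside G).obj_empty (empty G) (inferInstanceAs (IsEmpty Empty))).choose =
      (0 : BurnsideGroup (empty G)) :=
    ghost_ext fun _ x => Empty.elim x
  exact (congrArg (bTr (fromEmpty X)) h).trans (map_zero _)

/-- The element of `A(X ⊔ Y)` with given components. -/
noncomputable def bPair {X Y : FinGSet G} (κ : BurnsideGroup X) (l : BurnsideGroup Y) :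
    BurnsideGroup (X.sum Y) := bTr inl κ + bTr inr l

theorem bRes_inl_bPair {X Y : FinGSet G} (κ : BurnsideGroup X) (l : BurnsideGroup Y) :
    bRes inl (bPair κ l) = κ := by
  refine ghost_ext fun K x hx => ?_
  rw [ghost_bRes _ _ hx, bPair, ghost_bTr_inl_add]
  rfl

theorem bRes_inr_bPair {X Y : FinGSet G} (κ : BurnsideGroup X) (l : BurnsideGroup Y) :
    bRes inr (bPair κ l) = l := by
  refine ghost_ext fun K x hx => ?_
  rw [ghost_bRes _ _ hx, bPair, ghost_bTr_inl_add]
  rfl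

theorem bTr_fold_bPair {X : FinGSet G} (κ l : BurnsideGroup X) :
    bTr (fold X) (bPair κ l) = κ + l := by
  have h1 : (fold X).comp inl = MulActionHom.id G := rfl
  have h2 : (fold X).comp inr = MulActionHom.id G := rfl
  rw [bPair, map_add, bTr_bTr, bTr_bTr, h1, h2, bTr_id, bTr_id]

theorem eq_bPair {X Y : FinGSet G} (z : BurnsideGroup (X.sum Y)) :
    z = bPair (bRes inl z) (bRes inr z) :=
  ((burnside G).obj_sum (bRes inl z) (bRes inr z)).unique ⟨rfl, rfl⟩
    ⟨bRes_inl_bPair _ _, bRes_inr_bPair _ _⟩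

/-- The relation of a congruence on the Burnside Tambara functor is compatible with addition. -/
theorem SemiTambara.GenRel.add {X₀ : FinGSet G} {x y : BurnsideGroup X₀} {X : FinGSet G}
    {a b a' b' : BurnsideGroup X} (h : GenRel (burnside G).toSemiTambara x y a b)
    (h' : GenRel (burnside G).toSemiTambara x y a' b') :
    GenRel (burnside G).toSemiTambara x y (X := X) (a + a' : BurnsideGroup X)
      (b + b' : BurnsideGroup X) := by
  have h1 : GenRel (burnside G).toSemiTambara x y (bPair a a') (bPair b b') := by
    refine GenRel.sum ?_ ?_
    · have e1 : (burnside G).res inl (bPair a a') = a := bRes_inl_bPair a a'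
      have e2 : (burnside G).res inl (bPair b b') = b := bRes_inl_bPair b b'
      rw [e1, e2]; exact h
    · have e1 : (burnside G).res inr (bPair a a') = a' := bRes_inr_bPair a a'
      have e2 : (burnside G).res inr (bPair b b') = b' := bRes_inr_bPair b b'
      rw [e1, e2]; exact h'
  have h2 := GenRel.tr (fold X) h1
  have e1 : (burnside G).tr (fold X) (bPair a a') = (a + a' : BurnsideGroup X) :=
    bTr_fold_bPair a a'
  have e2 : (burnside G).tr (fold X) (bPair b b') = (b + b' : BurnsideGroup X) :=
    bTr_fold_bPair b b'
  rw [e1, e2] at h2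
  exact h2

end BurnsideCongruence

/-! ### The ideal generated by `2 - [D_{2m}/μ_m]` -/

section Ideal

variable {m : ℕ} [NeZero m]

theorem rotRes_bTr {X Y : FinGSet (DihedralGroup m)} (f : X →[DihedralGroup m] Y)
    (κ : BurnsideGroup X) : rotRes Y (bTr f κ) = bTr (prodOrient f) (rotRes X κ) :=
  bRes_bTr _ _ _ _ (isPb_prodOrient f) κ

theorem rotRes_bNm {X Y : FinGSet (DihedralGroup m)} (f : X →[DihedralGroup m] Y)
    (κ : BurnsideGroup X) : rotRes Y (bNm f κ) = bNm (prodOrient f) (rotRes X κ) :=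
  bRes_bNm _ _ _ _ (isPb_prodOrient f) κ

theorem rotRes_bRes {X Y : FinGSet (DihedralGroup m)} (f : X →[DihedralGroup m] Y)
    (κ : BurnsideGroup Y) : rotRes X (bRes f κ) = bRes (prodOrient f) (rotRes Y κ) :=
  (bRes_bRes _ _ _).trans (bRes_bRes (prodOrient f) fst κ).symm

/-- Restriction to the rotations kills `2 - [D_{2m}/μ_m]`, hence identifies congruent elements. -/
theorem rotRes_eq_of_genRel {X : FinGSet (DihedralGroup m)}
    {a b : (burnside (DihedralGroup m)).toSemiTambara.obj X}
    (h : SemiTambara.GenRel (burnside (DihedralGroup m)).toSemiTambara (dGen m)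
      ((burnside (DihedralGroup m)).zero (pt _)) a b) : rotRes X a = rotRes X b := by
  induction h with
  | base =>
    rw [burnside_zero, rotRes_eq_iff]
    intro K hK x _
    rw [ghost_dGen_of_le hK, map_zero]
    rfl
  | refl => rfl
  | symm _ h => exact h.symm
  | trans _ _ h h' => exact h.trans h'
  | res f _ h =>
    exact (rotRes_bRes f _).trans ((congrArg _ h).trans (rotRes_bRes f _).symm)
  | tr f _ h =>
    exact (rotRes_bTr f _).trans ((congrArg _ h).trans (rotRes_bTr f _).symm)
  | nm f _ h =>
    exact (rotRes_bNm f _).trans ((congrArg _ h).trans (rotRes_bNm f _).symm)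
  | @sum X Y a b _ _ h h' =>
    refine rotRes_eq_iff.2 fun K hK x hx => ?_
    rcases x with x | y
    · have hx' : ∀ k ∈ K, k • x = x := fun k hk => Sum.inl_injective (hx k hk)
      exact (ghost_bRes inl a (i := (K, x)) hx').symm.trans ((rotRes_eq_iff.1 h K hK x hx').trans
        (ghost_bRes inl b (i := (K, x)) hx'))
    · have hx' : ∀ k ∈ K, k • y = y := fun k hk => Sum.inr_injective (hx k hk)
      exact (ghost_bRes inr a (i := (K, y)) hx').symm.trans ((rotRes_eq_iff.1 h' K hK y hx').trans
        (ghost_bRes inr b (i := (K, y)) hx'))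

/-- The multiples of `2 - [D_{2m}/μ_m]` are congruent to zero: multiplication by a class `[A → X]`
is restriction to `A` followed by transfer. -/
theorem genRel_dMul {X : FinGSet (DihedralGroup m)} (z a : BurnsideGroup X) :
    SemiTambara.GenRel (burnside (DihedralGroup m)).toSemiTambara (dGen m)
      ((burnside (DihedralGroup m)).zero (pt _)) (a + dMul X z : BurnsideGroup X) a := by
  have key : ∀ (b : GSetsOver X), SemiTambara.GenRel (burnside (DihedralGroup m)).toSemiTambara
      (dGen m) ((burnside (DihedralGroup m)).zero (pt _)) (dMul X (bOf X b))
        (0 : BurnsideGroup X) := by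
    intro b
    induction b using gcls_ind with | h A p =>
    have h := SemiTambara.GenRel.tr p (SemiTambara.GenRel.res (toPt A)
      (SemiTambara.GenRel.base (S := (burnside (DihedralGroup m)).toSemiTambara) (x := dGen m)
        (y := (burnside (DihedralGroup m)).zero (pt _))))
    have e1 : (burnside _).tr p ((burnside _).res (toPt A) (dGen m)) =
        dMul X (bOf X (gcls A p)) := bTr_bRes_dGen p
    have e2 : (burnside _).tr p ((burnside _).res (toPt A)
        ((burnside (DihedralGroup m)).zero (pt _))) = (0 : BurnsideGroup X) := by
      rw [burnside_zero]
      exact (congrArg (bTr p) (map_zero (bRes (toPt A)))).trans (map_zero _)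
    rw [e1, e2] at h
    exact h
  obtain ⟨b, c, rfl⟩ := exists_bOf_sub z
  have h1 := (SemiTambara.GenRel.refl (S := (burnside (DihedralGroup m)).toSemiTambara)
    (a - dMul X (bOf X c) : BurnsideGroup X)).add (key b)
  have h2 := (SemiTambara.GenRel.refl (S := (burnside (DihedralGroup m)).toSemiTambara)
    (a - dMul X (bOf X c) : BurnsideGroup X)).add (key c)
  have h3 := h1.trans h2.symm
  have e1 : a - dMul X (bOf X c) + dMul X (bOf X b) = a + dMul X (bOf X b - bOf X c) := by
    rw [map_sub]; abel
  rw [e1, sub_add_cancel] at h3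
  exact h3

end Ideal

/-! ### Orbits -/

section Orbits

variable {G : Type} [Group G]

theorem gcls_eq_of_transitive {X C D : FinGSet G} {q : C →[G] X} {r : D →[G] X} {c : C} {d : D}
    (hC : ∀ x, ∃ g : G, g • c = x) (hD : ∀ x, ∃ g : G, g • d = x)
    (hs : ∀ g : G, g • c = c ↔ g • d = d) (hp : q c = r d) : gcls C q = gcls D r := by
  have hs' : ∀ g k : G, g • c = k • c ↔ g • d = k • d := fun g k => by
    rw [← inv_smul_eq_iff, ← inv_smul_eq_iff (g := k), ← mul_smul, ← mul_smul, hs]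
  obtain ⟨φ, hφ⟩ := exists_hom (Q := C) (P := D) (fun x y => ∃ k : G, k • c = x ∧ k • d = y)
    (fun g x y ⟨k, h, h'⟩ => ⟨g * k, by rw [mul_smul, h], by rw [mul_smul, h']⟩) (by
      intro x
      obtain ⟨k, rfl⟩ := hC x
      exact ⟨k • d, ⟨k, rfl, rfl⟩, fun y ⟨l, hl, hl'⟩ => hl' ▸ (hs' _ _).1 hl⟩)
  refine gcls_eq φ ⟨fun x y hxy => ?_, fun y => ?_⟩ fun x => ?_
  · obtain ⟨k, hk, hk'⟩ := hφ x
    obtain ⟨l, hl, hl'⟩ := hφ y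
    rw [← hk, ← hl, hs', hk', hl', hxy]
  · obtain ⟨k, rfl⟩ := hD y
    obtain ⟨l, hl, hl'⟩ := hφ (k • c)
    exact ⟨k • c, hl' ▸ (hs' _ _).1 hl⟩
  · obtain ⟨k, hk, hk'⟩ := hφ x
    rw [← hk', ← hk, map_smul, map_smul, hp]

theorem exists_smul_eq_smul {A : FinGSet G} {a : A} (g : G) (x : A) (h : ∃ k : G, k • a = x) :
    ∃ k : G, k • a = g • x := by
  obtain ⟨k, rfl⟩ := h
  exact ⟨g * k, mul_smul g k a⟩

theorem not_exists_smul_eq_smul {A : FinGSet G} {a : A} (g : G) (x : A)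
    (h : ¬ ∃ k : G, k • a = x) : ¬ ∃ k : G, k • a = g • x := fun h' => h (by
  have := exists_smul_eq_smul g⁻¹ _ h'
  rwa [inv_smul_smul] at this)

/-- The orbit of a point, as a `G`-set. -/
abbrev FinGSet.orb {A : FinGSet G} (a : A) : FinGSet G :=
  part (fun x : A => ∃ k : G, k • a = x) exists_smul_eq_smul

/-- The complement of the orbit of a point, as a `G`-set. -/
abbrev FinGSet.offOrb {A : FinGSet G} (a : A) : FinGSet G :=
  part (fun x : A => ¬ ∃ k : G, k • a = x) not_exists_smul_eq_smul

/-- A point, as a point of its orbit. -/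
def FinGSet.orbPt {A : FinGSet G} (a : A) : orb a := ⟨a, 1, one_smul G a⟩

theorem FinGSet.orb_transitive {A : FinGSet G} (a : A) (x : orb a) : ∃ g : G, g • orbPt a = x := by
  obtain ⟨x, k, rfl⟩ := x
  exact ⟨k, rfl⟩

theorem FinGSet.part_smul_eq_iff {A : FinGSet G} {S : A → Prop}
    {hS : ∀ (g : G) a, S a → S (g • a)} (g : G) (x : part S hS) : g • x = x ↔ g • x.1 = x.1 :=
  Subtype.ext_iff

theorem FinGSet.stabilizer_part {A : FinGSet G} {S : A → Prop}
    {hS : ∀ (g : G) a, S a → S (g • a)} (x : part S hS) :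
    MulAction.stabilizer G x = MulAction.stabilizer G x.1 :=
  Subgroup.ext fun g => part_smul_eq_iff g x

theorem FinGSet.card_stabilizer_sum_le {A B : FinGSet G} {n : ℕ}
    (hA : ∀ a : A, Nat.card (MulAction.stabilizer G a) ≤ n)
    (hB : ∀ b : B, Nat.card (MulAction.stabilizer G b) ≤ n) (c : A.sum B) :
    Nat.card (MulAction.stabilizer G c) ≤ n := by
  rcases c with a | b
  · have : MulAction.stabilizer G ((inl : A →[G] A.sum B) a) = MulAction.stabilizer G a :=
      Subgroup.ext fun g => Sum.inl_injective.eq_iff (a := g • a)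
    exact (congrArg (fun K : Subgroup G => Nat.card K) this).trans_le (hA a)
  · have : MulAction.stabilizer G ((inr : B →[G] A.sum B) b) = MulAction.stabilizer G b :=
      Subgroup.ext fun g => Sum.inr_injective.eq_iff (a := g • b)
    exact (congrArg (fun K : Subgroup G => Nat.card K) this).trans_le (hB b)

theorem gcls_orb {X A : FinGSet G} (p : A →[G] X) (a : A) :
    gcls A p = gcls (orb a) (p.comp (partMap _ _)) + gcls (offOrb a) (p.comp (partMap _ _)) :=
  gcls_split p _ exists_smul_eq_smul not_exists_smul_eq_smul

theorem FinGSet.card_offOrb {A : FinGSet G} (a : A) :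
    Nat.card (orb a) + Nat.card (offOrb a) = Nat.card A := by
  classical
  rw [← Nat.card_sum]
  exact Nat.card_congr (Equiv.sumCompl fun x : A => ∃ k : G, k • a = x)

theorem FinGSet.card_orb_pos {A : FinGSet G} (a : A) : 0 < Nat.card (orb a) :=
  Nat.card_pos_iff.2 ⟨⟨orbPt a⟩, inferInstance⟩

theorem gcls_of_isEmpty {X A : FinGSet G} (p : A →[G] X) (hA : IsEmpty A) : gcls A p = 0 := by
  refine (gcls_eq (fromEmpty A) ⟨fun x => Empty.elim x, fun a => hA.elim a⟩ fun x => ?_).symm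
  exact Empty.elim x

end Orbits

/-! ### The kernel of the restriction to rotations -/

section Kernel

variable {m : ℕ}

/-- Two reflections fixing `a` and `b` over the same point `y` are conjugate by a rotation which
fixes `y`; so if the stabilizers of `a` and `b` contain the same rotations, then `b` may be moved
within its fibre to a point with the same stabilizer as `a`. -/
theorem exists_same_stabilizer (hm : Odd m) {Y A B : FinGSet (DihedralGroup m)}
    {p : A →[DihedralGroup m] Y} {q : B →[DihedralGroup m] Y} {a : A} {b : B} (hp : p a = q b)
    (hs : ∀ g ∈ rot m, g • a = a ↔ g • b = b) {g k : DihedralGroup m} (hg : g ∉ rot m)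
    (hk : k ∉ rot m) (ha : g • a = a) (hb : k • b = b) :
    ∃ b' : B, p a = q b' ∧ ∀ g : DihedralGroup m, g • a = a ↔ g • b' = b' := by
  obtain ⟨l, h1, h2⟩ := conj_rot hm hk hg
  set u := (g * k) ^ l with hu
  have hy : u • q b = q b := by
    have h3 : g * k ∈ MulAction.stabilizer (DihedralGroup m) (q b) := by
      show (g * k) • q b = q b
      rw [mul_smul, ← map_smul, hb, ← hp, ← map_smul, ha]
    exact pow_mem h3 l
  have hgb : g • u • b = u • b := by
    rw [← h2, mul_smul, mul_smul, inv_smul_smul, hb]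
  have hrot : ∀ v ∈ rot m, v • a = a ↔ v • u • b = u • b := fun v hv => by
    rw [hs v hv, ← mul_smul, rot_comm hv h1, mul_smul, smul_left_cancel_iff]
  refine ⟨u • b, by rw [map_smul, hy, hp], fun v => ?_⟩
  by_cases hv : v ∈ rot m
  · exact hrot v hv
  · have h4 : v * g⁻¹ ∈ rot m := mul_mem_rot_iff.2 (by rw [inv_mem_iff]; tauto)
    have h5 := hrot _ h4
    rw [mul_smul, mul_smul, inv_smul_eq_iff.2 ha.symm, inv_smul_eq_iff.2 hgb.symm] at h5
    exact h5

variable [NeZero m]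

/-- If the stabilizer `K` of `a` contains a reflection and `b` has stabilizer `K ∩ μ_m`, then the
orbit of `b` is `D_{2m}/μ_m` times the orbit of `a`. -/
theorem bOf_orb_eq_burnsideMul {Y A B : FinGSet (DihedralGroup m)} {p : A →[DihedralGroup m] Y}
    {q : B →[DihedralGroup m] Y} {a : A} {b : B} {g₀ : DihedralGroup m} (hg₀ : g₀ ∉ rot m)
    (ha : g₀ • a = a) (hp : p a = q b)
    (hs : ∀ g : DihedralGroup m, g • b = b ↔ g ∈ rot m ∧ g • a = a) :
    bOf Y (gcls (orb b) (q.comp (partMap _ _))) =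
      burnsideMul (orient m) (bOf Y (gcls (orb a) (p.comp (partMap _ _)))) := by
  rw [burnsideMul_bOf]
  refine congrArg _ (gcls_eq_of_transitive (c := orbPt b)
    (d := ((orbPt a, orientPt m) : (orb a).prod (orient m))) (orb_transitive b) ?_ ?_ hp.symm)
  · rintro ⟨x, c⟩
    obtain ⟨g, rfl⟩ := orb_transitive a x
    obtain ⟨k, rfl⟩ := orient_cases c
    by_cases hgk : g⁻¹ * k ∈ rot m
    · exact ⟨g, Prod.ext rfl (smul_orientPt.2 hgk)⟩
    · refine ⟨g * g₀, Prod.ext ?_ (smul_orientPt.2 ?_)⟩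
      · refine (mul_smul g g₀ (orbPt a)).trans (congrArg (g • ·) ?_)
        exact (part_smul_eq_iff _ _).2 ha
      · rw [mul_inv_rev, mul_assoc, mul_mem_rot_iff, inv_mem_iff]
        tauto
  · intro g
    rw [part_smul_eq_iff]
    refine (hs g).trans ⟨fun h => Prod.ext ((part_smul_eq_iff _ _).2 h.2)
      ((smul_orient_eq_iff _).2 h.1), fun h => ⟨(smul_orient_eq_iff _).1 (congrArg Prod.snd h),
        (part_smul_eq_iff _ _).1 (congrArg Prod.fst h)⟩⟩

variable {Y : FinGSet (DihedralGroup m)} {M : Type*} [AddCommGroup M]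

/-- If `A` and `B` agree on rotations over `Y`, then every point of `A` has a counterpart in `B` over
the same point of `Y` which is fixed by the same rotations, and possibly more. -/
theorem exists_fixed_of_rotRes_eq {A B : FinGSet (DihedralGroup m)} {p : A →[DihedralGroup m] Y}
    {q : B →[DihedralGroup m] Y} (h : rotRes Y (bOf Y (gcls A p)) = rotRes Y (bOf Y (gcls B q)))
    (a : A) : ∃ b, q b = p a ∧ ∀ g ∈ rot m, g • a = a → g • b = b := by
  have h1 := rotRes_eq_iff.1 h (MulAction.stabilizer _ a ⊓ rot m) inf_le_right (p a)
    fun k hk => by rw [← map_smul, show k • a = a from hk.1]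
  rw [ghost_bOf, ghost_bOf, marks_gcls, marks_gcls] at h1
  have h2 : fixCount p (MulAction.stabilizer _ a ⊓ rot m, p a) ≠ 0 :=
    fixCount_ne_zero.2 ⟨a, rfl, fun k hk => hk.1⟩
  rw [h1] at h2
  obtain ⟨b, hb, hb'⟩ := fixCount_ne_zero.1 h2
  exact ⟨b, hb, fun g hg ha => hb' g ⟨ha, hg⟩⟩

/-- The cancellation step when the stabilizer of `a` contains a reflection and the one of `b` does
not: the orbit of `b` is traded for two copies of the orbit of `a`, one of which cancels. -/
theorem map_eq_step (f : BurnsideGroup Y →+ M) (n : ℕ)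
    (hf : ∀ (C : FinGSet (DihedralGroup m)) (r : C →[DihedralGroup m] Y),
      (∀ c : C, Nat.card (MulAction.stabilizer (DihedralGroup m) c) ≤ n) →
        f (dMul Y (bOf Y (gcls C r))) = 0)
    {A B : FinGSet (DihedralGroup m)} {p : A →[DihedralGroup m] Y} {q : B →[DihedralGroup m] Y}
    (ih : ∀ (A' B' : FinGSet (DihedralGroup m)) (p' : A' →[DihedralGroup m] Y)
      (q' : B' →[DihedralGroup m] Y), Nat.card A' + Nat.card B' < Nat.card A + Nat.card B →
      (∀ c : A', Nat.card (MulAction.stabilizer (DihedralGroup m) c) ≤ n) →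
      (∀ c : B', Nat.card (MulAction.stabilizer (DihedralGroup m) c) ≤ n) →
      rotRes Y (bOf Y (gcls A' p')) = rotRes Y (bOf Y (gcls B' q')) →
      f (bOf Y (gcls A' p')) = f (bOf Y (gcls B' q')))
    (hA : ∀ c : A, Nat.card (MulAction.stabilizer (DihedralGroup m) c) ≤ n)
    (hB : ∀ c : B, Nat.card (MulAction.stabilizer (DihedralGroup m) c) ≤ n)
    (h : rotRes Y (bOf Y (gcls A p)) = rotRes Y (bOf Y (gcls B q))) {a : A} {b : B}
    {g₀ : DihedralGroup m} (hg₀ : g₀ ∉ rot m) (ha : g₀ • a = a) (hp : p a = q b)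
    (hs : ∀ g : DihedralGroup m, g • b = b ↔ g ∈ rot m ∧ g • a = a) :
    f (bOf Y (gcls A p)) = f (bOf Y (gcls B q)) := by
  have h1 := bOf_orb_eq_burnsideMul hg₀ ha hp hs
  have hA' : ∀ {S : A → Prop} {hS : ∀ (g : DihedralGroup m) a, S a → S (g • a)} (c : part S hS),
      Nat.card (MulAction.stabilizer (DihedralGroup m) c) ≤ n := fun c => by
    rw [stabilizer_part]; exact hA _
  have hB' : ∀ {S : B → Prop} {hS : ∀ (g : DihedralGroup m) a, S a → S (g • a)} (c : part S hS),
      Nat.card (MulAction.stabilizer (DihedralGroup m) c) ≤ n := fun c => by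
    rw [stabilizer_part]; exact hB _
  have h2 : bOf Y (gcls (orb b) (q.comp (partMap _ _))) =
      2 • bOf Y (gcls (orb a) (p.comp (partMap _ _))) -
        dMul Y (bOf Y (gcls (orb a) (p.comp (partMap _ _)))) := by
    rw [h1, dMul_apply, sub_sub_cancel]
  have h3 := congrArg f h2
  have h4 := congrArg (rotRes Y) h2
  rw [map_sub, hf _ _ hA', sub_zero, map_nsmul] at h3
  rw [map_sub, rotRes_dMul, sub_zero, map_nsmul] at h4
  have h5 := ih (offOrb a) ((offOrb b).sum (orb a)) (p.comp (partMap _ _))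
    (desc (q.comp (partMap _ _)) (p.comp (partMap _ _))) (by
      have e1 := card_offOrb a
      have e2 := card_offOrb b
      have e3 := card_orb_pos b
      have e4 : Nat.card ((offOrb b).sum (orb a)) = Nat.card (offOrb b) + Nat.card (orb a) :=
        Nat.card_sum
      omega) hA' (card_stabilizer_sum_le hB' hA') (by
      rw [gcls_orb p a, gcls_orb q b, map_add, map_add, map_add, map_add, h4, two_nsmul] at h
      rw [← gcls_add, map_add, map_add]
      rw [add_assoc] at h
      rw [add_left_cancel h, add_comm])
  rw [← gcls_add, map_add, map_add] at h5
  rw [gcls_orb p a, gcls_orb q b, map_add, map_add, map_add, map_add, h3, h5]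
  abel

/-- Let `f` be an additive map on `A(Y)` which kills the multiples `(2 - [D_{2m}/μ_m]) [C]` for all
`C` with stabilizers of order at most `n`. Then `f` takes the same value on any two sets over `Y`
with stabilizers of order at most `n` which are isomorphic as `μ_m`-sets over `Y`: orbits with
maximal rotational stabilizers are cancelled one after the other. -/
theorem map_eq_of_rotRes_eq (hm : Odd m) (f : BurnsideGroup Y →+ M) (n : ℕ)
    (hf : ∀ (C : FinGSet (DihedralGroup m)) (r : C →[DihedralGroup m] Y),
      (∀ c : C, Nat.card (MulAction.stabilizer (DihedralGroup m) c) ≤ n) →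
        f (dMul Y (bOf Y (gcls C r))) = 0)
    {A B : FinGSet (DihedralGroup m)} {p : A →[DihedralGroup m] Y} {q : B →[DihedralGroup m] Y}
    (hA : ∀ c : A, Nat.card (MulAction.stabilizer (DihedralGroup m) c) ≤ n)
    (hB : ∀ c : B, Nat.card (MulAction.stabilizer (DihedralGroup m) c) ≤ n)
    (h : rotRes Y (bOf Y (gcls A p)) = rotRes Y (bOf Y (gcls B q))) :
    f (bOf Y (gcls A p)) = f (bOf Y (gcls B q)) := by
  induction hN : Nat.card A + Nat.card B using Nat.strong_induction_on generalizing A B with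
  | _ N ih =>
  subst hN
  rcases isEmpty_or_nonempty A with hA0 | hA0
  · have hB0 : IsEmpty B := ⟨fun b => by
      obtain ⟨a, -⟩ := exists_fixed_of_rotRes_eq h.symm b
      exact hA0.elim a⟩
    rw [gcls_of_isEmpty p hA0, gcls_of_isEmpty q hB0]
  obtain ⟨a, ha⟩ := Finite.exists_max
    (fun a : A => Nat.card (MulAction.stabilizer (DihedralGroup m) a ⊓ rot m :))
  obtain ⟨b, hb, hab⟩ := exists_fixed_of_rotRes_eq h a
  obtain ⟨a', -, hba⟩ := exists_fixed_of_rotRes_eq h.symm b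
  have h1 : MulAction.stabilizer (DihedralGroup m) a ⊓ rot m =
      MulAction.stabilizer (DihedralGroup m) a' ⊓ rot m :=
    Subgroup.eq_of_le_of_card_ge (fun g hg => ⟨hba g hg.2 (hab g hg.2 hg.1), hg.2⟩) (ha a')
  have hs : ∀ g ∈ rot m, g • a = a ↔ g • b = b := fun g hg => ⟨hab g hg, fun h2 => by
    have h3 : g ∈ MulAction.stabilizer (DihedralGroup m) a' ⊓ rot m := ⟨hba g hg h2, hg⟩
    rw [← h1] at h3
    exact h3.1⟩
  have key : ∀ b' : B, p a = q b' → (∀ g : DihedralGroup m, g • a = a ↔ g • b' = b') →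
      f (bOf Y (gcls A p)) = f (bOf Y (gcls B q)) := by
    intro b' hp hs'
    have h2 : gcls (orb a) (p.comp (partMap _ _)) = gcls (orb b') (q.comp (partMap _ _)) :=
      gcls_eq_of_transitive (orb_transitive a) (orb_transitive b')
        (fun g => by rw [part_smul_eq_iff, part_smul_eq_iff]; exact hs' g) hp
    rw [gcls_orb p a, gcls_orb q b', h2, map_add, map_add, map_add, map_add] at h ⊢
    congr 1
    refine ih _ ?_ (fun c => ?_) (fun c => ?_) (add_left_cancel h) rfl
    · have e1 := card_offOrb a
      have e2 := card_offOrb b'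
      have e3 := card_orb_pos b'
      omega
    · rw [stabilizer_part]; exact hA _
    · rw [stabilizer_part]; exact hB _
  by_cases h2 : ∃ g, g ∉ rot m ∧ g • a = a <;> by_cases h3 : ∃ k, k ∉ rot m ∧ k • b = b
  · obtain ⟨g, hg, hga⟩ := h2
    obtain ⟨k, hk, hkb⟩ := h3
    obtain ⟨b', hb1, hb2⟩ := exists_same_stabilizer hm hb.symm hs hg hk hga hkb
    exact key b' hb1 hb2
  · obtain ⟨g, hg, hga⟩ := h2
    refine map_eq_step f n hf (fun A' B' p' q' hc hA' hB' h' => ih _ hc hA' hB' h' rfl) hA hB h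
      hg hga hb.symm fun k => ?_
    by_cases hk : k ∈ rot m
    · have := hs k hk; tauto
    · exact ⟨fun h4 => absurd ⟨k, hk, h4⟩ h3, fun h4 => absurd h4.1 hk⟩
  · obtain ⟨g, hg, hgb⟩ := h3
    refine (map_eq_step f n hf (fun A' B' p' q' hc hA' hB' h' => ih _
      (hc.trans_eq (add_comm _ _)) hA' hB' h' rfl) hB hA h.symm hg hgb hb fun k => ?_).symm
    by_cases hk : k ∈ rot m
    · have := hs k hk; tauto
    · exact ⟨fun h4 => absurd ⟨k, hk, h4⟩ h2, fun h4 => absurd h4.1 hk⟩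
  · refine key b hb.symm fun g => ?_
    by_cases hg : g ∈ rot m
    · exact hs g hg
    · exact ⟨fun h4 => absurd ⟨g, hg, h4⟩ h2, fun h4 => absurd ⟨g, hg, h4⟩ h3⟩

/-- The same statement without a bound on stabilizers, for virtual `D_{2m}`-sets. -/
theorem map_eq_zero_of_rotRes_eq_zero (hm : Odd m) (f : BurnsideGroup Y →+ M)
    (hf : ∀ (C : FinGSet (DihedralGroup m)) (r : C →[DihedralGroup m] Y),
        f (dMul Y (bOf Y (gcls C r))) = 0) {κ : BurnsideGroup Y} (h : rotRes Y κ = 0) : f κ = 0 := by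
  obtain ⟨a, b, rfl⟩ := exists_bOf_sub κ
  induction a using gcls_ind with | h A p =>
  induction b using gcls_ind with | h B q =>
  rw [map_sub, sub_eq_zero] at h ⊢
  exact map_eq_of_rotRes_eq hm f (Nat.card (DihedralGroup m)) (fun C r _ => hf C r)
    (fun c => Subgroup.card_le_card_group _) (fun c => Subgroup.card_le_card_group _) h

/-- The kernel of the restriction to rotations is generated by `2 - [D_{2m}/μ_m]`. -/
theorem exists_dMul_of_rotRes_eq_zero (hm : Odd m) {κ : BurnsideGroup Y} (h : rotRes Y κ = 0) :
    ∃ z, κ = dMul Y z := by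
  have h1 := map_eq_zero_of_rotRes_eq_zero hm (QuotientAddGroup.mk' (dMul Y).range)
    (fun C r => (QuotientAddGroup.eq_zero_iff _).2 ⟨_, rfl⟩) h
  obtain ⟨z, hz⟩ := (QuotientAddGroup.eq_zero_iff κ).1 h1
  exact ⟨z, hz.symm⟩

theorem toQuotient_eq_iff (hm : Odd m) {a b : BurnsideGroup Y} :
    (burnside (DihedralGroup m)).toQuotient (X₀ := pt (DihedralGroup m)) (dGen m) a =
      (burnside (DihedralGroup m)).toQuotient (X₀ := pt (DihedralGroup m)) (dGen m) b ↔
    rotRes Y a = rotRes Y b := by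
  constructor
  · exact fun h => rotRes_eq_of_genRel (Quotient.exact h)
  · intro h
    obtain ⟨z, hz⟩ := exists_dMul_of_rotRes_eq_zero hm (κ := a - b) (by rw [map_sub, h, sub_self])
    have h1 := genRel_dMul z b
    rw [← hz, add_sub_cancel] at h1
    exact Quotient.sound h1

theorem toQuotient_eq_iff_exists (hm : Odd m) {a b : BurnsideGroup Y} :
    (burnside (DihedralGroup m)).toQuotient (X₀ := pt (DihedralGroup m)) (dGen m) a =
      (burnside (DihedralGroup m)).toQuotient (X₀ := pt (DihedralGroup m)) (dGen m) b ↔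
    ∃ z, a - b = 2 • z - burnsideMul (orient m) z := by
  rw [toQuotient_eq_iff hm]
  constructor
  · exact fun h => exists_dMul_of_rotRes_eq_zero hm (κ := a - b) (by rw [map_sub, h, sub_self])
  · rintro ⟨z, hz⟩
    rw [← sub_eq_zero, ← map_sub, hz, ← dMul_apply, rotRes_dMul]

end Kernel

/-! ### Virtual sets with constant marks, and the underlying cardinality of norms -/

section ConstMarks

variable {G : Type} [Group G]

/-- Invariant functions `X → ℤ`, the value at `X` of the constant Tambara functor `ℤ`. -/
abbrev InvFun (G : Type) [Group G] (X : FinGSet G) : Type :=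
  {φ : X → ℤ // ∀ (g : G) x, φ (g • x) = φ x}

/-- Pullback of invariant functions. -/
noncomputable abbrev InvFun.res {X Y : FinGSet G} (f : X →[G] Y) (φ : InvFun G Y) : InvFun G X :=
  (constZ G).res f φ

/-- Sums of invariant functions over fibres. -/
noncomputable abbrev InvFun.tr {X Y : FinGSet G} (f : X →[G] Y) (φ : InvFun G X) : InvFun G Y :=
  (constZ G).tr f φ

/-- Products of invariant functions over fibres. -/
noncomputable abbrev InvFun.nm {X Y : FinGSet G} (f : X →[G] Y) (φ : InvFun G X) : InvFun G Y :=
  (constZ G).nm f φ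

theorem InvFun.tr_apply {X Y : FinGSet G} (f : X →[G] Y) (φ : InvFun G X) (y : Y) :
    (InvFun.tr f φ).1 y = ∑ᶠ x : {x // f x = y}, φ.1 x := rfl

theorem InvFun.nm_apply {X Y : FinGSet G} (f : X →[G] Y) (φ : InvFun G X) (y : Y) :
    (InvFun.nm f φ).1 y = ∏ᶠ x : {x // f x = y}, φ.1 x := rfl

/-- Invariant functions are integral combinations of characteristic functions of invariant subsets. -/
theorem exists_bConst {X : FinGSet G} (φ : InvFun G X) : ∃ κ : BurnsideGroup X,
    ∀ (K : Subgroup G) (x : X), (∀ k ∈ K, k • x = x) → ghost X κ (K, x) = φ.1 x := by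
  classical
  have := Fintype.ofFinite X
  have hS : ∀ (v : ℤ) (g : G) (x : X), φ.1 x = v → φ.1 (g • x) = v := fun v g x h => by
    rw [φ.2, h]
  refine ⟨∑ v ∈ Finset.univ.image φ.1, v • bOf X (gcls (part _ (hS v)) (partMap _ _)),
    fun K x hx => ?_⟩
  have h1 : ∀ v : ℤ, ghost X (bOf X (gcls (part _ (hS v)) (partMap _ _))) (K, x) =
      if φ.1 x = v then 1 else 0 := by
    intro v
    rw [ghost_bOf, marks_gcls]
    split_ifs with h
    · let _ : Unique {a : part _ (hS v) // partMap _ (hS v) a = x ∧ ∀ k ∈ K, k • a = a} :=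
        ⟨⟨⟨⟨x, h⟩, rfl, fun k hk => Subtype.ext (hx k hk)⟩⟩,
          fun a => Subtype.ext (Subtype.ext a.2.1)⟩
      exact congrArg Nat.cast Nat.card_unique
    · have : IsEmpty {a : part _ (hS v) // partMap _ (hS v) a = x ∧ ∀ k ∈ K, k • a = a} :=
        ⟨fun a => h (a.2.1 ▸ a.1.2)⟩
      exact congrArg Nat.cast Nat.card_of_isEmpty
  rw [map_sum, Finset.sum_apply]
  simp only [map_zsmul, Pi.smul_apply, h1, smul_eq_mul, mul_ite, mul_one, mul_zero]
  rw [Finset.sum_ite_eq, if_pos (Finset.mem_image_of_mem _ (Finset.mem_univ x))]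

/-- The virtual `G`-set over `X` which has `φ x` points over `x`, with trivial action of the
stabilizer of `x`. -/
noncomputable def bConst {X : FinGSet G} (φ : InvFun G X) : BurnsideGroup X :=
  (exists_bConst φ).choose

theorem ghost_bConst {X : FinGSet G} (φ : InvFun G X) {K : Subgroup G} {x : X}
    (hx : ∀ k ∈ K, k • x = x) : ghost X (bConst φ) (K, x) = φ.1 x :=
  (exists_bConst φ).choose_spec K x hx

theorem fixCount_bot {X A : FinGSet G} (p : A →[G] X) (x : X) :
    fixCount p (⊥, x) = ∑ᶠ _a : {a // p a = x}, (1 : ℤ) := by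
  have := Fintype.ofFinite {a // p a = x}
  rw [finsum_eq_sum_of_fintype, Finset.sum_const, Finset.card_univ, ← Nat.card_eq_fintype_card,
    nsmul_eq_mul, mul_one]
  refine congrArg Nat.cast (Nat.card_congr (Equiv.subtypeEquivRight fun a => ?_))
  refine and_iff_left_of_imp fun _ k hk => ?_
  rw [Subgroup.mem_bot.1 hk, one_smul]

/-- Polynomials which agree on the marks of `G`-sets agree on the marks of virtual `G`-sets. -/
theorem eval_ghost_eq {X : FinGSet G} {P P' : MvPolynomial (Subgroup G × X) ℤ}
    (h : ∀ a : GSetsOver X, MvPolynomial.eval (marks X a) P = MvPolynomial.eval (marks X a) P')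
    (κ : BurnsideGroup X) :
    MvPolynomial.eval (ghost X κ) P = MvPolynomial.eval (ghost X κ) P' := by
  obtain ⟨a, b, rfl⟩ := exists_bOf_sub κ
  obtain ⟨p, hp⟩ := exists_line P (marks X a) (marks X b)
  obtain ⟨p', hp'⟩ := exists_line P' (marks X a) (marks X b)
  rw [ghost_sub, ← hp, ← hp']
  congr 1
  refine Polynomial.eq_of_infinite_eval_eq _ _ (Set.infinite_of_injective_forall_mem
    (f := fun n : ℕ => (n : ℤ)) Nat.cast_injective fun n => ?_)
  show p.eval (n : ℤ) = p'.eval (n : ℤ)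
  rw [hp, hp', ← ghost_line, ghost_bOf, h]

variable [Finite G]

theorem bRes_bConst {X Y : FinGSet G} (f : X →[G] Y) (φ : InvFun G Y) :
    bRes f (bConst φ) = bConst (φ.res f) := by
  refine ghost_ext fun K x hx => ?_
  rw [ghost_bRes _ _ hx, ghost_bConst _ hx, ghost_bConst _ fun k hk => by
    rw [← map_smul]; exact congrArg f (hx k hk)]
  rfl

/-- The cardinalities of the fibres of a norm are products of cardinalities of fibres. -/
theorem ghost_bNm_bot {X Y : FinGSet G} (f : X →[G] Y) (κ : BurnsideGroup X) (y : Y) :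
    ghost Y (bNm f κ) (⊥, y) = ∏ᶠ x : {x // f x = y}, ghost X κ (⊥, x.1) := by
  have := Fintype.ofFinite {x // f x = y}
  rw [bNm, (exists_bNm f κ).choose_spec, eval_ghost_eq
    (P' := ∏ x : {x // f x = y}, MvPolynomial.X (⊥, x.1)) (fun a => ?_) κ, map_prod,
    finprod_eq_prod_of_fintype]
  · simp only [MvPolynomial.eval_X]
  · rw [← (marks_nm f (⊥, y)).choose_spec, map_prod, ← finprod_eq_prod_of_fintype]
    simp only [MvPolynomial.eval_X]
    induction a using gcls_ind with | h A h =>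
    have h1 := finprod_finsum_fiber (isExp_expo h f) (fun _ => 1) y
    simp only [finprod_one] at h1
    refine (fixCount_bot (expoP h f) y).trans (h1.symm.trans ?_)
    exact finprod_congr fun x => (fixCount_bot h x.1).symm

theorem bConst_one {X : FinGSet G} {φ : InvFun G X} (h : ∀ x, φ.1 x = 1) :
    bConst φ = bOf X (gcls X (MulActionHom.id G)) := by
  refine ghost_ext fun K x hx => ?_
  rw [ghost_bConst _ hx, h, ghost_bOf, marks_gcls]
  let _ : Unique {a : X // (MulActionHom.id G : X →[G] X) a = x ∧ ∀ k ∈ K, k • a = a} :=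
    ⟨⟨⟨x, rfl, hx⟩⟩, fun a => Subtype.ext a.2.1⟩
  exact (congrArg Nat.cast Nat.card_unique).symm

theorem bNm_one {X Y : FinGSet G} (f : X →[G] Y) :
    bNm f (bOf X (gcls X (MulActionHom.id G))) = bOf Y (gcls Y (MulActionHom.id G)) := by
  have H : IsExp (MulActionHom.id G : X →[G] X) f (MulActionHom.id G : X →[G] X) f
      (MulActionHom.id G : Y →[G] Y) := by
    refine IsExp.mk' (fun _ => rfl) (fun _ _ _ h => h) (fun x y h => ⟨x, h, rfl⟩)
      (fun _ _ h _ => h) fun y T _ _ h => ⟨y, rfl, fun x hx => ?_⟩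
    obtain ⟨a, ha, rfl⟩ := h x hx
    exact ha
  rw [bNm_bOf]
  exact congrArg _ (NormSystem.fNm_mk (M := trivialLabels G) (m := ()) H)

end ConstMarks

/-! ### Induction of `H`-sets to `G`-sets -/

section Induction

variable {G : Type} [Group G] {H : Subgroup G}

/-- The relation `(g, x) ~ (g h⁻¹, h x)` on `G × X`. -/
def indSetoid (X : FinGSet H) : Setoid (G × X) where
  r a b := ∃ h : H, b.1 = a.1 * (h : G)⁻¹ ∧ b.2 = h • a.2
  iseqv :=
    { refl := fun a => ⟨1, by simp, (one_smul H a.2).symm⟩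
      symm := by
        rintro ⟨g, x⟩ ⟨g', x'⟩ ⟨h, h1, h2⟩
        refine ⟨h⁻¹, ?_, ?_⟩
        · rw [h1]; simp
        · exact (inv_smul_eq_iff.2 h2).symm
      trans := by
        rintro ⟨g, x⟩ ⟨g', x'⟩ ⟨g'', x''⟩ ⟨h, h1, h2⟩ ⟨k, k1, k2⟩
        refine ⟨k * h, ?_, ?_⟩
        · simp only at h1 k1
          rw [k1, h1, Subgroup.coe_mul, mul_inv_rev, mul_assoc]
        · exact k2.trans ((congrArg (k • ·) h2).trans (mul_smul k h x).symm) }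

variable [Finite G]

/-- The induced `G`-set `G ×_H X`. -/
def FinGSet.ind (X : FinGSet H) : FinGSet G :=
  letI : MulAction G (Quotient (indSetoid X)) :=
    { smul := fun c => Quotient.map (fun a => (c * a.1, a.2)) (by
        rintro a b ⟨h, h1, h2⟩
        exact ⟨h, by simp only [h1, mul_assoc], h2⟩)
      one_smul := by
        rintro ⟨a⟩
        exact congrArg (Quotient.mk _) (Prod.ext (one_mul _) rfl)
      mul_smul := by
        rintro c d ⟨a⟩
        exact congrArg (Quotient.mk _) (Prod.ext (mul_assoc _ _ _) rfl) }
  ⟨Quotient (indSetoid X)⟩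

/-- The point of `G ×_H X` represented by `(g, x)`. -/
def indMk {X : FinGSet H} (g : G) (x : X) : ind X := Quotient.mk (indSetoid X) (g, x)

theorem indMk_eq_iff {X : FinGSet H} {g g' : G} {x x' : X} :
    indMk g x = indMk g' x' ↔ ∃ h : H, g' = g * (h : G)⁻¹ ∧ x' = h • x :=
  ⟨fun h => Quotient.exact h, fun h => Quotient.sound h⟩

theorem indMk_inj {X : FinGSet H} {g : G} {x x' : X} (h : indMk g x = indMk g x') : x = x' := by
  obtain ⟨k, h1, rfl⟩ := indMk_eq_iff.1 h
  have : k = 1 := by simpa using h1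
  rw [this, one_smul]

theorem indMk_ind {X : FinGSet H} (z : ind X) : ∃ g x, indMk g x = z := by
  obtain ⟨⟨g, x⟩, rfl⟩ := Quotient.exists_rep z
  exact ⟨g, x, rfl⟩

theorem smul_indMk {X : FinGSet H} (c g : G) (x : X) : c • indMk g x = indMk (c * g) x := rfl

/-- Functoriality of induction. -/
def indMap {X Y : FinGSet H} (f : X →[H] Y) : ind X →[G] ind Y where
  toFun := Quotient.map (fun a => (a.1, f a.2)) (by
    rintro a b ⟨h, h1, h2⟩
    exact ⟨h, h1, by simp only [h2, map_smul]⟩)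
  map_smul' := by
    rintro c ⟨a⟩
    rfl

/-- The action map `G ×_H A → A` for a `G`-set `A`. -/
def indAct (H : Subgroup G) (A : FinGSet G) : ind (A.restrict H) →[G] A where
  toFun := Quotient.lift (fun a => a.1 • (show A from a.2)) (by
    rintro ⟨g, x⟩ ⟨g', x'⟩ ⟨h, rfl, rfl⟩
    show g • (show A from x) = (g * (h : G)⁻¹) • ((h : G) • (show A from x) : A)
    rw [← mul_smul, inv_mul_cancel_right])
  map_smul' := by
    rintro c ⟨a⟩
    exact mul_smul _ _ _

/-- The function on `G ×_H X` which corresponds to an `H`-invariant function on `X`. -/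
def indFun {X : FinGSet H} (φ : InvFun H X) : InvFun G (ind X) :=
  ⟨Quotient.lift (fun a => φ.1 a.2) (by
    rintro ⟨g, x⟩ ⟨g', x'⟩ ⟨h, rfl, rfl⟩
    exact (φ.2 h x).symm), by
    rintro c ⟨a⟩
    rfl⟩

theorem indFun_res {X Y : FinGSet H} (f : X →[H] Y) (φ : InvFun H Y) :
    indFun (φ.res f) = (indFun φ).res (indMap f) := by
  refine Subtype.ext (funext fun z => ?_)
  obtain ⟨g, x, rfl⟩ := indMk_ind z
  rfl

/-- A fibre of `G ×_H X → G ×_H Y` is a fibre of `X → Y`. -/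
theorem bijective_ind_fiber {X Y : FinGSet H} (f : X →[H] Y) (g : G) (y : Y) :
    Function.Bijective (fun x : {x // f x = y} =>
      (⟨indMk g x.1, congrArg (indMk g) x.2⟩ : {z // indMap f z = indMk g y})) := by
  refine ⟨fun x x' h => Subtype.ext (indMk_inj (congrArg Subtype.val h)), ?_⟩
  rintro ⟨z, hz⟩
  obtain ⟨g', x, rfl⟩ := indMk_ind z
  obtain ⟨h, rfl, rfl⟩ := indMk_eq_iff.1 hz
  exact ⟨⟨h • x, map_smul f h x⟩, Subtype.ext (indMk_eq_iff.2 ⟨h, rfl, rfl⟩).symm⟩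

theorem indFun_tr {X Y : FinGSet H} (f : X →[H] Y) (φ : InvFun H X) :
    indFun (φ.tr f) = (indFun φ).tr (indMap f) := by
  refine Subtype.ext (funext fun z => ?_)
  obtain ⟨g, y, rfl⟩ := indMk_ind z
  exact finsum_eq_of_bijective _ (bijective_ind_fiber f g y) fun x => rfl

theorem indFun_nm {X Y : FinGSet H} (f : X →[H] Y) (φ : InvFun H X) :
    indFun (φ.nm f) = (indFun φ).nm (indMap f) := by
  refine Subtype.ext (funext fun z => ?_)
  obtain ⟨g, y, rfl⟩ := indMk_ind z
  exact finprod_eq_of_bijective _ (bijective_ind_fiber f g y) fun x => rfl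

theorem isPb_indAct {A B : FinGSet G} (f : A →[G] B) :
    IsPb (indMap (restrictHom H f)) (indAct H A) (indAct H B) f := by
  refine ⟨fun z => ?_, fun z a hz => ?_⟩
  · obtain ⟨g, x, rfl⟩ := indMk_ind z
    exact (map_smul f g (show A from x)).symm
  · obtain ⟨g, b, rfl⟩ := indMk_ind z
    have hb : f (g⁻¹ • a) = b := by
      rw [map_smul, ← hz]; exact inv_smul_smul g (show B from b)
    refine ⟨indMk (X := A.restrict H) g (g⁻¹ • a), ⟨congrArg (indMk g) hb, smul_inv_smul g a⟩, ?_⟩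
    rintro z ⟨h1, h2⟩
    obtain ⟨g', x, rfl⟩ := indMk_ind z
    obtain ⟨h, rfl, -⟩ := indMk_eq_iff.1 h1
    refine indMk_eq_iff.2 ⟨h, rfl, ?_⟩
    show (g' * (h : G)⁻¹)⁻¹ • a = (h : G) • (show A from x)
    have h2 : g' • (show A from x) = a := h2
    rw [← h2, ← mul_smul]
    congr 1
    group

/-- The pullback of coinduced sets which defines the basic relation of the norm is a dependent
product along the action map `G ×_H A → A`. -/
theorem TambaraFunctor.IsCoind.isExp {A P : FinGSet G} {X : FinGSet H} {t : X →[H] A.restrict H}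
    {ev : P.restrict H →[H] X} {π : P →[G] A} (hc : IsCoind t ev π) :
    IsExp (indMap t) (indAct H A) (indMap ev) (indAct H P) π := by
  refine IsExp.mk' (fun z => ?_) (fun z z' h1 h2 => ?_) (fun z s hz => ?_) (fun s s' h1 h2 => ?_)
    fun a T hT hTa hTx => ?_
  · obtain ⟨g, s, rfl⟩ := indMk_ind z
    exact (congrArg (fun a : A => g • a) (hc.1 s)).trans (map_smul π g (show P from s)).symm
  · obtain ⟨g, s, rfl⟩ := indMk_ind z
    obtain ⟨g', s', rfl⟩ := indMk_ind z'
    obtain ⟨h, rfl, -⟩ := indMk_eq_iff.1 h2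
    refine indMk_eq_iff.2 ⟨h, rfl, ?_⟩
    have h1 : g • (show P from s) = (g * (h : G)⁻¹) • (show P from s') := h1
    rw [mul_smul, smul_left_cancel_iff, eq_inv_smul_iff] at h1
    exact h1.symm
  · obtain ⟨g, a, rfl⟩ := indMk_ind z
    refine ⟨indMk (X := P.restrict H) g (g⁻¹ • s), smul_inv_smul g s, ?_⟩
    have h1 : π (g⁻¹ • s) = (show A from a) := by
      rw [map_smul, ← hz]
      exact inv_smul_smul g (show A from a)
    exact congrArg (indMk g) ((hc.1 _).trans h1)
  · refine hc.ext h1 fun g => ?_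
    obtain ⟨z, h3, h4⟩ := h2 (indMk (X := P.restrict H) g⁻¹ (g • s)) (inv_smul_smul g s)
    obtain ⟨g', x, rfl⟩ := indMk_ind z
    obtain ⟨h, h5, h6⟩ := indMk_eq_iff.1 h4
    refine h6.trans ((map_smul ev h x).symm.trans (congrArg ev ?_))
    have h3 : g' • (show P from x) = s' := h3
    have h5 : g⁻¹ = g' * (h : G)⁻¹ := h5
    have h7 : g = h * g'⁻¹ := by rw [← inv_inj, h5]; group
    rw [← h3, h7, ← mul_smul, inv_mul_cancel_right]
    rfl
  · have h1 : ∀ g : G, ∃ x : X, T (indMk g⁻¹ x) ∧ t x = g • a := by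
      intro g
      obtain ⟨z, h2, h3⟩ := hTx (indMk (X := A.restrict H) g⁻¹ (g • a)) (inv_smul_smul g a)
      obtain ⟨g', x, rfl⟩ := indMk_ind z
      obtain ⟨h, h4, h5⟩ := indMk_eq_iff.1 h3
      refine ⟨h • x, ?_, (map_smul t h x).trans h5.symm⟩
      rwa [← indMk_eq_iff.2 ⟨h, h4, rfl⟩]
    choose F hF1 hF2 using h1
    have hF : ∀ (h : H) (g : G), F (h * g) = h • F g := by
      intro h g
      have h2 : indMk (g⁻¹) (F g) = indMk (((h : G) * g)⁻¹) (h • F g) :=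
        indMk_eq_iff.2 ⟨h, by rw [mul_inv_rev], rfl⟩
      refine indMk_inj (hT _ _ (hF1 _) (h2 ▸ hF1 g) (congrArg (indMk _) ?_))
      rw [map_smul, hF2, hF2]
      exact mul_smul (h : G) g a
    obtain ⟨s, ⟨h2, h3⟩, -⟩ := hc.2 a F hF hF2
    refine ⟨s, h2, fun z hz => ?_⟩
    obtain ⟨g, x, rfl⟩ := indMk_ind z
    have h4 := h3 g⁻¹
    have h5 : g • (show P from x) = s := hz
    rw [← h5, inv_smul_smul] at h4
    have h6 := hF1 g⁻¹
    rw [inv_inv, ← h4] at h6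
    exact h6

end Induction

/-! ### The comparison map from the norm to the quotient of the Burnside functor -/

section Comparison

variable {G : Type} [Group G] [Finite G] {H : Subgroup G}

/-- The virtual `G`-set over `Y` attached to a `G`-set `p : A → Y` with an `H`-invariant label
`φ : A → ℤ`: the transfer along `p` of the norm of `φ` along `G ×_H A → A`. -/
noncomputable def labelled {Y : FinGSet G} (A : FinGSet G) (p : A →[G] Y)
    (φ : InvFun H (A.restrict H)) : BurnsideGroup Y :=
  bTr p (bNm (indAct H A) (bConst (indFun φ)))

/-- Here no restriction to rotations is needed, since virtual sets with constant marks restrict to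
virtual sets with constant marks. -/
theorem bRes_labelled {Y Y' A P : FinGSet G} {p : A →[G] Y} {f : Y' →[G] Y} {a : P →[G] A}
    {b : P →[G] Y'} (hp : IsPb a b p f) (φ : InvFun H (A.restrict H)) :
    bRes f (labelled A p φ) = labelled P b (φ.res (restrictHom H a)) := by
  rw [labelled, bRes_bTr _ _ _ _ hp, bRes_bNm _ _ _ _ (isPb_indAct a), bRes_bConst, ← indFun_res]
  rfl

theorem labelled_eq_of_bijective {Y A B : FinGSet G} {p : A →[G] Y} {q : B →[G] Y} (f : A →[G] B)
    (hf : Function.Bijective f) (h : ∀ a, q (f a) = p a) (φ : InvFun H (B.restrict H)) :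
    labelled A p (φ.res (restrictHom H f)) = labelled B q φ := by
  rw [← bRes_labelled (f := MulActionHom.id G) (isPb_of_bijective p q f hf h) φ, bRes_id]

theorem labelled_one {Y A : FinGSet G} (p : A →[G] Y) {φ : InvFun H (A.restrict H)}
    (h : ∀ a, φ.1 a = 1) : labelled A p φ = bOf Y (gcls A p) := by
  have h1 : ∀ z, (indFun φ).1 z = 1 := fun z => by
    obtain ⟨g, a, rfl⟩ := indMk_ind z
    exact h a
  rw [labelled, bConst_one h1, bNm_one, bTr_bOf]
  rfl

/-- The class of a labelled `G`-set in the norm of `ℤ`. -/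
noncomputable def nCls {Y : FinGSet G} (A : FinGSet G) (p : A →[G] Y) (φ : InvFun H (A.restrict H)) :
    (norm H (constZ H)).obj Y :=
  Quotient.mk _ (NormSystem.cls (M := NormSystem.onRestrict H (constZ H).toNormSystem) A p φ)

theorem nCls_ind {Y : FinGSet G} (x : (norm H (constZ H)).obj Y) :
    ∃ (A : FinGSet G) (p : A →[G] Y) (φ : InvFun H (A.restrict H)), nCls A p φ = x := by
  induction x using Quotient.ind with | _ x =>
  induction x using NormSystem.Free.ind with | h A p φ =>
  exact ⟨A, p, φ, rfl⟩

theorem nCls_eq_of_bijective {Y A B : FinGSet G} {p : A →[G] Y} {q : B →[G] Y} (f : A →[G] B)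
    (hf : Function.Bijective f) (h : ∀ a, q (f a) = p a) (φ : InvFun H (B.restrict H)) :
    nCls A p (φ.res (restrictHom H f)) = nCls B q φ :=
  congrArg (Quotient.mk _) (NormSystem.mk_eq f hf h rfl)

/-- The relation which defines the norm. -/
theorem nCls_step {A P Y : FinGSet G} {X : FinGSet H} (p : A →[G] Y) {t : X →[H] A.restrict H}
    {ev : P.restrict H →[H] X} {π : P →[G] A} (hc : IsCoind t ev π) (r : InvFun H X) :
    nCls A p (r.tr t) = nCls P (p.comp π) (r.res ev) :=
  Quotient.sound (Relation.EqvGen.rel _ _ (NStep.mk (R := constZ H) p t ev π r hc))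

theorem nCls_res {Y Y' A P : FinGSet G} {p : A →[G] Y} {f : Y' →[G] Y} {a : P →[G] A}
    {b : P →[G] Y'} (hp : IsPb a b p f) (φ : InvFun H (A.restrict H)) :
    (norm H (constZ H)).res f (nCls A p φ) = nCls P b (φ.res (restrictHom H a)) :=
  congrArg (Quotient.mk _) (NormSystem.fRes_mk hp)

theorem nCls_tr {Y Y' A : FinGSet G} (p : A →[G] Y) (f : Y →[G] Y')
    (φ : InvFun H (A.restrict H)) :
    (norm H (constZ H)).tr f (nCls A p φ) = nCls A (f.comp p) φ := rfl

theorem nCls_nm {Y Y' A E P : FinGSet G} {π : A →[G] Y} {f : Y →[G] Y'} {e : E →[G] A}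
    {q : E →[G] P} {p : P →[G] Y'} (hp : IsExp π f e q p) (φ : InvFun H (A.restrict H)) :
    (norm H (constZ H)).nm f (nCls A π φ) =
      nCls P p ((φ.res (restrictHom H e)).nm (restrictHom H q)) :=
  congrArg (Quotient.mk _) (NormSystem.fNm_mk hp)

end Comparison

section Psi

variable {m : ℕ}

theorem conj_refl_inf_rot {g k : DihedralGroup m} (hg : g ∈ refl m) (hk : k * g * k⁻¹ ∈ rot m) :
    g = 1 := by
  rw [conj_mem_rot] at hk
  rcases mem_refl.1 hg with rfl | rfl
  · rfl
  · exact absurd hk (sr_notMem_rot _)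

variable [NeZero m]

/-- Rotations act freely on `D_{2m} ×_{D_2} X`, so that virtual sets over it become equal over the
rotations as soon as their fibres have the same cardinalities. -/
theorem rotRes_ind_eq {X : FinGSet (refl m)} {κ l : BurnsideGroup (ind X)}
    (h : ∀ z, ghost _ κ (⊥, z) = ghost _ l (⊥, z)) : rotRes _ κ = rotRes _ l := by
  refine rotRes_eq_iff.2 fun K hK z hz => ?_
  have : K = ⊥ := by
    refine (Subgroup.eq_bot_iff_forall K).2 fun k hk => ?_
    obtain ⟨g, x, rfl⟩ := indMk_ind z
    obtain ⟨h, h1, -⟩ := indMk_eq_iff.1 ((smul_indMk k g x).symm.trans (hz k hk))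
    have h2 : k = g * h * g⁻¹ := eq_mul_inv_iff_mul_eq.2 (eq_mul_inv_iff_mul_eq.1 h1).symm
    rw [h2] at hk ⊢
    rw [conj_refl_inf_rot h.2 (hK hk)]
    group
  rw [this, h]

/-- On the rotations, the passage from invariant functions to virtual sets over induced sets commutes
with transfers. -/
theorem rotRes_bConst_indFun_tr {X Y : FinGSet (refl m)} (f : X →[refl m] Y)
    (φ : InvFun (refl m) X) :
    rotRes _ (bConst (indFun (φ.tr f))) = rotRes _ (bTr (indMap f) (bConst (indFun φ))) := by
  have hb : ∀ {Z : FinGSet (DihedralGroup m)} (z : Z), ∀ k ∈ (⊥ : Subgroup (DihedralGroup m)),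
      k • z = z := fun z k hk => by rw [Subgroup.mem_bot.1 hk, one_smul]
  refine rotRes_ind_eq fun z => ?_
  rw [ghost_bTr, ghost_bConst _ (hb z), indFun_tr, InvFun.tr_apply]
  exact finsum_congr fun x => (ghost_bConst _ (hb _)).symm

/-- On the rotations, the passage from invariant functions to virtual sets over induced sets commutes
with norms. -/
theorem rotRes_bConst_indFun_nm {X Y : FinGSet (refl m)} (f : X →[refl m] Y)
    (φ : InvFun (refl m) X) :
    rotRes _ (bConst (indFun (φ.nm f))) = rotRes _ (bNm (indMap f) (bConst (indFun φ))) := by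
  have hb : ∀ {Z : FinGSet (DihedralGroup m)} (z : Z), ∀ k ∈ (⊥ : Subgroup (DihedralGroup m)),
      k • z = z := fun z k hk => by rw [Subgroup.mem_bot.1 hk, one_smul]
  refine rotRes_ind_eq fun z => ?_
  rw [ghost_bNm_bot, ghost_bConst _ (hb z), indFun_nm, InvFun.nm_apply]
  exact finprod_congr fun x => (ghost_bConst _ (hb _)).symm

theorem rotRes_bTr_bNm_congr {X Y Z : FinGSet (DihedralGroup m)} (f : X →[DihedralGroup m] Y)
    (p : Y →[DihedralGroup m] Z) {κ l : BurnsideGroup X} (h : rotRes X κ = rotRes X l) :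
    rotRes Z (bTr p (bNm f κ)) = rotRes Z (bTr p (bNm f l)) := by
  rw [rotRes_bTr, rotRes_bTr, rotRes_bNm, rotRes_bNm, h]

/-- On the rotations, the virtual sets attached to labelled sets satisfy the relation which defines
the norm of `ℤ`. It is the distributivity of norms over transfers, as the coinduced set is a
dependent product along the action map. -/
theorem rotRes_labelled_step {A P Y : FinGSet (DihedralGroup m)} {X : FinGSet (refl m)}
    (p : A →[DihedralGroup m] Y) {t : X →[refl m] A.restrict (refl m)}
    {ev : P.restrict (refl m) →[refl m] X} {π : P →[DihedralGroup m] A} (hc : IsCoind t ev π)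
    (r : InvFun (refl m) X) :
    rotRes Y (labelled A p (r.tr t)) = rotRes Y (labelled P (p.comp π) (r.res ev)) := by
  rw [labelled, rotRes_bTr_bNm_congr _ _ (rotRes_bConst_indFun_tr t r),
    bNm_bTr _ _ _ _ _ hc.isExp, bTr_bTr, bRes_bConst, ← indFun_res]
  rfl

theorem rotRes_bNm_labelled {Y Y' A E P : FinGSet (DihedralGroup m)} {π : A →[DihedralGroup m] Y}
    {f : Y →[DihedralGroup m] Y'} {e : E →[DihedralGroup m] A} {q : E →[DihedralGroup m] P}
    {p : P →[DihedralGroup m] Y'} (hp : IsExp π f e q p)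
    (φ : InvFun (refl m) (A.restrict (refl m))) :
    rotRes Y' (bNm f (labelled A π φ)) =
      rotRes Y' (labelled P p ((φ.res (restrictHom _ e)).nm (restrictHom _ q))) := by
  have h1 : q.comp (indAct (refl m) E) = (indAct (refl m) P).comp (indMap (restrictHom _ q)) :=
    MulActionHom.ext fun z => ((isPb_indAct (H := refl m) q).1 z).symm
  rw [labelled, labelled, rotRes_bTr_bNm_congr _ _ (rotRes_bConst_indFun_nm _ _),
    bNm_bTr _ _ _ _ _ hp, bRes_bNm _ _ _ _ (isPb_indAct e), bNm_bNm, bNm_bNm, bRes_bConst,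
    ← indFun_res, h1]

/-- The quotient of the Burnside Tambara functor by `2 - [D_{2m}/μ_m]`. -/
noncomputable abbrev burnsideQuot (m : ℕ) [NeZero m] : TambaraFunctor.{1} (DihedralGroup m) :=
  (burnside (DihedralGroup m)).quotientBy (X₀ := pt (DihedralGroup m)) (dGen m)

/-- The class in the quotient of a virtual set. -/
noncomputable def qCls {Y : FinGSet (DihedralGroup m)} (κ : BurnsideGroup Y) : (burnsideQuot m).obj Y :=
  (burnside (DihedralGroup m)).toQuotient (X₀ := pt (DihedralGroup m)) (dGen m) κ

/-- The comparison map `N_{D_2}^{D_{2m}} ℤ → A / (2 - [D_{2m}/μ_m])`. -/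
noncomputable def psi (hm : Odd m) {Y : FinGSet (DihedralGroup m)} :
    (norm (refl m) (constZ (refl m))).obj Y → (burnsideQuot m).obj Y :=
  Quotient.lift
    (Quotient.lift (fun s => qCls (labelled s.A s.p s.lab)) (by
      rintro s t ⟨f, hf, h1, h2⟩
      have h3 := labelled_eq_of_bijective f hf h1 (H := refl m) t.lab
      have h2 : InvFun.res (restrictHom (refl m) f) t.lab = s.lab := h2
      rw [h2] at h3
      exact congrArg qCls h3)) (by
    intro a b h
    induction h with
    | rel a b h =>
      obtain ⟨p, t, ev, π, r, hc⟩ := h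
      exact (toQuotient_eq_iff hm).2 (rotRes_labelled_step p hc r)
    | refl => rfl
    | symm _ _ _ h => exact h.symm
    | trans _ _ _ _ _ h h' => exact h.trans h')

variable (hm : Odd m)

theorem psi_nCls {Y A : FinGSet (DihedralGroup m)} (p : A →[DihedralGroup m] Y)
    (φ : InvFun (refl m) (A.restrict (refl m))) :
    psi hm (nCls A p φ) = qCls (labelled A p φ) := rfl

theorem psi_res {X Y : FinGSet (DihedralGroup m)} (f : X →[DihedralGroup m] Y)
    (y : (norm (refl m) (constZ (refl m))).obj Y) :
    psi hm ((norm (refl m) (constZ (refl m))).res f y) = (burnsideQuot m).res f (psi hm y) := by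
  obtain ⟨A, p, φ, rfl⟩ := nCls_ind y
  rw [nCls_res (isPb_pb p f), psi_nCls, psi_nCls, ← bRes_labelled (isPb_pb p f)]
  rfl

theorem psi_tr {X Y : FinGSet (DihedralGroup m)} (f : X →[DihedralGroup m] Y)
    (x : (norm (refl m) (constZ (refl m))).obj X) :
    psi hm ((norm (refl m) (constZ (refl m))).tr f x) = (burnsideQuot m).tr f (psi hm x) := by
  obtain ⟨A, p, φ, rfl⟩ := nCls_ind x
  rw [nCls_tr, psi_nCls, psi_nCls, labelled, ← bTr_bTr]
  rfl

theorem psi_nm {X Y : FinGSet (DihedralGroup m)} (f : X →[DihedralGroup m] Y)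
    (x : (norm (refl m) (constZ (refl m))).obj X) :
    psi hm ((norm (refl m) (constZ (refl m))).nm f x) = (burnsideQuot m).nm f (psi hm x) := by
  obtain ⟨A, p, φ, rfl⟩ := nCls_ind x
  rw [nCls_nm (isExp_expo p f), psi_nCls, psi_nCls]
  exact (toQuotient_eq_iff hm).2 (rotRes_bNm_labelled (isExp_expo p f) φ).symm

end Psi

/-! ### The additive group structure of the norm -/

section NormGroup

variable {G : Type} [Group G] [Finite G] {H : Subgroup G}

/-- The value at `Y` of the norm of `ℤ`. -/
abbrev NormZ (H : Subgroup G) (Y : FinGSet G) : Type 1 := (norm H (constZ H)).obj Y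

theorem nCls_eq {Y A B : FinGSet G} {p : A →[G] Y} {q : B →[G] Y} {φ : InvFun H (A.restrict H)}
    {ψ : InvFun H (B.restrict H)} (f : A →[G] B) (hf : Function.Bijective f)
    (h : ∀ a, q (f a) = p a) (hφ : ∀ a, ψ.1 (f a) = φ.1 a) : nCls A p φ = nCls B q ψ := by
  rw [← nCls_eq_of_bijective f hf h]
  congr 1
  exact Subtype.ext (funext fun a => (hφ a).symm)

/-- The label on a disjoint union with given components. -/
def InvFun.sum {A B : FinGSet G} (φ : InvFun H (A.restrict H)) (ψ : InvFun H (B.restrict H)) :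
    InvFun H ((A.sum B).restrict H) :=
  ⟨Sum.elim φ.1 ψ.1, by
    rintro h (a | b)
    · exact φ.2 h a
    · exact ψ.2 h b⟩

/-- The sum of two elements is the transfer along the fold map of the element of the value at
`Y ⊔ Y` with these components. -/
noncomputable instance {Y : FinGSet G} : Add (NormZ H Y) :=
  ⟨fun x y => (norm H (constZ H)).tr (fold Y) ((norm H (constZ H)).obj_sum x y).choose⟩

noncomputable instance {Y : FinGSet G} : Zero (NormZ H Y) := ⟨(norm H (constZ H)).zero Y⟩

theorem tr_fold_eq_add {Y : FinGSet G} (z : NormZ H (Y.sum Y)) :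
    (norm H (constZ H)).tr (fold Y) z =
      ((norm H (constZ H)).res inl z + (norm H (constZ H)).res inr z : NormZ H Y) := by
  have h := ((norm H (constZ H)).obj_sum ((norm H (constZ H)).res inl z)
    ((norm H (constZ H)).res inr z)).choose_spec
  exact congrArg _ (h.2 z ⟨rfl, rfl⟩)

theorem nCls_sum {Y A B : FinGSet G} (p : A →[G] Y) (q : B →[G] Y)
    (φ : InvFun H (A.restrict H)) (ψ : InvFun H (B.restrict H)) :
    nCls (A.sum B) (desc p q) (φ.sum ψ) = (nCls A p φ + nCls B q ψ : NormZ H Y) := by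
  have h := tr_fold_eq_add (nCls (A.sum B) (NormSystem.sumMap p q) (φ.sum ψ))
  rw [nCls_res (NormSystem.isPb_inl p q), nCls_res (NormSystem.isPb_inr p q), nCls_tr] at h
  have h1 : (fold Y).comp (NormSystem.sumMap p q) = desc p q :=
    MulActionHom.ext (by rintro (x | x) <;> rfl)
  rw [h1] at h
  exact h

theorem nCls_of_isEmpty {Y A : FinGSet G} (p : A →[G] Y) (φ : InvFun H (A.restrict H))
    (hA : IsEmpty A) : nCls A p φ = (0 : NormZ H Y) := by
  have h : ((norm H (constZ H)).obj_empty (empty G) (inferInstanceAs (IsEmpty Empty))).choose =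
      nCls (empty G) (MulActionHom.id G) ⟨fun _ => 0, fun _ _ => rfl⟩ :=
    ((norm H (constZ H)).obj_empty (empty G) (inferInstanceAs (IsEmpty Empty))).unique trivial
      trivial
  have h1 : (0 : NormZ H Y) = nCls (empty G) (fromEmpty Y) ⟨fun _ => 0, fun _ _ => rfl⟩ :=
    congrArg ((norm H (constZ H)).tr (fromEmpty Y)) h
  rw [h1]
  exact (nCls_eq (fromEmpty A) ⟨fun x => Empty.elim x, fun a => hA.elim a⟩
    (fun x => Empty.elim x) fun x => Empty.elim x).symm

theorem normZ_add_comm {Y : FinGSet G} (x y : NormZ H Y) : x + y = y + x := by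
  obtain ⟨A, p, φ, rfl⟩ := nCls_ind x
  obtain ⟨B, q, ψ, rfl⟩ := nCls_ind y
  rw [← nCls_sum, ← nCls_sum]
  refine nCls_eq (desc inr inl) ?_ (by rintro (x | x) <;> rfl) (by rintro (x | x) <;> rfl)
  have : ⇑(desc inr inl : A.sum B →[G] B.sum A) = Sum.swap := by
    funext x; rcases x with x | x <;> rfl
  rw [this]
  exact (Equiv.sumComm A B).bijective

theorem normZ_zero_add {Y : FinGSet G} (x : NormZ H Y) : 0 + x = x := by
  obtain ⟨A, p, φ, rfl⟩ := nCls_ind x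
  rw [← nCls_of_isEmpty (fromEmpty Y) ⟨fun _ => 0, fun _ _ => rfl⟩
    (inferInstanceAs (IsEmpty Empty)), ← nCls_sum]
  refine (nCls_eq inr ⟨Sum.inr_injective, ?_⟩ (fun _ => rfl) fun _ => rfl).symm
  rintro (x | x)
  · exact Empty.elim x
  · exact ⟨x, rfl⟩

theorem normZ_add_assoc {Y : FinGSet G} (x y z : NormZ H Y) : x + y + z = x + (y + z) := by
  obtain ⟨A, p, φ, rfl⟩ := nCls_ind x
  obtain ⟨B, q, ψ, rfl⟩ := nCls_ind y
  obtain ⟨C, r, χ, rfl⟩ := nCls_ind z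
  rw [← nCls_sum, ← nCls_sum, ← nCls_sum, ← nCls_sum]
  refine nCls_eq (desc (desc inl (inr.comp inl)) (inr.comp inr)) ?_
    (by rintro ((x | x) | x) <;> rfl) (by rintro ((x | x) | x) <;> rfl)
  have : ⇑(desc (desc inl (inr.comp inl)) (inr.comp inr) : (A.sum B).sum C →[G] A.sum (B.sum C)) =
      Equiv.sumAssoc A B C := by
    funext x; rcases x with (x | x) | x <;> rfl
  rw [this]
  exact (Equiv.sumAssoc A B C).bijective

theorem normZ_exists_add_eq_zero {Y : FinGSet G} (x : NormZ H Y) : ∃ y, y + x = 0 := by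
  obtain ⟨z, o, h1, h2⟩ := (norm H (constZ H)).exists_neg x
  refine ⟨(norm H (constZ H)).res inr z, ?_⟩
  rw [tr_fold_eq_add, h1] at h2
  rw [normZ_add_comm, h2]
  exact congrArg ((norm H (constZ H)).tr (fromEmpty Y))
    (((norm H (constZ H)).obj_empty (empty G) (inferInstanceAs (IsEmpty Empty))).unique trivial
      trivial)

noncomputable instance {Y : FinGSet G} : Neg (NormZ H Y) :=
  ⟨fun x => (normZ_exists_add_eq_zero x).choose⟩

noncomputable instance {Y : FinGSet G} : AddCommGroup (NormZ H Y) where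
  add_assoc := normZ_add_assoc
  zero_add := normZ_zero_add
  add_zero x := by rw [normZ_add_comm, normZ_zero_add]
  add_comm := normZ_add_comm
  nsmul := nsmulRec
  zsmul := zsmulRec
  neg_add_cancel x := (normZ_exists_add_eq_zero x).choose_spec

/-- The constant label `1`. -/
def InvFun.one (X : FinGSet G) : InvFun G X := ⟨fun _ => 1, fun _ _ => rfl⟩

theorem nCls_orb {Y A : FinGSet G} (p : A →[G] Y) (φ : InvFun H (A.restrict H)) (a : A) :
    nCls A p φ = (nCls (orb a) (p.comp (partMap _ _)) (φ.res (restrictHom H (partMap _ _))) +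
      nCls (offOrb a) (p.comp (partMap _ _)) (φ.res (restrictHom H (partMap _ _))) :
        NormZ H Y) := by
  classical
  rw [← nCls_sum]
  refine (nCls_eq (desc (partMap _ _) (partMap _ _)) ?_ (by rintro (x | x) <;> rfl)
    (by rintro (x | x) <;> rfl)).symm
  have : ⇑(desc (partMap _ _) (partMap _ _) : (orb a).sum (offOrb a) →[G] A) =
      Equiv.sumCompl fun x : A => ∃ k : G, k • a = x := by
    funext x; rcases x with x | x <;> rfl
  rw [this]
  exact (Equiv.sumCompl fun x : A => ∃ k : G, k • a = x).bijective

/-- The additive map from the Burnside functor to the norm which sends the class of a `G`-set to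
the class of the same `G`-set with label `1`. -/
noncomputable def phi (H : Subgroup G) (Y : FinGSet G) : BurnsideGroup Y →+ NormZ H Y :=
  Algebra.GrothendieckAddGroup.lift
    { toFun := Quotient.lift (fun s => nCls s.A s.p (InvFun.one _)) (by
        rintro s t ⟨f, hf, h, -⟩
        exact nCls_eq f hf h fun _ => rfl)
      map_zero' := nCls_of_isEmpty _ _ (inferInstanceAs (IsEmpty Empty))
      map_add' := fun a b => by
        induction a using gcls_ind with | h A p =>
        induction b using gcls_ind with | h B q =>
        refine Eq.trans ?_ (nCls_sum p q _ _)
        exact nCls_eq (MulActionHom.id G) Function.bijective_id (fun _ => rfl)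
          (by rintro (x | x) <;> rfl) }

theorem phi_bOf {Y A : FinGSet G} (p : A →[G] Y) :
    phi H Y (bOf Y (gcls A p)) = nCls A p (InvFun.one _) := lift_bOf _ _

theorem labelled_sum {Y A B : FinGSet G} (p : A →[G] Y) (q : B →[G] Y)
    (φ : InvFun H (A.restrict H)) (ψ : InvFun H (B.restrict H)) :
    labelled (A.sum B) (desc p q) (φ.sum ψ) = labelled A p φ + labelled B q ψ := by
  have h1 : (fold Y).comp (NormSystem.sumMap p q) = desc p q :=
    MulActionHom.ext (by rintro (x | x) <;> rfl)
  rw [← h1, labelled, ← bTr_bTr, ← labelled, eq_bPair (labelled _ (NormSystem.sumMap p q) _),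
    bTr_fold_bPair, bRes_labelled (NormSystem.isPb_inl p q),
    bRes_labelled (NormSystem.isPb_inr p q)]
  rfl

end NormGroup

/-! ### The comparison map and restriction to the rotations -/

section PsiHom

variable {m : ℕ} [NeZero m]

/-- Restriction to the rotations, on the quotient of the Burnside functor. -/
noncomputable def quotRotRes (Y : FinGSet (DihedralGroup m)) :
    (burnsideQuot m).obj Y → BurnsideGroup (Y.prod (orient m)) :=
  Quotient.lift (rotRes Y) fun _ _ h => rotRes_eq_of_genRel h

theorem quotRotRes_injective (hm : Odd m) (Y : FinGSet (DihedralGroup m)) :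
    Function.Injective (quotRotRes Y) := by
  intro x y h
  induction x using Quotient.ind with | _ x =>
  induction y using Quotient.ind with | _ y =>
  exact (toQuotient_eq_iff hm).2 h

/-- The comparison map followed by restriction to the rotations, as an additive map. -/
noncomputable def psiHom (hm : Odd m) (Y : FinGSet (DihedralGroup m)) :
    NormZ (refl m) Y →+ BurnsideGroup (Y.prod (orient m)) :=
  AddMonoidHom.mk' (fun x => quotRotRes Y (psi hm x)) fun x y => by
    obtain ⟨A, p, φ, rfl⟩ := nCls_ind x
    obtain ⟨B, q, ψ, rfl⟩ := nCls_ind y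
    rw [← nCls_sum, psi_nCls, psi_nCls, psi_nCls, labelled_sum]
    exact map_add (rotRes Y) _ _

theorem psiHom_nCls (hm : Odd m) {Y A : FinGSet (DihedralGroup m)} (p : A →[DihedralGroup m] Y)
    (φ : InvFun (refl m) (A.restrict (refl m))) :
    psiHom hm Y (nCls A p φ) = rotRes Y (labelled A p φ) := rfl

theorem psiHom_phi (hm : Odd m) {Y : FinGSet (DihedralGroup m)} (κ : BurnsideGroup Y) :
    psiHom hm Y (phi (refl m) Y κ) = rotRes Y κ := by
  obtain ⟨a, b, rfl⟩ := exists_bOf_sub κ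
  induction a using gcls_ind with | h A p =>
  induction b using gcls_ind with | h B q =>
  rw [map_sub, map_sub, map_sub, phi_bOf, phi_bOf, psiHom_nCls, psiHom_nCls,
    labelled_one p fun _ => rfl, labelled_one q fun _ => rfl]

end PsiHom

/-! ### Changing labels one orbit at a time -/

section Relabel

variable {G : Type} [Group G] {H : Subgroup G}

theorem InvFun.tr_desc {X Y Z : FinGSet G} (f : X →[G] Z) (g : Y →[G] Z) (φ : InvFun G (X.sum Y))
    (z : Z) : (φ.tr (desc f g)).1 z =
      ((φ.res inl).tr f).1 z + ((φ.res inr).tr g).1 z := by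
  rw [InvFun.tr_apply, InvFun.tr_apply, InvFun.tr_apply]
  have := Fintype.ofFinite {x // f x = z}
  have := Fintype.ofFinite {y // g y = z}
  rw [finsum_eq_sum_of_fintype (fun x : {x // f x = z} => _),
    finsum_eq_sum_of_fintype (fun y : {y // g y = z} => _)]
  refine Eq.trans ?_ (Fintype.sum_sum_type (Sum.elim (fun x : {x // f x = z} => (φ.res inl).1 x.1)
    fun y : {y // g y = z} => (φ.res inr).1 y.1))
  rw [← finsum_eq_sum_of_fintype]
  symm
  refine finsum_eq_of_bijective (fun x : {x // f x = z} ⊕ {y // g y = z} =>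
    (Sum.elim (fun x => ⟨Sum.inl x.1, x.2⟩) (fun y => ⟨Sum.inr y.1, y.2⟩) x :
      {x : X.sum Y // desc f g x = z})) ⟨?_, ?_⟩ ?_
  · rintro (x | x) (y | y) h
    · exact congrArg Sum.inl (Subtype.ext (Sum.inl_injective (congrArg Subtype.val h)))
    · exact absurd (congrArg Subtype.val h) Sum.inl_ne_inr
    · exact absurd (congrArg Subtype.val h) Sum.inr_ne_inl
    · exact congrArg Sum.inr (Subtype.ext (Sum.inr_injective (congrArg Subtype.val h)))
  · rintro ⟨x | x, hx⟩
    · exact ⟨Sum.inl ⟨x, hx⟩, rfl⟩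
    · exact ⟨Sum.inr ⟨x, hx⟩, rfl⟩
  · rintro (x | x) <;> rfl

theorem InvFun.tr_partMap {X : FinGSet G} {S : X → Prop} {hS : ∀ (g : G) x, S x → S (g • x)}
    (φ : InvFun G (part S hS)) (ψ : InvFun G X) (h : ∀ x, φ.1 x = ψ.1 x.1) (x : X)
    [Decidable (S x)] : (φ.tr (partMap S hS)).1 x = if S x then ψ.1 x else 0 := by
  rw [InvFun.tr_apply]
  split_ifs with hx
  · let _ : Unique {y // partMap S hS y = x} := ⟨⟨⟨⟨x, hx⟩, rfl⟩⟩, fun y =>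
      Subtype.ext (Subtype.ext y.2)⟩
    rw [finsum_unique]
    exact h _
  · have : IsEmpty {y // partMap S hS y = x} := ⟨fun y => hx (y.2 ▸ y.1.2)⟩
    exact finsum_of_isEmpty _

theorem card_stabilizer_smul {A : FinGSet G} (g : G) (a : A) :
    Nat.card (MulAction.stabilizer G (g • a)) = Nat.card (MulAction.stabilizer G a) :=
  (Nat.card_congr (MulAction.stabilizerEquivStabilizer (g := g) (a := a) rfl).toEquiv).symm

/-- If the stabilizer of a point `s` over the orbit of `a` is not smaller than the stabilizer of
`a`, then some translate of `s` lies over `a` and is fixed by the stabilizer of `a`. -/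
theorem exists_smul_fixed [Finite G] {A P : FinGSet G} (π : P →[G] A) {a : A} (ha : ∀ x, ∃ g : G, g • a = x)
    {s : P} (hs : ¬ Nat.card (MulAction.stabilizer G s) < Nat.card (MulAction.stabilizer G a)) :
    ∃ k : G, π (k • s) = a ∧ ∀ g : G, g • a = a → g • k • s = k • s := by
  obtain ⟨k, hk⟩ := ha (π s)
  have h1 : π (k⁻¹ • s) = a := by rw [map_smul, ← hk, inv_smul_smul]
  refine ⟨k⁻¹, h1, ?_⟩
  have h2 : MulAction.stabilizer G (k⁻¹ • s) = MulAction.stabilizer G a := by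
    refine Subgroup.eq_of_le_of_card_ge (fun g hg => ?_) ?_
    · have hg : g • k⁻¹ • s = k⁻¹ • s := hg
      show g • a = a
      rw [← h1, ← map_smul, hg]
    · rw [card_stabilizer_smul]
      exact not_lt.1 hs
  intro g hg
  have h3 : g ∈ MulAction.stabilizer G a := hg
  rw [← h2] at h3
  exact h3

/-- An `H`-equivariant section of `t` induces a `G`-equivariant section of `π`. -/
theorem TambaraFunctor.IsCoind.exists_section {A P : FinGSet G} {X : FinGSet H}
    {t : X →[H] A.restrict H} {ev : P.restrict H →[H] X} {π : P →[G] A} (hc : IsCoind t ev π)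
    (σ : A.restrict H →[H] X) (hσ : ∀ x, t (σ x) = x) :
    ∃ s : A →[G] P, ∀ x, π (s x) = x ∧ ∀ g : G, ev (g • s x : P) = σ (g • x : A) := by
  refine exists_hom (fun (x : A) (s : P) => π s = x ∧ ∀ g : G, ev (g • s : P) = σ (g • x : A))
    ?_ fun x => hc.2 x (fun g => σ (g • x : A)) (fun h g => ?_) fun g => hσ _
  · rintro c x s ⟨h1, h2⟩
    refine ⟨by rw [map_smul, h1], fun g => ?_⟩
    rw [← mul_smul, h2, mul_smul]
  · rw [mul_smul]
    exact map_smul σ h (g • x : A)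

variable [Finite G]

/-- Additivity of the norm in the label at a single `H`-orbit `H a`, for a transitive `G`-set, up
to `G`-sets with smaller stabilizers. It comes from the relation of the norm for the map which is
two-to-one over `H a` and one-to-one elsewhere: the two sections of this map account for the
first two summands, and all other points of the coinduced set have smaller stabilizers than `a`. -/
theorem exists_nCls_add {Y A : FinGSet G} (p : A →[G] Y) {a : A} (ha : ∀ x, ∃ g : G, g • a = x)
    {φ ψ χ : InvFun H (A.restrict H)}
    (h0 : ∀ x : A, (¬ ∃ h : H, (h : G) • a = x) → ψ.1 x = φ.1 x ∧ χ.1 x = φ.1 x)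
    (h1 : ∀ x : A, (∃ h : H, (h : G) • a = x) → χ.1 x = φ.1 x + ψ.1 x) :
    ∃ (P : FinGSet G) (q : P →[G] Y) (r : InvFun H (P.restrict H)),
      (∀ s : P, Nat.card (MulAction.stabilizer G s) < Nat.card (MulAction.stabilizer G a)) ∧
      ((∀ x, φ.1 x = 1) → (∀ x, ψ.1 x = 1) → r = InvFun.one _) ∧
      nCls A p χ = (nCls A p φ + nCls A p ψ + nCls P q r : NormZ H Y) := by
  classical
  let a' : A.restrict H := a
  let X : FinGSet H := (A.restrict H).sum (orb a')
  let t : X →[H] A.restrict H := desc (MulActionHom.id H) (partMap _ _)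
  let r : InvFun H X := ⟨Sum.elim φ.1 (fun x => ψ.1 x.1), by
    rintro h (x | x)
    · exact φ.2 h x
    · exact ψ.2 h x.1⟩
  have hχ : χ = r.tr t := by
    refine Subtype.ext (funext fun x => ?_)
    have e1 : ((r.res inl).tr (MulActionHom.id H)).1 x = φ.1 x :=
      congrFun (congrArg Subtype.val ((constZ H).tr_id (r.res inl))) x
    have e2 : ((r.res inr).tr (partMap _ _)).1 x =
        if (∃ h : H, h • a' = x) then ψ.1 x else 0 :=
      InvFun.tr_partMap (r.res inr) ψ (fun _ => rfl) x
    refine Eq.trans ?_ (InvFun.tr_desc _ _ r x).symm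
    rw [e1, e2]
    split_ifs with hx
    · exact h1 x hx
    · rw [add_zero]; exact (h0 x hx).2
  obtain ⟨P, ev, π, hc⟩ := exists_isCoind t
  obtain ⟨s₀, hs₀⟩ := hc.exists_section inl fun _ => rfl
  let σ₀ : A.restrict H → X := fun x => if hx : ∃ h : H, h • a' = x then Sum.inr ⟨x, hx⟩
    else Sum.inl x
  have hσ₁ : ∀ x (hx : ∃ h : H, h • a' = x), σ₀ x = Sum.inr ⟨x, hx⟩ := fun x hx => dif_pos hx
  have hσ₀ : ∀ x (_ : ¬ ∃ h : H, h • a' = x), σ₀ x = Sum.inl x := fun x hx => dif_neg hx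
  let σ : A.restrict H →[H] X := ⟨σ₀, fun h x => by
    by_cases hx : ∃ k : H, k • a' = x
    · exact (hσ₁ _ (exists_smul_eq_smul h x hx)).trans (congrArg (h • ·) (hσ₁ x hx)).symm
    · exact (hσ₀ _ (not_exists_smul_eq_smul h x hx)).trans (congrArg (h • ·) (hσ₀ x hx)).symm⟩
  have hσ1 : ∀ x (hx : ∃ h : H, h • a' = x), σ x = Sum.inr ⟨x, hx⟩ := hσ₁
  have hσ0 : ∀ x (_ : ¬ ∃ h : H, h • a' = x), σ x = Sum.inl x := hσ₀
  have hσ : ∀ x, t (σ x) = x := fun x => by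
    by_cases hx : ∃ h : H, h • a' = x
    · exact congrArg t (hσ1 x hx)
    · exact congrArg t (hσ0 x hx)
  obtain ⟨s₁, hs₁⟩ := hc.exists_section σ hσ
  have haa : ∃ h : H, h • a' = a' := ⟨1, one_smul H a'⟩
  -- The two sections have disjoint images, since they differ over `a`.
  have hne : ∀ x y, s₀ x ≠ s₁ y := by
    intro x y hxy
    obtain rfl : x = y := by rw [← (hs₀ x).1, hxy, (hs₁ y).1]
    obtain ⟨k, rfl⟩ := ha x
    have e0 := (hs₀ (k • a)).2 k⁻¹
    have e1 := (hs₁ (k • a)).2 k⁻¹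
    rw [inv_smul_smul] at e0 e1
    rw [hxy, e1] at e0
    exact Sum.inr_ne_inl ((hσ1 a' haa).symm.trans e0)
  let S : P → Prop := fun s => (∀ x, s₀ x ≠ s) ∧ ∀ x, s₁ x ≠ s
  have hS : ∀ (g : G) s, S s → S (g • s) := by
    rintro g s ⟨h2, h3⟩
    refine ⟨fun x hx => h2 (g⁻¹ • x) ?_, fun x hx => h3 (g⁻¹ • x) ?_⟩
    · rw [map_smul, hx, inv_smul_smul]
    · rw [map_smul, hx, inv_smul_smul]
  have ev1 : ∀ s : P, ev ((1 : G) • s : P) = ev s := fun s => by rw [one_smul]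
  refine ⟨part S hS, (p.comp π).comp (partMap S hS),
    (r.res ev).res (restrictHom H (partMap S hS)), fun s => ?_, fun hφ hψ => ?_, ?_⟩
  · by_contra hlt
    rw [stabilizer_part] at hlt
    obtain ⟨k, hk, hfix⟩ := exists_smul_fixed π ha hlt
    -- A point over `a` fixed by the stabilizer of `a` is determined by its value at `1`.
    have key : ∀ (s' : A →[G] P) (σ' : A.restrict H →[H] X),
        (∀ x, π (s' x) = x ∧ ∀ g : G, ev (g • s' x : P) = σ' (g • x : A)) →
        (∀ x, (¬ ∃ h : H, h • a' = x) → σ' x = Sum.inl x) → ev (k • s.1 : P) = σ' a' →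
        s' a = k • s.1 := by
      intro s' σ' hs' hσ' hev
      refine hc.ext ((hs' a).1.trans hk.symm) fun g => ?_
      rw [(hs' a).2]
      by_cases hga : ∃ h : H, h • a' = (g • a : A)
      · obtain ⟨h, hh⟩ := hga
        have e1 : g • k • s.1 = (h : G) • k • s.1 := by
          have e2 := hfix ((h : G)⁻¹ * g) (by
            rw [mul_smul, inv_smul_eq_iff]; exact hh.symm)
          rw [mul_smul, inv_smul_eq_iff] at e2
          exact e2
        rw [e1, ← hh, map_smul, ← hev]
        exact (map_smul ev h (k • s.1 : P)).symm
      · rw [hσ' _ hga]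
        have e1 : t (ev (g • k • s.1 : P)) = (g • a : A) := by
          rw [hc.1, map_smul, hk]
        rcases hx : ev (g • k • s.1 : P) with x | x
        · rw [hx] at e1
          exact congrArg Sum.inl e1.symm
        · rw [hx] at e1
          exact absurd (e1 ▸ x.2) hga
    have e1 : t (ev (k • s.1 : P)) = a' := (hc.1 _).trans hk
    have hS' : S (k • s.1) := hS k s.1 s.2
    rcases hx : ev (k • s.1 : P) with x | x
    · rw [hx] at e1
      refine hS'.1 a (key s₀ inl hs₀ (fun _ _ => rfl) (hx.trans ?_))
      exact congrArg Sum.inl e1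
    · rw [hx] at e1
      refine hS'.2 a (key s₁ σ hs₁ hσ0 (hx.trans ?_))
      exact (congrArg Sum.inr (Subtype.ext e1)).trans (hσ1 a' haa).symm
  · have hr : ∀ x, r.1 x = 1 := by
      rintro (x | x)
      · exact hφ x
      · exact hψ x.1
    exact Subtype.ext (funext fun s => hr _)
  · rw [hχ, nCls_step p hc, ← nCls_sum, ← nCls_sum]
    refine (nCls_eq (desc (desc s₀ s₁) (partMap S hS)) ⟨?_, fun s => ?_⟩ ?_ ?_).symm
    · rintro ((x | x) | x) ((y | y) | y) hxy
      · have hxy : s₀ x = s₀ y := hxy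
        exact congrArg (Sum.inl ∘ Sum.inl) (by rw [← (hs₀ x).1, hxy, (hs₀ y).1])
      · exact absurd hxy (hne x y)
      · exact absurd hxy (y.2.1 x)
      · exact absurd hxy.symm (hne y x)
      · have hxy : s₁ x = s₁ y := hxy
        exact congrArg (Sum.inl ∘ Sum.inr) (by rw [← (hs₁ x).1, hxy, (hs₁ y).1])
      · exact absurd hxy (y.2.2 x)
      · exact absurd hxy.symm (x.2.1 y)
      · exact absurd hxy.symm (x.2.2 y)
      · exact congrArg Sum.inr (Subtype.ext hxy)
    · by_cases h2 : ∃ x, s₀ x = s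
      · obtain ⟨x, rfl⟩ := h2
        exact ⟨Sum.inl (Sum.inl x), rfl⟩
      · by_cases h3 : ∃ x, s₁ x = s
        · obtain ⟨x, rfl⟩ := h3
          exact ⟨Sum.inl (Sum.inr x), rfl⟩
        · exact ⟨Sum.inr ⟨s, fun x hx => h2 ⟨x, hx⟩, fun x hx => h3 ⟨x, hx⟩⟩, rfl⟩
    · rintro ((x | x) | x)
      · exact congrArg p (hs₀ x).1
      · exact congrArg p (hs₁ x).1
      · rfl
    · rintro ((x | x) | x)
      · have e1 := (ev1 _).symm.trans ((hs₀ x).2 1)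
        rw [one_smul] at e1
        exact congrArg r.1 e1
      · have e1 := (ev1 _).symm.trans ((hs₁ x).2 1)
        rw [one_smul] at e1
        refine (congrArg r.1 e1).trans ?_
        by_cases hx : ∃ h : H, h • a' = x
        · exact congrArg r.1 (hσ1 x hx)
        · exact (congrArg r.1 (hσ0 x hx)).trans (h0 x hx).1.symm
      · rfl

end Relabel

/-! ### Labels reduce to the label `1` -/

section Range

variable {G : Type} [Group G] {H : Subgroup G}

open Classical in
/-- The label which agrees with `φ` off the `H`-orbit of `a`, and is `v` on this orbit. -/
noncomputable def InvFun.update {A : FinGSet G} (φ : InvFun H (A.restrict H)) (a : A) (v : ℤ) :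
    InvFun H (A.restrict H) :=
  ⟨fun x => if ∃ h : H, h • (show A.restrict H from a) = x then v else φ.1 x, fun h x => by
    by_cases hx : ∃ k : H, k • (show A.restrict H from a) = x
    · exact (if_pos (exists_smul_eq_smul h x hx)).trans (if_pos hx).symm
    · exact ((if_neg (not_exists_smul_eq_smul h x hx)).trans (φ.2 h x)).trans (if_neg hx).symm⟩

theorem InvFun.update_of_mem {A : FinGSet G} (φ : InvFun H (A.restrict H)) {a : A} (v : ℤ) {x : A}
    (hx : ∃ h : H, (h : G) • a = x) : (φ.update a v).1 x = v := if_pos hx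

theorem InvFun.update_of_notMem {A : FinGSet G} (φ : InvFun H (A.restrict H)) {a : A} (v : ℤ)
    {x : A} (hx : ¬ ∃ h : H, (h : G) • a = x) : (φ.update a v).1 x = φ.1 x := if_neg hx

theorem InvFun.update_self {A : FinGSet G} (φ : InvFun H (A.restrict H)) (a : A) :
    φ.update a (φ.1 a) = φ := by
  refine Subtype.ext (funext fun x : A => ?_)
  by_cases hx : ∃ h : H, (h : G) • a = x
  · obtain ⟨h, rfl⟩ := hx
    exact (φ.update_of_mem _ ⟨h, rfl⟩).trans (φ.2 h a).symm
  · exact φ.update_of_notMem _ hx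

variable [Finite G]

/-- For a transitive `G`-set, the labels at one `H`-orbit for which the class is in the range of `phi`
are closed under the group operations, modulo sets with smaller stabilizers. So the label at this
orbit may be replaced by `1`, and then the next orbit may be treated. -/
theorem nCls_mem_range_of_transitive {Y A : FinGSet G} (p : A →[G] Y) {a : A}
    (ha : ∀ x, ∃ g : G, g • a = x) (φ : InvFun H (A.restrict H))
    (ih : ∀ (P : FinGSet G) (q : P →[G] Y) (r : InvFun H (P.restrict H)),
      (∀ s : P, Nat.card (MulAction.stabilizer G s) < Nat.card (MulAction.stabilizer G a)) →
        nCls P q r ∈ (phi H Y).range) : nCls A p φ ∈ (phi H Y).range := by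
  induction hN : Nat.card {x : A // φ.1 x ≠ 1} using Nat.strong_induction_on generalizing φ with
  | _ N ih' =>
  subst hN
  by_cases hφ : ∀ x : A, φ.1 x = 1
  · have h1 : φ = InvFun.one _ := Subtype.ext (funext hφ)
    exact ⟨bOf Y (gcls A p), by rw [phi_bOf, h1]⟩
  push Not at hφ
  obtain ⟨b, hb⟩ := hφ
  obtain ⟨k, rfl⟩ := ha b
  have hb' : ∀ x, ∃ g : G, g • k • a = x := fun x => by
    obtain ⟨g, rfl⟩ := ha x
    exact ⟨g * k⁻¹, by rw [mul_smul, inv_smul_smul]⟩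
  have hadd : ∀ u v : ℤ, nCls A p (φ.update (k • a) u) ∈ (phi H Y).range →
      (nCls A p (φ.update (k • a) v) ∈ (phi H Y).range ↔
        nCls A p (φ.update (k • a) (u + v)) ∈ (phi H Y).range) := by
    intro u v hu
    obtain ⟨P, q, r, hP, -, h⟩ := exists_nCls_add p hb' (φ := φ.update (k • a) u)
      (ψ := φ.update (k • a) v) (χ := φ.update (k • a) (u + v))
      (fun x hx => by
        rw [InvFun.update_of_notMem _ _ hx, InvFun.update_of_notMem _ _ hx,
          InvFun.update_of_notMem _ _ hx]
        exact ⟨rfl, rfl⟩)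
      (fun x hx => by
        rw [InvFun.update_of_mem _ _ hx, InvFun.update_of_mem _ _ hx,
          InvFun.update_of_mem _ _ hx])
    rw [h, add_mem_cancel_right (ih P q r fun s => by
      rw [← card_stabilizer_smul k a]; exact hP s), add_mem_cancel_left hu]
  have h1 : nCls A p (φ.update (k • a) 1) ∈ (phi H Y).range := by
    refine ih' _ ?_ _ rfl
    refine Set.ncard_lt_ncard (s := {x : A | (φ.update (k • a) 1).1 x ≠ 1})
      (t := {x : A | φ.1 x ≠ 1}) ⟨fun x hx => ?_, fun h => ?_⟩ (Set.toFinite _)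
    · by_cases hx' : ∃ h : H, (h : G) • k • a = x
      · exact absurd (φ.update_of_mem 1 hx') hx
      · exact fun h => hx ((φ.update_of_notMem 1 hx').trans h)
    · exact h hb (φ.update_of_mem 1 ⟨1, one_smul G _⟩)
  have h2 : ∀ v : ℤ, nCls A p (φ.update (k • a) v) ∈ (phi H Y).range := by
    intro v
    induction v using Int.induction_on with
    | zero => exact (hadd 1 0 h1).2 h1
    | succ i hi => rw [add_comm]; exact (hadd 1 _ h1).1 hi
    | pred i hi => exact (hadd 1 _ h1).2 (by rwa [add_sub_cancel])
  rw [← φ.update_self (k • a)]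
  exact h2 _

theorem nCls_mem_range_of_lt {Y : FinGSet G} (n : ℕ) : ∀ {A : FinGSet G} (p : A →[G] Y)
    (φ : InvFun H (A.restrict H)), (∀ a : A, Nat.card (MulAction.stabilizer G a) < n) →
    nCls A p φ ∈ (phi H Y).range := by
  induction n with
  | zero =>
    intro A p φ hA
    rw [nCls_of_isEmpty p φ ⟨fun a => Nat.not_lt_zero _ (hA a)⟩]
    exact zero_mem _
  | succ n ih =>
    intro A p φ hA
    induction hN : Nat.card A using Nat.strong_induction_on generalizing A with
    | _ N ih' =>
    subst hN
    rcases isEmpty_or_nonempty A with hA0 | ⟨⟨a⟩⟩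
    · rw [nCls_of_isEmpty p φ hA0]
      exact zero_mem _
    rw [nCls_orb p φ a]
    refine add_mem (nCls_mem_range_of_transitive _ (orb_transitive a) _ fun P q r hP =>
      ih q r fun s => (hP s).trans_le (Nat.le_of_lt_succ ?_)) (ih' _ ?_ _ _ (fun c => ?_) rfl)
    · rw [stabilizer_part]; exact hA a
    · have e1 := card_offOrb a
      have e2 := card_orb_pos a
      omega
    · rw [stabilizer_part]; exact hA _

/-- The value of the norm of `ℤ` is generated by the classes of `G`-sets with label `1`. -/
theorem phi_surjective (H : Subgroup G) (Y : FinGSet G) : Function.Surjective (phi H Y) := by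
  intro x
  obtain ⟨A, p, φ, rfl⟩ := nCls_ind x
  exact nCls_mem_range_of_lt (Nat.card G + 1) p φ fun a =>
    Nat.lt_succ_of_le (Subgroup.card_le_card_group _)

/-- For a transitive `G`-set whose point `a` is fixed by `H`, the label which is the order of `H`
at `a` and `1` elsewhere is a transfer of the label `1` along a map whose fibre over `a` is a free
`H`-orbit. As `H` has no fixed points there, all stabilizers of the coinduced set are smaller than
the one of `a`. -/
theorem exists_nCls_eq_one [Nontrivial H] {Y A : FinGSet G} (p : A →[G] Y) {a : A}
    (ha : ∀ x, ∃ g : G, g • a = x) (haH : ∀ h : H, (h : G) • a = a)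
    {χ : InvFun H (A.restrict H)} (h0 : ∀ x : A, x ≠ a → χ.1 x = 1)
    (h1 : χ.1 a = Nat.card H) :
    ∃ (P : FinGSet G) (q : P →[G] Y),
      (∀ s : P, Nat.card (MulAction.stabilizer G s) < Nat.card (MulAction.stabilizer G a)) ∧
      nCls A p χ = nCls P q (InvFun.one _) := by
  classical
  let a' : A.restrict H := a
  let c : (⟨H⟩ : FinGSet H) →[H] A.restrict H := ⟨fun _ => a', fun h _ => (haH h).symm⟩
  let t : (offOrb a').sum (⟨H⟩ : FinGSet H) →[H] A.restrict H := desc (partMap _ _) c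
  have horb : ∀ x : A, (∃ h : H, h • a' = x) ↔ x = a := fun x =>
    ⟨fun ⟨h, hh⟩ => hh.symm.trans (haH h), fun h => ⟨1, (one_smul H a').trans h.symm⟩⟩
  have hχ : χ = (InvFun.one _).tr t := by
    refine Subtype.ext (funext fun x => ?_)
    have e1 : (((InvFun.one ((offOrb a').sum (⟨H⟩ : FinGSet H))).res inl).tr (partMap _ _)).1 x =
        if ¬ (∃ h : H, h • a' = x) then 1 else 0 :=
      InvFun.tr_partMap (S := fun x => ¬ ∃ h : H, h • a' = x) _ (InvFun.one (A.restrict H))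
        (fun _ => rfl) x
    refine Eq.trans ?_ (InvFun.tr_desc (partMap _ _) c (InvFun.one _) x).symm
    rw [e1, InvFun.tr_apply]
    by_cases hx : x = a'
    · subst hx
      rw [if_neg (not_not.2 ((horb x).2 rfl)), zero_add, h1]
      have : Fintype {y // c y = x} := Fintype.ofFinite _
      rw [finsum_eq_sum_of_fintype]
      refine Eq.trans ?_ (Finset.sum_const (1 : ℤ)).symm
      rw [nsmul_one, Finset.card_univ, ← Nat.card_eq_fintype_card]
      exact congrArg _ (Nat.card_congr (Equiv.subtypeUnivEquiv fun _ => rfl)).symm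
    · rw [if_pos (fun h => hx ((horb x).1 h)), h0 x hx]
      have : IsEmpty {y // c y = x} := ⟨fun y => hx y.2.symm⟩
      rw [finsum_of_isEmpty]
      rfl
  obtain ⟨P, ev, π, hc⟩ := exists_isCoind t
  refine ⟨P, p.comp π, fun s => ?_, by rw [hχ, nCls_step p hc]; rfl⟩
  by_contra hlt
  obtain ⟨k, hk, hfix⟩ := exists_smul_fixed π ha hlt
  have e1 : t (ev (k • s : P)) = a' := (hc.1 _).trans hk
  have e2 : ∀ h : H, h • ev (k • s : P) = ev (k • s : P) := fun h =>
    (map_smul ev h (k • s : P)).symm.trans (congrArg ev (hfix h (haH h)))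
  rcases hx : ev (k • s : P) with x | x
  · rw [hx] at e1
    exact x.2 ((horb _).2 e1)
  · obtain ⟨h, hh⟩ := exists_ne (1 : H)
    have e3 := e2 h
    rw [hx] at e3
    exact hh (mul_eq_right.1 (Sum.inr_injective e3))

end Range

/-! ### The relation `2 = [D_{2m}/μ_m]` in the norm -/

section Relation

theorem card_refl (m : ℕ) : Nat.card (refl m) = 2 := by
  rw [Nat.card_zpowers, orderOf_sr]

variable {m : ℕ} [NeZero m] {Y : FinGSet (DihedralGroup m)}

/-- Two points with the same stabilizer, consisting of rotations, lie over each point of `A` in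
`A × D_{2m}/μ_m`. -/
theorem dMul_bOf_eq_zero {A : FinGSet (DihedralGroup m)} (p : A →[DihedralGroup m] Y)
    (hA : ∀ (a : A), ∀ g : DihedralGroup m, g • a = a → g ∈ rot m) :
    dMul Y (bOf Y (gcls A p)) = 0 := by
  classical
  refine ghost_ext fun K y hy => ?_
  rw [dMul_apply, map_sub, map_nsmul, Pi.sub_apply, Pi.smul_apply, ghost_burnsideMul _ hy,
    ghost_bOf, marks_gcls]
  split_ifs with hK
  · simp
  · have h1 : fixCount p (K, y) = 0 := by
      by_contra h2
      obtain ⟨a, -, ha⟩ := fixCount_ne_zero.1 h2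
      exact hK fun g hg => hA a g (ha g hg)
    simp [h1]

/-- The relation `2 [A] = [D_{2m}/μ_m] [A]` in the norm for a transitive `A` with a point fixed by `τ`,
provided that the relation holds for all sets with smaller stabilizers. -/
theorem phi_dMul_of_transitive (hm : Odd m) {A : FinGSet (DihedralGroup m)}
    (p : A →[DihedralGroup m] Y) {a : A} (ha : ∀ x, ∃ g : DihedralGroup m, g • a = x)
    (hτ : (sr 0 : DihedralGroup m) • a = a)
    (ih : ∀ (C : FinGSet (DihedralGroup m)) (r : C →[DihedralGroup m] Y),
      (∀ c : C, Nat.card (MulAction.stabilizer (DihedralGroup m) c) <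
        Nat.card (MulAction.stabilizer (DihedralGroup m) a)) →
      phi (refl m) Y (dMul Y (bOf Y (gcls C r))) = 0) :
    phi (refl m) Y (dMul Y (bOf Y (gcls A p))) = 0 := by
  have haH : ∀ h : refl m, (h : DihedralGroup m) • a = a := by
    rintro ⟨h, hh⟩
    rcases mem_refl.1 hh with rfl | rfl
    · exact one_smul _ a
    · exact hτ
  have : Nontrivial (refl m) := Finite.one_lt_card_iff_nontrivial.1 (by rw [card_refl]; norm_num)
  have hmem : ∀ x : A, (∃ h : refl m, (h : DihedralGroup m) • a = x) ↔ x = a := fun x =>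
    ⟨fun ⟨h, hh⟩ => hh.symm.trans (haH h), fun h => ⟨1, (one_smul _ a).trans h.symm⟩⟩
  let χ : InvFun (refl m) (A.restrict (refl m)) := (InvFun.one _).update a 2
  have hχ0 : ∀ x : A, x ≠ a → χ.1 x = 1 := fun x hx =>
    InvFun.update_of_notMem _ _ fun h => hx ((hmem x).1 h)
  have hχ1 : χ.1 a = 2 := InvFun.update_of_mem _ _ ((hmem a).2 rfl)
  -- The class with label `χ`, computed in two ways.
  obtain ⟨P, q, r, hP, hr, h1⟩ := exists_nCls_add p ha (φ := InvFun.one _) (ψ := InvFun.one _)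
    (χ := χ) (fun x hx => ⟨rfl, hχ0 x fun h => hx ((hmem x).2 h)⟩) (fun x hx => by
      rw [(hmem x).1 hx, hχ1]; rfl)
  obtain ⟨P', q', hP', h2⟩ := exists_nCls_eq_one p ha haH hχ0 (by rw [hχ1, card_refl]; rfl)
  rw [hr (fun _ => rfl) fun _ => rfl, h2, ← phi_bOf, ← phi_bOf, ← phi_bOf] at h1
  have h3 := congrArg (psiHom hm Y) h1
  rw [map_add, map_add, psiHom_phi, psiHom_phi, psiHom_phi] at h3
  have h4 := rotRes_dMul (bOf Y (gcls A p))
  rw [dMul_apply, burnsideMul_bOf, map_sub, two_nsmul, map_add, sub_eq_zero] at h4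
  have hpos : 0 < Nat.card (MulAction.stabilizer (DihedralGroup m) a) := Nat.card_pos
  have h5 := map_eq_of_rotRes_eq hm (phi (refl m) Y)
    (Nat.card (MulAction.stabilizer (DihedralGroup m) a) - 1)
    (fun C r hC => ih C r fun c => by have := hC c; omega)
    (A := (A.prod (orient m)).sum P) (p := desc (p.comp fst) q) (q := q')
    (card_stabilizer_sum_le (fun s => Nat.le_sub_one_of_lt ?_) fun s =>
      Nat.le_sub_one_of_lt (hP s)) (fun s => Nat.le_sub_one_of_lt (hP' s))
    (by rw [← gcls_add, map_add, map_add, h3, h4])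
  · rw [← gcls_add, map_add, map_add, h1] at h5
    rw [dMul_apply, burnsideMul_bOf, two_nsmul, map_sub, map_add, add_right_cancel h5, sub_self]
  · by_contra hlt
    obtain ⟨k, -, hfix⟩ := exists_smul_fixed (fst : A.prod (orient m) →[DihedralGroup m] A) ha hlt
    exact sr_notMem_rot 0 ((smul_orient_eq_iff _).1 (congrArg Prod.snd (hfix _ hτ)))

theorem phi_dMul_of_lt (hm : Odd m) (n : ℕ) : ∀ {A : FinGSet (DihedralGroup m)}
    (p : A →[DihedralGroup m] Y),
    (∀ a : A, Nat.card (MulAction.stabilizer (DihedralGroup m) a) < n) →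
    phi (refl m) Y (dMul Y (bOf Y (gcls A p))) = 0 := by
  induction n with
  | zero =>
    intro A p hA
    rw [gcls_of_isEmpty p ⟨fun a => Nat.not_lt_zero _ (hA a)⟩, map_zero, map_zero, map_zero]
  | succ n ih =>
    intro A p hA
    induction hN : Nat.card A using Nat.strong_induction_on generalizing A with
    | _ N ih' =>
    subst hN
    rcases isEmpty_or_nonempty A with hA0 | ⟨⟨a⟩⟩
    · rw [gcls_of_isEmpty p hA0, map_zero, map_zero, map_zero]
    have h2 := ih' _ (by
      have e1 := card_offOrb a
      have e2 := card_orb_pos a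
      omega) (A := offOrb a) (p.comp (partMap _ _)) (fun c => by
        rw [stabilizer_part]; exact hA _) rfl
    rw [gcls_orb p a, map_add, map_add, map_add, h2, add_zero]
    by_cases h3 : ∀ g : DihedralGroup m, g • a = a → g ∈ rot m
    · rw [dMul_bOf_eq_zero, map_zero]
      intro x g hg
      obtain ⟨k, rfl⟩ := orb_transitive a x
      have hk : (k⁻¹ * g * k⁻¹⁻¹) • a = a := by
        rw [inv_inv, mul_smul, mul_smul, inv_smul_eq_iff]
        exact (part_smul_eq_iff _ _).1 hg
      exact conj_mem_rot.1 (h3 _ hk)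
    · push Not at h3
      obtain ⟨g, hga, hg⟩ := h3
      -- All reflections are conjugate, so the orbit has a point fixed by the chosen reflection.
      obtain ⟨l, -, h4⟩ := conj_rot hm hg (sr_notMem_rot 0)
      set u := (sr 0 * g) ^ l
      refine phi_dMul_of_transitive hm _ (a := u • orbPt a) (fun x => ?_) ?_ fun C r hC =>
        ih r fun c => (hC c).trans_le (Nat.le_of_lt_succ ?_)
      · obtain ⟨k, rfl⟩ := orb_transitive a x
        exact ⟨k * u⁻¹, by rw [mul_smul, inv_smul_smul]⟩
      · rw [← h4, mul_smul, mul_smul, inv_smul_smul]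
        exact congrArg (u • ·) ((part_smul_eq_iff _ _).2 hga)
      · rw [card_stabilizer_smul, stabilizer_part]
        exact hA a

theorem phi_eq_zero_of_rotRes_eq_zero (hm : Odd m) {κ : BurnsideGroup Y} (h : rotRes Y κ = 0) :
    phi (refl m) Y κ = 0 :=
  map_eq_zero_of_rotRes_eq_zero hm _ (fun _ r => phi_dMul_of_lt hm (Nat.card (DihedralGroup m) + 1) r
    fun _ => Nat.lt_succ_of_le (Subgroup.card_le_card_group _)) h

theorem psi_bijective (hm : Odd m) :
    Function.Bijective (psi hm : NormZ (refl m) Y → (burnsideQuot m).obj Y) := by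
  constructor
  · intro x y hxy
    obtain ⟨κ, hκ⟩ := phi_surjective (refl m) Y (x - y)
    have h1 : psiHom hm Y (x - y) = 0 := by
      rw [map_sub, sub_eq_zero]
      exact congrArg (quotRotRes Y) hxy
    rw [← hκ, psiHom_phi] at h1
    rw [phi_eq_zero_of_rotRes_eq_zero hm h1] at hκ
    exact sub_eq_zero.1 hκ.symm
  · intro x
    induction x using Quotient.ind with | _ κ =>
    exact ⟨phi (refl m) Y κ, quotRotRes_injective hm Y (psiHom_phi hm κ)⟩

end Relation

theorem mainTheorem9 (m : ℕ) [NeZero m] (hm : Odd m) :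
    Nonempty (TambaraFunctor.Iso
      (TambaraFunctor.norm (Subgroup.zpowers (DihedralGroup.sr 0 : DihedralGroup m))
        (constZ (Subgroup.zpowers (DihedralGroup.sr 0 : DihedralGroup m))))
      ((burnside (DihedralGroup m)).quotientBy (X₀ := pt (DihedralGroup m))
        (2 • burnsideCls (pt (DihedralGroup m)) -
          burnsideCls (orbit (Subgroup.zpowers (DihedralGroup.r 1 : DihedralGroup m)))))) ∧
    ∀ (X : FinGSet (DihedralGroup m)) (x y : BurnsideGroup X),
      (burnside (DihedralGroup m)).toQuotient (X₀ := pt (DihedralGroup m))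
          (2 • burnsideCls (pt (DihedralGroup m)) -
            burnsideCls (orbit (Subgroup.zpowers (DihedralGroup.r 1 : DihedralGroup m)))) x =
        (burnside (DihedralGroup m)).toQuotient (X₀ := pt (DihedralGroup m))
          (2 • burnsideCls (pt (DihedralGroup m)) -
            burnsideCls (orbit (Subgroup.zpowers (DihedralGroup.r 1 : DihedralGroup m)))) y ↔
      ∃ z : BurnsideGroup X,
        x - y = 2 • z -
          burnsideMul (orbit (Subgroup.zpowers (DihedralGroup.r 1 : DihedralGroup m))) z :=
  ⟨⟨{ equiv := fun _ => Equiv.ofBijective (psi hm) (psi_bijective hm)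
      map_res := fun f x => psi_res hm f x
      map_tr := fun f x => psi_tr hm f x
      map_nm := fun f x => psi_nm hm f x }⟩,
    fun _ _ _ => toQuotient_eq_iff_exists hm⟩
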